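/- **Setting.** For a real potential $V\in\widehat H^1\cap C^2(\mathbb R)$, where $\widehat H^1=\{V\in H^1(\mathbb R):\langle x\rangle V\in L^2\}$, $\langle x\rangle=(1+x^2)^{1/2}$ and $\|V\|_{\widehat H^1}^2=\|V\|_{H^1}^2+\|\langle x\rangle V\|_{L^2}^2$, let $w=(w_j)_{j\ge1}$ be the increasing sequence of the (simple) eigenvalues of $-\partial_{xx}+x^2+V$ on $L^2(\mathbb R)$. For $n\ge 1$ and $j,\ell\in(\mathbb N^*)^n$ let $\kappa(j,\ell)\in\mathbb N^*\cup\{\infty\}$ be the smallest $s$ whose multiplicities in $(j_1,\dots,j_n)$ and in $(\ell_1,\dots,\ell_n)$ differ ($\kappa=\infty$ if there is none). For $\beta>0$ and $N\ge1$, $w$ is called non-resonant at order $n$ up to the mode $N$ with constant $\beta$ if $$\kappa(j,\ell)\le N\implies |w_{j_1}+\cdots+w_{j_n}-w_{\ell_1}-\cdots-w_{\ell_n}|\ge\beta\qquad\text{for all } j,\ell\in(\mathbb N^*)^n .$$ For an integer $M\ge2$ and $u\in\mathbb C^M$ put $\|u\|_{h^s}^2=\sum_{k=1}^M\langle k\rangle^{2s}|u_k|^2$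 and $B_M(\varepsilon)=\{u\in\mathbb C^M:\|u\|_{h^{1/2}}<\varepsilon\}$. Let $(u,v)_{\ell^2}=\sum_k\mathrm{Re}\,\overline{u_k}v_k$, $\nabla H=(2\partial_{\overline{u_k}}H)_k$ and $\{H,K\}=(i\nabla H,\nabla K)_{\ell^2}$. A map $\tau$ is symplectic if $(i\,\mathrm d\tau(u)v,\mathrm d\tau(u)v')_{\ell^2}=(iv,v')_{\ell^2}$ for all $u$ in its domain and all $v,v'\in\mathbb C^M$. Let $\mathscr H^{2n}_M$ be the set of functions $$H(u)=\sum_{j,\ell\in\{1,\dots,M\}^n}H_{j,\ell}\,u_{j_1}\cdots u_{j_n}\overline{u_{\ell_1}}\cdots\overline{u_{\ell_n}}$$ with $H_{j,\ell}=\overline{H_{\ell,j}}$ and $H_{j,\ell}$ invariant under permutations of the entries of $j$ and of $\ell$, and let $\|H\|_{\mathscr H}=\sup_{j,\ell}|H_{j,\ell}|$. **Theorem.** Let $p,r\ge1$. There is $b>0$ depending only on $r$ and $p$, and for all $C_0,\beta,\rho>0$ there is $C>0$ depending only on $(C_0,r,p,\beta,\rho)$, such that the following holds. Let $N\ge1$,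 let $V\in\widehat H^1\cap C^2$ with $\|V\|_{\widehat H^1}\le\rho$ be such that the eigenvalues $w$ are non-resonant at order $r+p$ up to the mode $N$ with constant $\beta$, let $M\ge2$, $Z_2(u)=\frac12\sum_{j=1}^Mw_j|u_j|^2$, and let $P\in\mathscr H^{2p+2}_M$ with $\|P\|_{\mathscr H}\le C_0$. Then there are $\varepsilon_0\ge 1/(C(\log M)^b)$ and smooth symplectic maps $\tau^{(0)}:B_M(\varepsilon_0)\to B_M(2\varepsilon_0)$ and $\tau^{(1)}:B_M(2\varepsilon_0)\to\mathbb C^M$ with $\tau^{(1)}\circ\tau^{(0)}=\mathrm{id}$ on $B_M(\varepsilon_0)$ such that, for $\sigma\in\{0,1\}$ and $u\in B_M(2^\sigma\varepsilon_0)$, $$\|\tau^{(\sigma)}(u)-u\|_{h^{1/2}}\le\Big(\frac{\|u\|_{h^{1/2}}}{2^\sigma\varepsilon_0}\Big)^{2p}\|u\|_{h^{1/2}},\qquad \|\mathrm d\tau^{(\sigma)}(u)\|_{\mathscr L(h^{1/2})}\le4^r,\qquad \|\mathrm d\tau^{(\sigma)}(u)\|_{\mathscr L(h^{-1/2})}\le4^r,$$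 and such that on $B_M(2\varepsilon_0)$ $$(Z_2+P)\circ\tau^{(1)}=Z_2+Q+R,\qquad Q=Q^{(2p+2)}+Q^{(2p+4)}+\cdots+Q^{(2r+2p)},\quad Q^{(2n)}\in\mathscr H^{2n}_M,$$ where $\{|u_q|^2,Q\}=0$ on $\mathbb C^M$ for all $1\le q\le\min(N,M)$, and $R$ is smooth on $B_M(2\varepsilon_0)$ with $$\|\nabla R(u)\|_{h^{-1/2}}\le C(\log M)^b\|u\|_{h^{1/2}}^{2r+2p}\qquad\text{for } u\in B_M(2\varepsilon_0).$$ -/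

import Mathlib

open scoped ContDiff

noncomputable section

namespace LowRegBNF

/-! ### Potentials and the spectrum of the perturbed harmonic oscillator -/

/-- `V` is a real potential in `Ĥ¹ ∩ C²`, where `Ĥ¹` is the space of `V ∈ H¹(ℝ)` with
`⟨x⟩ V ∈ L²(ℝ)`. As `V` is `C²`, its weak derivative is the classical one. -/
structure IsPotential (V : ℝ → ℝ) : Prop where
  contDiff : ContDiff ℝ 2 V
  memLp : MeasureTheory.MemLp V 2
  memLp_deriv : MeasureTheory.MemLp (deriv V) 2
  memLp_weight : MeasureTheory.MemLp (fun x : ℝ => √(1 + x ^ 2) * V x) 2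

/-- The norm of `Ĥ¹`: `‖V‖² = ‖V‖²_{H¹} + ‖⟨x⟩ V‖²_{L²}`. -/
def hatH1Norm (V : ℝ → ℝ) : ℝ :=
  √((∫ x, V x ^ 2) + (∫ x, deriv V x ^ 2) + ∫ x : ℝ, (√(1 + x ^ 2) * V x) ^ 2)

/-- `ψ` lies in the domain `Ĥ² = {ψ ∈ H² : ⟨x⟩² ψ ∈ L²}` of `-∂ₓₓ + x² + V` and
`(-∂ₓₓ + x² + V) ψ = Λ ψ`. For continuous `V` such a `ψ` has a `C²` representative, and `ψ` denotes
this representative. -/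
structure IsEigenfunction (V : ℝ → ℝ) (Λ : ℝ) (ψ : ℝ → ℝ) : Prop where
  contDiff : ContDiff ℝ 2 ψ
  memLp : MeasureTheory.MemLp ψ 2
  memLp_deriv : MeasureTheory.MemLp (deriv ψ) 2
  memLp_deriv2 : MeasureTheory.MemLp (deriv (deriv ψ)) 2
  memLp_weight : MeasureTheory.MemLp (fun x : ℝ => (1 + x ^ 2) * ψ x) 2
  eigen : ∀ x : ℝ, -deriv (deriv ψ) x + x ^ 2 * ψ x + V x * ψ x = Λ * ψ x

/-- `w = (Λ_j)_{j ≥ 1}` is the increasing sequence of the (simple) eigenvalues of `-∂ₓₓ + x² + V`: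
the eigenvalues that belong to an orthonormal basis `(ψ_j)_{j ≥ 1}` of `L²(ℝ)` that consists of
eigenfunctions. -/
def IsSpectrum (V : ℝ → ℝ) (w : ℕ+ → ℝ) : Prop :=
  StrictMono w ∧
    ∃ e : HilbertBasis ℕ+ ℝ (MeasureTheory.Lp ℝ 2 (MeasureTheory.volume : MeasureTheory.Measure ℝ)),
      ∀ j : ℕ+, ∃ ψ : ℝ → ℝ, IsEigenfunction V (w j) ψ ∧
        (e j : ℝ → ℝ) =ᵐ[MeasureTheory.volume] ψ

/-! ### Non-resonance -/

/-- The multiplicity of `s` in `j` minus its multiplicity in `ℓ`. -/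
def excess {n : ℕ} (j ℓ : Fin n → ℕ+) (s : ℕ+) : ℤ :=
  ∑ i, ((if j i = s then 1 else 0) - (if ℓ i = s then 1 else 0))

/-- `κ(j,ℓ)`: the smallest index that does not cancel between `j` and `ℓ`, and `∞` if all
indices cancel. -/
def kappa {n : ℕ} (j ℓ : Fin n → ℕ+) : ℕ∞ :=
  ⨅ (s : ℕ+) (_ : excess j ℓ s ≠ 0), ((s : ℕ) : ℕ∞)

/-- The small divisor `w_{j₁} + ⋯ + w_{jₙ} - w_{ℓ₁} - ⋯ - w_{ℓₙ}`. -/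
def smallDivisor (w : ℕ+ → ℝ) {n : ℕ} (j ℓ : Fin n → ℕ+) : ℝ :=
  ∑ i, w (j i) - ∑ i, w (ℓ i)

/-- Strong non-resonance at order `n` for the modes up to `N`, with constant `β`. -/
def NonResonant (w : ℕ+ → ℝ) (n N : ℕ) (β : ℝ) : Prop :=
  ∀ j ℓ : Fin n → ℕ+, kappa j ℓ ≤ (N : ℕ∞) → β ≤ |smallDivisor w j ℓ|

/-! ### The phase space `ℂ^⟦1,M⟧` -/

/-- The phase space. The element `k` of `Fin M` stands for the mode `k + 1` of `⟦1,M⟧`. -/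
abbrev Phase (M : ℕ) : Type := Fin M → ℂ

/-- The mode in `⟦1,M⟧` that an element of `Fin M` stands for. -/
def mode {M : ℕ} (k : Fin M) : ℕ+ := Nat.succPNat k

/-- The Japanese bracket `⟨k⟩ = (1 + k²)^{1/2}`. -/
def jap (k : ℕ+) : ℝ := √(1 + ((k : ℕ) : ℝ) ^ 2)

/-- The discrete Sobolev norm of `h^s(⟦1,M⟧)`. -/
def hNorm {M : ℕ} (s : ℝ) (u : Phase M) : ℝ :=
  √(∑ k, jap (mode k) ^ (2 * s) * ‖u k‖ ^ 2)

/-- The open ball of centre `0` and radius `ε` for the norm of `h^{1/2}`. -/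
def hBall (M : ℕ) (ε : ℝ) : Set (Phase M) := {u | hNorm (1 / 2) u < ε}

/-- The real scalar product of `ℓ²(⟦1,M⟧)`. -/
def l2 {M : ℕ} (u v : Phase M) : ℝ := ∑ k, ((starRingEnd ℂ) (u k) * v k).re

/-- The gradient `∇H(u) = 2 (∂_{ū_k} H(u))_k`, where `2 ∂_{z̄} = ∂_{Re z} + i ∂_{Im z}`. -/
def grad {M : ℕ} (H : Phase M → ℝ) (u : Phase M) : Phase M := fun k =>
  (fderiv ℝ H u (Pi.single k 1) : ℂ) + Complex.I * (fderiv ℝ H u (Pi.single k Complex.I) : ℂ)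

/-- The Poisson bracket `{H,K}(u) = (i ∇H(u), ∇K(u))_{ℓ²}`. -/
def poisson {M : ℕ} (H K : Phase M → ℝ) (u : Phase M) : ℝ :=
  l2 (Complex.I • grad H u) (grad K u)

/-- `τ` preserves the symplectic form `(i ·, ·)_{ℓ²}` on the open set `U`, where it is smooth. -/
structure IsSmoothSymplecticOn {M : ℕ} (τ : Phase M → Phase M) (U : Set (Phase M)) : Prop where
  smooth : ContDiffOn ℝ ∞ τ U
  symplectic : ∀ u ∈ U, ∀ v w : Phase M,
    l2 (Complex.I • fderiv ℝ τ u v) (fderiv ℝ τ u w) = l2 (Complex.I • v) w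

/-! ### Hamiltonians -/

/-- The class `𝓗^{2n}_M`, given by the coefficients `H_{j,ℓ}`, which are unique. -/
structure Ham (M n : ℕ) where
  coeff : (Fin n → Fin M) → (Fin n → Fin M) → ℂ
  reality : ∀ j ℓ, coeff j ℓ = (starRingEnd ℂ) (coeff ℓ j)
  symmetry : ∀ (φ ψ : Equiv.Perm (Fin n)) (j ℓ), coeff (j ∘ φ) (ℓ ∘ ψ) = coeff j ℓ

/-- The sum `∑_{j,ℓ} H_{j,ℓ} u_{j₁} ⋯ u_{jₙ} ū_{ℓ₁} ⋯ ū_{ℓₙ}`. -/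
def Ham.sum {M n : ℕ} (H : Ham M n) (u : Phase M) : ℂ :=
  ∑ j, ∑ ℓ, H.coeff j ℓ * (∏ i, u (j i)) * ∏ i, (starRingEnd ℂ) (u (ℓ i))

/-- The sum is real. -/
theorem Ham.sum_im {M n : ℕ} (H : Ham M n) (u : Phase M) : (H.sum u).im = 0 := by
  rw [← Complex.conj_eq_iff_im]
  simp only [Ham.sum, map_sum, map_mul, map_prod, Complex.conj_conj, ← H.reality]
  rw [Finset.sum_comm]
  refine Finset.sum_congr rfl fun j _ => Finset.sum_congr rfl fun ℓ _ => ?_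
  ring

/-- The function on phase space that a Hamiltonian of the class defines. -/
def Ham.eval {M n : ℕ} (H : Ham M n) (u : Phase M) : ℝ := (H.sum u).re

/-- The norm `‖H‖_𝓗 = sup_{j,ℓ} |H_{j,ℓ}|`. -/
def Ham.norm {M n : ℕ} (H : Ham M n) : ℝ :=
  ⨆ jℓ : (Fin n → Fin M) × (Fin n → Fin M), ‖H.coeff jℓ.1 jℓ.2‖

/-- The quadratic Hamiltonian `Z₂(u) = ½ ∑ w_j |u_j|²`. -/
def Z2 (w : ℕ+ → ℝ) {M : ℕ} (u : Phase M) : ℝ := (1 / 2) * ∑ k, w (mode k) * ‖u k‖ ^ 2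

/-- The action `|u_q|²`. -/
def action {M : ℕ} (q : Fin M) (u : Phase M) : ℝ := ‖u q‖ ^ 2

end LowRegBNF

end

/-! The change of variables comes from one polynomial generator χ in a single step, instead of a
composition of Lie flows. Let Y be half of the Hamiltonian vector field of χ. The map τ₁ sends m −
Y(m) to m + Y(m). Its differential is the Cayley transform of dY, and dY is infinitesimally
symplectic, so τ₁ is symplectic (`exists_cayley`, `vfield_antisymm`). Replacing Y by −Y exchanges
the two endpoints and gives the inverse τ₀.

The gain is an exact energy identity. Since Z₂ is quadratic, Z₂(m + Y) − Z₂(m − Y) equals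
dZ₂(X_χ)(m) without any higher-order term (`Z2_add_sub`). Therefore (Z₂ + P) ∘ τ₁ = Z₂ + Q + R,
where R at u = m − Y(m) is the value at m of the polynomial E = `homOp w χ` + P(m + Y) − Q(m − Y)
(`IsNormalForm.energy_eq`). Making R small is a purely algebraic problem: find χ and Q such that E
has high order. It is solved degree by degree (`IsNormalForm.step`): the lowest-degree part of E is
divided by the small divisors where it is not resonant, and put into Q where it is resonant. All
polynomials are real and gauge invariant, so only even degrees occur.

The estimates must lose only powers of log M. The eigenvalues are w_k = 2k − 1 + O(ρ)
(`IsSpectrum.abs_sub_le`), by a min-max comparison with the harmonic oscillator, whose Hermite basis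
is constructed here, and by the bound of sup |V| by the Ĥ¹ norm. So a small divisor bounded below by
β also controls the integer Σ ±k of the monomial: 1 + |Σ ±k| ≤ K |Ω| with K of size log M
(`exists_isControl`). The coefficients of χ thus carry the kernel 1/(1 + |Σ ±k|), whose sum over one
index is again O(log M).

This kernel serves twice. In ℓ¹ it bounds the substitutions m ± Y, so that majorants on the unit
simplex stay bounded by powers of K (`majLE_aeval_shift`). Through Schur's test it bounds dY on
h^{1/2} and on h^{-1/2} (`sum_sum_maj_le`). Finally h^{1/2} embeds into ℓ¹ up to a logarithm,
because Σ 1/⟨k⟩ = O(log M) (`sum_le_wNorm`), and this yields the gradient bound for R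
(`abs_fderiv_reEval_le`). -/

noncomputable section

namespace LowRegBNF

open MvPolynomial

/-! ### Majorants of polynomials -/

section Majorant

variable {σ τ : Type*} [Fintype σ] [Fintype τ]

/-- The monomial `x^γ`. -/
def mon (x : σ → ℝ) (γ : σ →₀ ℕ) : ℝ := ∏ i, x i ^ γ i

/-- The majorant `∑_γ |f_γ| x^γ` of the polynomial `f`. -/
def maj (f : MvPolynomial σ ℂ) (x : σ → ℝ) : ℝ := ∑ γ ∈ f.support, ‖f.coeff γ‖ * mon x γ

theorem mon_nonneg {x : σ → ℝ} (hx : 0 ≤ x) (γ : σ →₀ ℕ) : 0 ≤ mon x γ :=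
  Finset.prod_nonneg fun i _ => pow_nonneg (hx i) _

theorem mon_add (x : σ → ℝ) (γ δ : σ →₀ ℕ) : mon x (γ + δ) = mon x γ * mon x δ := by
  simp [mon, pow_add, Finset.prod_mul_distrib]

@[simp] theorem mon_zero (x : σ → ℝ) : mon x 0 = 1 := by simp [mon]

@[simp] theorem mon_single (x : σ → ℝ) (i : σ) (n : ℕ) : mon x (Finsupp.single i n) = x i ^ n := by
  classical
  rw [mon, Finset.prod_eq_single i] <;> simp +contextual [eq_comm]

theorem degree_eq_sum (γ : σ →₀ ℕ) : γ.degree = ∑ i, γ i :=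
  Finsupp.degree_eq_sum γ

theorem mon_smul (t : ℝ) (x : σ → ℝ) (γ : σ →₀ ℕ) : mon (t • x) γ = t ^ γ.degree * mon x γ := by
  simp [mon, mul_pow, Finset.prod_mul_distrib, Finset.prod_pow_eq_pow_sum, degree_eq_sum]

theorem maj_nonneg (f : MvPolynomial σ ℂ) {x : σ → ℝ} (hx : 0 ≤ x) : 0 ≤ maj f x :=
  Finset.sum_nonneg fun γ _ => mul_nonneg (norm_nonneg _) (mon_nonneg hx γ)

theorem maj_eq_sum {f : MvPolynomial σ ℂ} {s : Finset (σ →₀ ℕ)} (h : f.support ⊆ s) (x : σ → ℝ) :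
    maj f x = ∑ γ ∈ s, ‖f.coeff γ‖ * mon x γ :=
  Finset.sum_subset h fun γ _ hγ => by simp [notMem_support_iff.mp hγ]

theorem maj_le_of_coeff_le {f g : MvPolynomial σ ℂ} (h : ∀ γ, ‖f.coeff γ‖ ≤ ‖g.coeff γ‖)
    {x : σ → ℝ} (hx : 0 ≤ x) : maj f x ≤ maj g x := by
  classical
  rw [maj_eq_sum (Finset.subset_union_left (s₂ := g.support)),
    maj_eq_sum (Finset.subset_union_right (s₁ := f.support))]
  exact Finset.sum_le_sum fun γ _ => mul_le_mul_of_nonneg_right (h γ) (mon_nonneg hx γ)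

theorem maj_congr {f g : MvPolynomial σ ℂ} (h : ∀ γ, ‖f.coeff γ‖ = ‖g.coeff γ‖)
    {x : σ → ℝ} (hx : 0 ≤ x) : maj f x = maj g x :=
  le_antisymm (maj_le_of_coeff_le (fun γ => (h γ).le) hx)
    (maj_le_of_coeff_le (fun γ => (h γ).ge) hx)

@[simp] theorem maj_zero (x : σ → ℝ) : maj (0 : MvPolynomial σ ℂ) x = 0 := by simp [maj]

theorem maj_monomial (γ : σ →₀ ℕ) (c : ℂ) (x : σ → ℝ) :
    maj (monomial γ c) x = ‖c‖ * mon x γ := by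
  classical
  rw [maj_eq_sum support_monomial_subset]
  simp

@[simp] theorem maj_X (i : σ) (x : σ → ℝ) : maj (X i : MvPolynomial σ ℂ) x = x i := by
  simp [X, maj_monomial]

@[simp] theorem maj_C (c : ℂ) (x : σ → ℝ) : maj (C c : MvPolynomial σ ℂ) x = ‖c‖ := by
  rw [← monomial_zero', maj_monomial]; simp

theorem maj_add_le (f g : MvPolynomial σ ℂ) {x : σ → ℝ} (hx : 0 ≤ x) :
    maj (f + g) x ≤ maj f x + maj g x := by
  classical
  rw [maj_eq_sum (support_add (p := f) (q := g)),
    maj_eq_sum (Finset.subset_union_left (s₂ := g.support)),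
    maj_eq_sum (Finset.subset_union_right (s₁ := f.support)), ← Finset.sum_add_distrib]
  refine Finset.sum_le_sum fun γ _ => ?_
  rw [← add_mul, coeff_add]
  exact mul_le_mul_of_nonneg_right (norm_add_le _ _) (mon_nonneg hx γ)

theorem maj_neg (f : MvPolynomial σ ℂ) {x : σ → ℝ} (hx : 0 ≤ x) : maj (-f) x = maj f x :=
  maj_congr (fun γ => by simp) hx

theorem maj_sub_le (f g : MvPolynomial σ ℂ) {x : σ → ℝ} (hx : 0 ≤ x) :
    maj (f - g) x ≤ maj f x + maj g x := by
  rw [sub_eq_add_neg, ← maj_neg g hx]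
  exact maj_add_le f (-g) hx

theorem maj_sum_le {ι : Type*} (s : Finset ι) (f : ι → MvPolynomial σ ℂ) {x : σ → ℝ} (hx : 0 ≤ x) :
    maj (∑ i ∈ s, f i) x ≤ ∑ i ∈ s, maj (f i) x := by
  classical
  induction s using Finset.induction_on with
  | empty => simp
  | insert a s ha ih =>
    rw [Finset.sum_insert ha, Finset.sum_insert ha]
    exact (maj_add_le _ _ hx).trans (by gcongr)

theorem maj_mul_le (f g : MvPolynomial σ ℂ) {x : σ → ℝ} (hx : 0 ≤ x) :
    maj (f * g) x ≤ maj f x * maj g x := by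
  conv_lhs => rw [as_sum f, as_sum g, Finset.sum_mul_sum]
  rw [maj.eq_1 f, maj.eq_1 g, Finset.sum_mul_sum]
  refine (maj_sum_le _ _ hx).trans (Finset.sum_le_sum fun γ _ => ?_)
  refine (maj_sum_le _ _ hx).trans (Finset.sum_le_sum fun δ _ => ?_)
  rw [monomial_mul, maj_monomial, norm_mul, mon_add]
  exact le_of_eq (by ring)

theorem maj_C_mul (c : ℂ) (f : MvPolynomial σ ℂ) {x : σ → ℝ} (hx : 0 ≤ x) :
    maj (C c * f) x ≤ ‖c‖ * maj f x := by
  simpa using maj_mul_le (C c) f hx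

theorem maj_pow_le (f : MvPolynomial σ ℂ) (n : ℕ) {x : σ → ℝ} (hx : 0 ≤ x) :
    maj (f ^ n) x ≤ maj f x ^ n := by
  induction n with
  | zero => simpa using (maj_C (σ := σ) 1 x).le
  | succ n ih =>
    rw [pow_succ, pow_succ]
    exact (maj_mul_le _ _ hx).trans (mul_le_mul_of_nonneg_right ih (maj_nonneg f hx))

theorem maj_prod_le {ι : Type*} (s : Finset ι) (f : ι → MvPolynomial σ ℂ) {x : σ → ℝ}
    (hx : 0 ≤ x) : maj (∏ i ∈ s, f i) x ≤ ∏ i ∈ s, maj (f i) x := by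
  classical
  induction s using Finset.induction_on with
  | empty => simpa using (maj_C (σ := σ) 1 x).le
  | insert a s ha ih =>
    rw [Finset.prod_insert ha, Finset.prod_insert ha]
    exact (maj_mul_le _ _ hx).trans (mul_le_mul_of_nonneg_left ih (maj_nonneg _ hx))

/-- Majorants are subadditive and submultiplicative, so a substitution can be carried out on the
majorants themselves. This is how compositions with the midpoint shifts are estimated. -/
theorem maj_aeval_le (a : τ → MvPolynomial σ ℂ) (f : MvPolynomial τ ℂ) {x : σ → ℝ} (hx : 0 ≤ x) :
    maj (aeval a f) x ≤ maj f fun i => maj (a i) x := by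
  rw [aeval_def, eval₂_eq', maj]
  refine (maj_sum_le _ _ hx).trans (Finset.sum_le_sum fun γ _ => ?_)
  refine (maj_mul_le _ _ hx).trans ?_
  rw [algebraMap_eq, maj_C]
  refine mul_le_mul_of_nonneg_left ?_ (norm_nonneg _)
  refine (maj_prod_le _ _ hx).trans (Finset.prod_le_prod (fun i _ => maj_nonneg _ hx) fun i _ => ?_)
  exact maj_pow_le _ _ hx

theorem norm_eval_le (f : MvPolynomial σ ℂ) (z : σ → ℂ) : ‖eval z f‖ ≤ maj f fun i => ‖z i‖ := by
  rw [eval_eq', maj]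
  refine (norm_sum_le _ _).trans (Finset.sum_le_sum fun γ _ => ?_)
  simp [mon]

/-- Order is turned into smallness: every monomial present has degree at least d, so scaling by t ≤
1 gains at least t^d. The next lemma is the counterpart for t ≥ 1, with the degree in place of the
order. -/
theorem maj_smul_le_of_mem_pow {f : MvPolynomial σ ℂ} {d : ℕ} (hf : f ∈ idealOfVars σ ℂ ^ d)
    {t : ℝ} (ht₀ : 0 ≤ t) (ht₁ : t ≤ 1) {x : σ → ℝ} (hx : 0 ≤ x) :
    maj f (t • x) ≤ t ^ d * maj f x := by
  rw [maj, maj, Finset.mul_sum]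
  refine Finset.sum_le_sum fun γ hγ => ?_
  have h := (mem_pow_idealOfVars_iff d f).mp hf γ hγ
  rw [mon_smul, mul_left_comm]
  exact mul_le_mul_of_nonneg_right (pow_le_pow_of_le_one ht₀ ht₁ h)
    (mul_nonneg (norm_nonneg _) (mon_nonneg hx γ))

theorem maj_smul_le_of_degree_le {f : MvPolynomial σ ℂ} {d : ℕ}
    (hf : ∀ γ ∈ f.support, γ.degree ≤ d) {t : ℝ} (ht : 1 ≤ t) {x : σ → ℝ} (hx : 0 ≤ x) :
    maj f (t • x) ≤ t ^ d * maj f x := by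
  rw [maj, maj, Finset.mul_sum]
  refine Finset.sum_le_sum fun γ hγ => ?_
  rw [mon_smul, mul_left_comm]
  exact mul_le_mul_of_nonneg_right (pow_le_pow_right₀ ht (hf γ hγ))
    (mul_nonneg (norm_nonneg _) (mon_nonneg hx γ))

/-- The majorant of `f` is at most `B` on the unit simplex. -/
def MajLE (f : MvPolynomial σ ℂ) (B : ℝ) : Prop := ∀ x : σ → ℝ, 0 ≤ x → ∑ i, x i ≤ 1 → maj f x ≤ B

theorem MajLE.nonneg {f : MvPolynomial σ ℂ} {B : ℝ} (h : MajLE f B) : 0 ≤ B :=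
  (maj_nonneg f le_rfl).trans (h 0 le_rfl (by simp))

theorem MajLE.le_pow {f : MvPolynomial σ ℂ} {B : ℝ} (h : MajLE f B) {d : ℕ}
    (hf : ∀ γ ∈ f.support, γ.degree ≤ d) {t : ℝ} (ht : 1 ≤ t) {x : σ → ℝ} (hx : 0 ≤ x)
    (hxt : ∑ i, x i ≤ t) : maj f x ≤ t ^ d * B := by
  have ht0 : 0 < t := by linarith
  have hx' : (0 : σ → ℝ) ≤ t⁻¹ • x := smul_nonneg (by positivity) hx
  have e : x = t • (t⁻¹ • x) := by rw [smul_smul, mul_inv_cancel₀ ht0.ne', one_smul]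
  rw [e]
  refine (maj_smul_le_of_degree_le hf ht hx').trans
    (mul_le_mul_of_nonneg_left (h _ hx' ?_) (by positivity))
  simp only [Pi.smul_apply, smul_eq_mul, ← Finset.mul_sum]
  rw [inv_mul_le_iff₀ ht0]
  linarith

/-- The majorant is evaluated at the point with entries 1/d on the support of γ and 0 elsewhere. At
most d variables occur in γ, so this point lies in the simplex, and x^γ ≥ d^{-d} there. The constant
does not see the number of variables. -/
theorem MajLE.norm_coeff_le {f : MvPolynomial σ ℂ} {B : ℝ} (h : MajLE f B) {d : ℕ} (hd : 1 ≤ d)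
    (γ : σ →₀ ℕ) (hγ : γ.degree ≤ d) : ‖f.coeff γ‖ ≤ (d : ℝ) ^ d * B := by
  classical
  by_cases hs : γ ∈ f.support
  swap
  · rw [notMem_support_iff.mp hs, norm_zero]
    have := h.nonneg
    positivity
  have hd0 : (0 : ℝ) < d := by exact_mod_cast hd
  let x : σ → ℝ := fun i => if γ i = 0 then 0 else (d : ℝ)⁻¹
  have hx : 0 ≤ x := fun i => by dsimp [x]; split_ifs <;> positivity
  have hx1 : ∑ i, x i ≤ 1 := by
    calc ∑ i, x i ≤ ∑ i, (γ i : ℝ) * (d : ℝ)⁻¹ := by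
          refine Finset.sum_le_sum fun i _ => ?_
          dsimp [x]
          split_ifs with h0
          · simp [h0]
          · have : (1 : ℝ) ≤ γ i := by exact_mod_cast Nat.one_le_iff_ne_zero.mpr h0
            nlinarith [inv_pos.mpr hd0]
      _ = (γ.degree : ℝ) * (d : ℝ)⁻¹ := by
          rw [← Finset.sum_mul, degree_eq_sum]; push_cast; rfl
      _ ≤ 1 := by
          rw [mul_inv_le_iff₀ hd0, one_mul]
          exact_mod_cast hγ
  have hm : ((d : ℝ)⁻¹) ^ d ≤ mon x γ := by
    have : mon x γ = ((d : ℝ)⁻¹) ^ γ.degree := by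
      rw [degree_eq_sum, ← Finset.prod_pow_eq_pow_sum]
      refine Finset.prod_congr rfl fun i _ => ?_
      dsimp [x]
      split_ifs with h0 <;> simp [h0]
    rw [this]
    exact pow_le_pow_of_le_one (by positivity) (inv_le_one_of_one_le₀ (by exact_mod_cast hd)) hγ
  have h1 : ‖f.coeff γ‖ * mon x γ ≤ B :=
    (Finset.single_le_sum (f := fun γ => ‖f.coeff γ‖ * mon x γ)
      (fun δ _ => mul_nonneg (norm_nonneg _) (mon_nonneg hx δ)) hs).trans (h x hx hx1)
  have h2 : ‖f.coeff γ‖ * ((d : ℝ)⁻¹) ^ d ≤ B :=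
    (mul_le_mul_of_nonneg_left hm (norm_nonneg _)).trans h1
  rw [inv_pow, mul_inv_le_iff₀ (by positivity)] at h2
  linarith

/-- The multi-indices of degree at most `d`. -/
def multiIndices (σ : Type*) [Fintype σ] (d : ℕ) : Finset (σ →₀ ℕ) :=
  (Finsupp.finite_of_degree_le (σ := σ) d).toFinset

@[simp] theorem mem_multiIndices {d : ℕ} {γ : σ →₀ ℕ} :
    γ ∈ multiIndices σ d ↔ γ.degree ≤ d := by simp [multiIndices]

theorem exists_eq_add_single {ι : Type*} {γ : ι →₀ ℕ} (h : γ ≠ 0) :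
    ∃ i δ, γ = δ + Finsupp.single i 1 := by
  obtain ⟨i, hi⟩ := Finsupp.ne_iff.mp h
  refine ⟨i, γ - Finsupp.single i 1, (tsub_add_cancel_of_le ?_).symm⟩
  rw [Finsupp.single_le_iff]
  exact Nat.one_le_iff_ne_zero.mpr hi

@[simp] theorem degree_add_single {ι : Type*} (γ : ι →₀ ℕ) (i : ι) :
    (γ + Finsupp.single i 1).degree = γ.degree + 1 := by
  simp

/-- A non-constant monomial of degree at most d + 1 is a variable times a monomial of degree at most
d, so each increase of d costs one factor 1 + Σ x_i. Only the ℓ¹ size enters, never the number of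
monomials. -/
theorem sum_mon_le (d : ℕ) {x : σ → ℝ} (hx : 0 ≤ x) :
    ∑ γ ∈ multiIndices σ d, mon x γ ≤ (1 + ∑ i, x i) ^ d := by
  classical
  have hs : 0 ≤ ∑ i, x i := Finset.sum_nonneg fun i _ => hx i
  induction d with
  | zero =>
    have : multiIndices σ 0 = {0} := by
      ext γ
      simp [Finsupp.degree_eq_zero_iff]
    simp [this]
  | succ d ih =>
    have hsub : multiIndices σ (d + 1) ⊆ insert 0 ((Finset.univ ×ˢ multiIndices σ d).image
        fun q : σ × (σ →₀ ℕ) => q.2 + Finsupp.single q.1 1) := by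
      intro γ hγ
      rw [mem_multiIndices] at hγ
      by_cases h : γ = 0
      · simp [h]
      · obtain ⟨i, δ, rfl⟩ := exists_eq_add_single h
        rw [degree_add_single] at hγ
        refine Finset.mem_insert_of_mem (Finset.mem_image.mpr ⟨(i, δ), ?_, rfl⟩)
        simpa using hγ
    calc ∑ γ ∈ multiIndices σ (d + 1), mon x γ
        ≤ ∑ γ ∈ insert 0 ((Finset.univ ×ˢ multiIndices σ d).image
            fun q : σ × (σ →₀ ℕ) => q.2 + Finsupp.single q.1 1), mon x γ :=
          Finset.sum_le_sum_of_subset_of_nonneg hsub fun γ _ _ => mon_nonneg hx γ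
      _ = mon x 0 + ∑ γ ∈ (Finset.univ ×ˢ multiIndices σ d).image
            fun q : σ × (σ →₀ ℕ) => q.2 + Finsupp.single q.1 1, mon x γ := by
          refine Finset.sum_insert fun h => ?_
          obtain ⟨q, -, hq⟩ := Finset.mem_image.mp h
          simpa using congrArg Finsupp.degree hq
      _ ≤ 1 + ∑ q ∈ Finset.univ ×ˢ multiIndices σ d, mon x (q.2 + Finsupp.single q.1 1) := by
          rw [mon_zero]
          gcongr
          exact Finset.sum_image_le_of_nonneg fun q _ => mon_nonneg hx _
      _ = 1 + (∑ i, x i) * ∑ γ ∈ multiIndices σ d, mon x γ := by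
          rw [Finset.sum_product, Finset.sum_mul_sum]
          simp only [mon_add, mon_single, pow_one, mul_comm]
      _ ≤ (1 + ∑ i, x i) ^ (d + 1) := by
          have h1 : 1 ≤ (1 + ∑ i, x i) ^ d := one_le_pow₀ (by linarith)
          rw [pow_succ']
          nlinarith

end Majorant

end LowRegBNF
end


noncomputable section

namespace LowRegBNF

open MvPolynomial

/-! ### Orders, weights and coefficient multipliers -/

section Order

variable {σ τ : Type*}

/-- A substitution without constant terms maps the ideal of the variables into itself, hence also
its powers. -/
theorem aeval_mem_pow {a : τ → MvPolynomial σ ℂ} (ha : ∀ i, a i ∈ idealOfVars σ ℂ)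
    {f : MvPolynomial τ ℂ} {d : ℕ} (hf : f ∈ idealOfVars τ ℂ ^ d) :
    aeval a f ∈ idealOfVars σ ℂ ^ d := by
  have h : (idealOfVars τ ℂ).map (aeval a : MvPolynomial τ ℂ →ₐ[ℂ] MvPolynomial σ ℂ) ≤
      idealOfVars σ ℂ := by
    rw [Ideal.map_le_iff_le_comap, idealOfVars, Ideal.span_le]
    rintro _ ⟨i, rfl⟩
    simpa using ha i
  refine Ideal.pow_right_mono h d ?_
  rw [← Ideal.map_pow]
  exact Ideal.mem_map_of_mem _ hf

theorem X_mem_idealOfVars (i : σ) : (X i : MvPolynomial σ ℂ) ∈ idealOfVars σ ℂ :=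
  Ideal.subset_span ⟨i, rfl⟩

/-- Telescoping: A x − B y = A (x − y) + (A − B) y. In each term one factor contributes order e and
the other n − 1 factors contribute order one each. -/
theorem aeval_monomial_sub_mem_pow {a b : τ → MvPolynomial σ ℂ} (ha : ∀ i, a i ∈ idealOfVars σ ℂ)
    (hb : ∀ i, b i ∈ idealOfVars σ ℂ) {e : ℕ} (hab : ∀ i, a i - b i ∈ idealOfVars σ ℂ ^ e)
    (n : ℕ) : ∀ γ : τ →₀ ℕ, n ≤ γ.degree →
    aeval a (monomial γ (1 : ℂ)) - aeval b (monomial γ (1 : ℂ)) ∈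
      idealOfVars σ ℂ ^ (n - 1 + e) := by
  have key : ∀ A B x y : MvPolynomial σ ℂ, A * x - B * y = A * (x - y) + (A - B) * y :=
    fun _ _ _ _ => by ring
  induction n with
  | zero =>
    -- For n = 0 the truncated exponent `0 - 1 + e` is e, so the claim is just membership in the
    -- e-th power, by a separate induction on the actual degree.
    suffices ∀ m, ∀ γ : τ →₀ ℕ, γ.degree = m →
        aeval a (monomial γ (1 : ℂ)) - aeval b (monomial γ (1 : ℂ)) ∈ idealOfVars σ ℂ ^ e by
      intro γ _
      simpa using this _ γ rfl
    intro m
    induction m with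
    | zero =>
      intro γ hγ
      have : γ = 0 := (Finsupp.degree_eq_zero_iff γ).mp hγ
      simp [this]
    | succ m ih =>
      intro γ hγ
      have h0 : γ ≠ 0 := by rintro rfl; simp at hγ
      obtain ⟨i, δ, rfl⟩ := exists_eq_add_single h0
      rw [degree_add_single] at hγ
      have hm : monomial (δ + Finsupp.single i 1) (1 : ℂ) = monomial δ 1 * X i := by
        rw [X, monomial_mul, one_mul]
      rw [hm, map_mul, map_mul, aeval_X, aeval_X, key]
      exact Ideal.add_mem _ (Ideal.mul_mem_left _ _ (hab i))
        (Ideal.mul_mem_right _ _ (ih δ (by omega)))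
  | succ n ih =>
    intro γ hγ
    have h0 : γ ≠ 0 := by rintro rfl; simp at hγ
    obtain ⟨i, δ, rfl⟩ := exists_eq_add_single h0
    rw [degree_add_single] at hγ
    have hm : monomial (δ + Finsupp.single i 1) (1 : ℂ) = monomial δ 1 * X i := by
      rw [X, monomial_mul, one_mul]
    have hδ : n ≤ δ.degree := by omega
    rw [hm, map_mul, map_mul, aeval_X, aeval_X, key,
      Nat.add_sub_cancel]
    refine Ideal.add_mem _ ?_ ?_
    · rw [pow_add]
      refine Ideal.mul_mem_mul (Ideal.pow_le_pow_right hδ ?_) (hab i)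
      refine aeval_mem_pow ha ((mem_pow_idealOfVars_iff _ _).mpr fun x hx => ?_)
      rw [Finset.mem_singleton.mp (support_monomial_subset hx)]
    -- Truncated subtraction again: for n = 0 the factor y need not contribute an order; for n ≥ 1
    -- it raises n − 1 + e to n + e.
    · rcases Nat.eq_zero_or_pos n with rfl | hn
      · exact Ideal.mul_mem_right _ _ (by simpa using ih δ hδ)
      · have := Ideal.mul_mem_mul (ih δ hδ) (by simpa using hb i : b i ∈ idealOfVars σ ℂ ^ 1)
        rw [← pow_add] at this
        convert this using 2
        omega

/-- Two substitutions that differ at order `e` differ at order `d - 1 + e` in a polynomial of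
order `d`. -/
theorem aeval_sub_aeval_mem_pow {a b : τ → MvPolynomial σ ℂ} (ha : ∀ i, a i ∈ idealOfVars σ ℂ)
    (hb : ∀ i, b i ∈ idealOfVars σ ℂ) {d e : ℕ} (hab : ∀ i, a i - b i ∈ idealOfVars σ ℂ ^ e)
    {f : MvPolynomial τ ℂ} (hf : f ∈ idealOfVars τ ℂ ^ d) :
    aeval a f - aeval b f ∈ idealOfVars σ ℂ ^ (d - 1 + e) := by
  rw [as_sum f, map_sum, map_sum, ← Finset.sum_sub_distrib]
  refine Ideal.sum_mem _ fun γ hγ => ?_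
  have h := aeval_monomial_sub_mem_pow ha hb hab d γ ((mem_pow_idealOfVars_iff _ _).mp hf γ hγ)
  have hm : monomial γ (f.coeff γ) = C (f.coeff γ) * monomial γ 1 := by rw [C_mul_monomial, mul_one]
  rw [hm, map_mul, map_mul, aeval_C, aeval_C, ← mul_sub]
  exact Ideal.mul_mem_left _ _ h

theorem pderiv_mem_pow {f : MvPolynomial σ ℂ} {d : ℕ} (hf : f ∈ idealOfVars σ ℂ ^ (d + 1)) (i : σ) :
    pderiv i f ∈ idealOfVars σ ℂ ^ d := by
  rw [mem_pow_idealOfVars_iff'] at hf ⊢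
  intro γ hγ
  rw [coeff_pderiv, hf _ (by rw [degree_add_single]; omega), zero_mul]

theorem isWeightedHomogeneous_aeval {g : σ → ℤ} {h : τ → ℤ} {a : τ → MvPolynomial σ ℂ}
    (ha : ∀ i, IsWeightedHomogeneous g (a i) (h i)) {f : MvPolynomial τ ℂ} {n : ℤ}
    (hf : IsWeightedHomogeneous h f n) : IsWeightedHomogeneous g (aeval a f) n := by
  rw [aeval_def, eval₂_eq]
  refine IsWeightedHomogeneous.sum _ _ _ fun γ hγ => ?_
  have hw : n = 0 + ∑ i ∈ γ.support, γ i • h i := by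
    rw [← hf (mem_support_iff.mp hγ), Finsupp.weight_apply, zero_add, Finsupp.sum]
  rw [hw]
  exact (isWeightedHomogeneous_C g _).mul
    (IsWeightedHomogeneous.prod _ _ _ fun i _ => (ha i).pow (γ i))

theorem isWeightedHomogeneous_pderiv {g : σ → ℤ} {f : MvPolynomial σ ℂ} {n : ℤ}
    (hf : IsWeightedHomogeneous g f n) (i : σ) : IsWeightedHomogeneous g (pderiv i f) (n - g i) := by
  intro γ hγ
  rw [coeff_pderiv] at hγ
  have := hf (left_ne_zero_of_mul hγ)
  rw [map_add, Finsupp.weight_single, one_smul] at this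
  omega

/-- Multiplication of the coefficient of each monomial `γ` by `φ γ`. -/
def mult (φ : (σ →₀ ℕ) → ℂ) (f : MvPolynomial σ ℂ) : MvPolynomial σ ℂ :=
  ∑ γ ∈ f.support, monomial γ (φ γ * f.coeff γ)

@[simp] theorem coeff_mult (φ : (σ →₀ ℕ) → ℂ) (f : MvPolynomial σ ℂ) (γ : σ →₀ ℕ) :
    (mult φ f).coeff γ = φ γ * f.coeff γ := by
  classical
  rw [mult, coeff_sum]
  simp only [coeff_monomial]
  rw [Finset.sum_ite_eq' f.support γ]
  split_ifs with h
  · rfl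
  · rw [notMem_support_iff.mp h, mul_zero]

theorem mult_add (φ : (σ →₀ ℕ) → ℂ) (f g : MvPolynomial σ ℂ) :
    mult φ (f + g) = mult φ f + mult φ g := by
  ext γ
  simp [mul_add]

theorem isWeightedHomogeneous_mult {g : σ → ℤ} {f : MvPolynomial σ ℂ} {n : ℤ}
    (hf : IsWeightedHomogeneous g f n) (φ : (σ →₀ ℕ) → ℂ) :
    IsWeightedHomogeneous g (mult φ f) n := by
  intro γ hγ
  rw [coeff_mult] at hγ
  exact hf (right_ne_zero_of_mul hγ)

/-- Euler's identity for the diagonal operator with weights `θ`. -/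
theorem sum_X_mul_pderiv [Fintype σ] (θ : σ → ℂ) (f : MvPolynomial σ ℂ) :
    ∑ i, C (θ i) * (X i * pderiv i f) = mult (Finsupp.weight θ) f := by
  classical
  induction f using MvPolynomial.induction_on' with
  | add f g hf hg =>
    rw [mult_add, ← hf, ← hg, ← Finset.sum_add_distrib]
    exact Finset.sum_congr rfl fun i _ => by rw [map_add]; ring
  | monomial γ c =>
    simp only [X_mul_pderiv_monomial]
    ext δ
    rw [coeff_mult, coeff_sum, Finsupp.weight_eq_sum]
    simp only [coeff_C_mul, coeff_smul, coeff_monomial]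
    split_ifs with h
    · subst h
      rw [Finset.sum_mul]
      exact Finset.sum_congr rfl fun i _ => by simp [nsmul_eq_mul]; ring
    · simp

end Order

end LowRegBNF
end


noncomputable section

namespace LowRegBNF

open MvPolynomial

/-! ### Hamiltonian polynomials in `u` and `ū` -/

section Var

/-- The variables: `inl k` stands for `u_k` and `inr k` for `ū_k`. -/
abbrev Var (M : ℕ) : Type := Fin M ⊕ Fin M

variable {M : ℕ}

/-- The charge of a variable under `u ↦ e^{iθ} u`. -/
def charge : Var M → ℤ := Sum.elim (fun _ => 1) fun _ => -1

/-- The signed mode of a variable. -/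
def freq : Var M → ℤ := Sum.elim (fun k => (k : ℤ) + 1) fun k => -((k : ℤ) + 1)

/-- The signed frequency of a variable. -/
def sfreq (w : ℕ+ → ℝ) : Var M → ℝ := Sum.elim (fun k => w (mode k)) fun k => -w (mode k)

/-- The exchange of `u` and `ū`. -/
def swapIdx (γ : Var M →₀ ℕ) : Var M →₀ ℕ := γ.mapDomain Sum.swap

@[simp] theorem swapIdx_apply (γ : Var M →₀ ℕ) (v : Var M) : swapIdx γ v = γ v.swap := by
  have h : Function.Injective (Sum.swap : Var M → Var M) := Sum.swap_leftInverse.injective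
  conv_lhs => rw [← Sum.swap_swap v]
  exact Finsupp.mapDomain_apply h γ _

@[simp] theorem swapIdx_swapIdx (γ : Var M →₀ ℕ) : swapIdx (swapIdx γ) = γ := by
  ext v
  simp

theorem weight_swapIdx {A : Type*} [AddCommGroup A] {θ : Var M → A} (hθ : ∀ v, θ v.swap = -θ v)
    (γ : Var M →₀ ℕ) : Finsupp.weight θ (swapIdx γ) = -Finsupp.weight θ γ := by
  rw [Finsupp.weight_eq_sum, Finsupp.weight_eq_sum, ← Finset.sum_neg_distrib]
  refine Fintype.sum_equiv (Equiv.sumComm _ _) _ _ fun v => ?_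
  have := hθ v
  simp only [swapIdx_apply, Equiv.sumComm_apply, this, smul_neg, neg_neg]

@[simp] theorem degree_swapIdx (γ : Var M →₀ ℕ) : (swapIdx γ).degree = γ.degree := by
  rw [degree_eq_sum, degree_eq_sum]
  exact Fintype.sum_equiv (Equiv.sumComm _ _) _ _ fun v => by simp

theorem charge_swap (v : Var M) : charge v.swap = -charge v := by
  rcases v with k | k <;> simp [charge]

theorem sfreq_swap (w : ℕ+ → ℝ) (v : Var M) : sfreq w v.swap = -sfreq w v := by
  rcases v with k | k <;> simp [sfreq]

/-- Complex conjugation of polynomials in `u` and `ū`. -/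
def conjP : MvPolynomial (Var M) ℂ →+* MvPolynomial (Var M) ℂ :=
  (rename Sum.swap : MvPolynomial (Var M) ℂ →ₐ[ℂ] MvPolynomial (Var M) ℂ).toRingHom.comp
    (map (starRingEnd ℂ))

@[simp] theorem conjP_X (v : Var M) : conjP (X v) = X v.swap := by simp [conjP]

@[simp] theorem conjP_C (c : ℂ) : conjP (C c : MvPolynomial (Var M) ℂ) = C ((starRingEnd ℂ) c) := by
  simp [conjP]

theorem coeff_conjP (f : MvPolynomial (Var M) ℂ) (γ : Var M →₀ ℕ) :
    (conjP f).coeff γ = (starRingEnd ℂ) (f.coeff (swapIdx γ)) := by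
  have h : Function.Injective (Sum.swap : Var M → Var M) := Sum.swap_leftInverse.injective
  have := coeff_rename_mapDomain (Sum.swap : Var M → Var M) h (map (starRingEnd ℂ) f) (swapIdx γ)
  rw [coeff_map] at this
  rw [← this]
  change _ = coeff (swapIdx (swapIdx γ)) _
  rw [swapIdx_swapIdx]
  rfl

theorem conjP_aeval {a : Var M → MvPolynomial (Var M) ℂ} (ha : ∀ v, conjP (a v) = a v.swap)
    (f : MvPolynomial (Var M) ℂ) : conjP (aeval a f) = aeval a (conjP f) := by
  induction f using MvPolynomial.induction_on with
  | C c => simp [algebraMap_eq]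
  | add f g hf hg => rw [map_add, map_add, map_add, map_add, hf, hg]
  | mul_X f v hf => rw [map_mul, map_mul, map_mul, map_mul, hf, aeval_X, ha, conjP_X, aeval_X]

theorem conjP_pderiv (v : Var M) (f : MvPolynomial (Var M) ℂ) :
    conjP (pderiv v f) = pderiv v.swap (conjP f) := by
  have h : Function.Injective (Sum.swap : Var M → Var M) := Sum.swap_leftInverse.injective
  change rename Sum.swap (map (starRingEnd ℂ) (pderiv v f)) =
    pderiv v.swap (rename Sum.swap (map (starRingEnd ℂ) f))
  rw [pderiv_rename h, pderiv_map]

/-- Real polynomials that are invariant under `u ↦ e^{iθ} u`. -/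
structure IsHamPoly (f : MvPolynomial (Var M) ℂ) : Prop where
  real : conjP f = f
  gauge : IsWeightedHomogeneous charge f 0

theorem IsHamPoly.add {f g : MvPolynomial (Var M) ℂ} (hf : IsHamPoly f) (hg : IsHamPoly g) :
    IsHamPoly (f + g) :=
  ⟨by rw [map_add, hf.real, hg.real], hf.gauge.add hg.gauge⟩

theorem IsHamPoly.sub {f g : MvPolynomial (Var M) ℂ} (hf : IsHamPoly f) (hg : IsHamPoly g) :
    IsHamPoly (f - g) :=
  ⟨by rw [map_sub, hf.real, hg.real], hf.gauge.sub hg.gauge⟩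

theorem isHamPoly_zero : IsHamPoly (0 : MvPolynomial (Var M) ℂ) :=
  ⟨map_zero _, isWeightedHomogeneous_zero _ _ _⟩

theorem IsHamPoly.coeff_swapIdx {f : MvPolynomial (Var M) ℂ} (hf : IsHamPoly f)
    (γ : Var M →₀ ℕ) : f.coeff (swapIdx γ) = (starRingEnd ℂ) (f.coeff γ) := by
  conv_lhs => rw [← hf.real, coeff_conjP, swapIdx_swapIdx]

theorem IsHamPoly.mult {f : MvPolynomial (Var M) ℂ} (hf : IsHamPoly f) {φ : (Var M →₀ ℕ) → ℂ}
    (hφ : ∀ γ, φ (swapIdx γ) = (starRingEnd ℂ) (φ γ)) : IsHamPoly (mult φ f) := by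
  refine ⟨?_, isWeightedHomogeneous_mult hf.gauge φ⟩
  ext γ
  rw [coeff_conjP, coeff_mult, coeff_mult, hφ, hf.coeff_swapIdx]
  simp

theorem IsHamPoly.aeval {f : MvPolynomial (Var M) ℂ} (hf : IsHamPoly f)
    {a : Var M → MvPolynomial (Var M) ℂ} (ha : ∀ v, conjP (a v) = a v.swap)
    (ha' : ∀ v, IsWeightedHomogeneous charge (a v) (charge v)) : IsHamPoly (aeval a f) :=
  ⟨by rw [conjP_aeval ha, hf.real], isWeightedHomogeneous_aeval ha' hf.gauge⟩

/-- Charge zero means as many factors u as factors ū. -/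
theorem even_degree {γ : Var M →₀ ℕ} (h : Finsupp.weight charge γ = 0) : Even γ.degree := by
  rw [Finsupp.weight_eq_sum, Fintype.sum_sum_type] at h
  rw [degree_eq_sum, Fintype.sum_sum_type]
  simp only [charge, Sum.elim_inl, Sum.elim_inr, smul_neg, Finset.sum_neg_distrib, nsmul_eq_mul,
    mul_one] at h
  refine ⟨∑ k, γ (Sum.inr k), ?_⟩
  have : (∑ k, γ (Sum.inl k) : ℕ) = ∑ k, γ (Sum.inr k) := by zify; linarith
  rw [this]

/-- Gauge invariance removes the odd degrees, so a remainder controlled up to an odd order gains one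
more order for free. -/
theorem IsHamPoly.mem_pow_even {f : MvPolynomial (Var M) ℂ} (hf : IsHamPoly f) {n : ℕ}
    (h : f ∈ idealOfVars (Var M) ℂ ^ (2 * n + 1)) : f ∈ idealOfVars (Var M) ℂ ^ (2 * n + 2) := by
  rw [mem_pow_idealOfVars_iff] at h ⊢
  intro γ hγ
  have h1 := h γ hγ
  obtain ⟨m, hm⟩ := even_degree (hf.gauge (mem_support_iff.mp hγ))
  omega

/-- Half of the Hamiltonian vector field of `χ`, in the variables `u` and `ū`. -/
def vf (χ : MvPolynomial (Var M) ℂ) (v : Var M) : MvPolynomial (Var M) ℂ :=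
  C (Complex.I * (charge v : ℂ)) * pderiv v.swap χ

theorem vf_add (χ η : MvPolynomial (Var M) ℂ) (v : Var M) : vf (χ + η) v = vf χ v + vf η v := by
  rw [vf, vf, vf, map_add, mul_add]

theorem conjP_vf {χ : MvPolynomial (Var M) ℂ} (hχ : IsHamPoly χ) (v : Var M) :
    conjP (vf χ v) = vf χ v.swap := by
  rw [vf, vf, map_mul, conjP_pderiv, hχ.real, conjP_C, charge_swap]
  simp

theorem vf_gauge {χ : MvPolynomial (Var M) ℂ} (hχ : IsHamPoly χ) (v : Var M) :
    IsWeightedHomogeneous charge (vf χ v) (charge v) := by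
  have := (isWeightedHomogeneous_C charge (Complex.I * (charge v : ℂ))).mul
    (isWeightedHomogeneous_pderiv hχ.gauge v.swap)
  rw [charge_swap, sub_neg_eq_add, zero_add, zero_add] at this
  exact this

theorem vf_mem_pow {χ : MvPolynomial (Var M) ℂ} {d : ℕ}
    (hχ : χ ∈ idealOfVars (Var M) ℂ ^ (d + 1)) (v : Var M) : vf χ v ∈ idealOfVars (Var M) ℂ ^ d :=
  Ideal.mul_mem_left _ _ (pderiv_mem_pow hχ _)

theorem norm_charge (v : Var M) : ‖Complex.I * (charge v : ℂ)‖ = 1 := by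
  rcases v with k | k <;> simp [charge]

theorem maj_vf_le (χ : MvPolynomial (Var M) ℂ) (v : Var M) {x : Var M → ℝ} (hx : 0 ≤ x) :
    maj (vf χ v) x ≤ maj (pderiv v.swap χ) x := by
  refine (maj_C_mul _ _ hx).trans ?_
  rw [norm_charge, one_mul]

/-- The substitution `v ↦ v + c Y_v`, where `Y` is half of the vector field of `χ`. -/
def shift (χ : MvPolynomial (Var M) ℂ) (c : ℝ) (v : Var M) : MvPolynomial (Var M) ℂ :=
  X v + C (c : ℂ) * vf χ v

theorem conjP_shift {χ : MvPolynomial (Var M) ℂ} (hχ : IsHamPoly χ) (c : ℝ) (v : Var M) :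
    conjP (shift χ c v) = shift χ c v.swap := by
  rw [shift, shift, map_add, map_mul, conjP_vf hχ, conjP_X, conjP_C, Complex.conj_ofReal]

theorem shift_gauge {χ : MvPolynomial (Var M) ℂ} (hχ : IsHamPoly χ) (c : ℝ) (v : Var M) :
    IsWeightedHomogeneous charge (shift χ c v) (charge v) :=
  (isWeightedHomogeneous_X ℂ charge v).add ((vf_gauge hχ v).C_mul _)

theorem shift_mem {χ : MvPolynomial (Var M) ℂ} (hχ : χ ∈ idealOfVars (Var M) ℂ ^ 2) (c : ℝ)
    (v : Var M) : shift χ c v ∈ idealOfVars (Var M) ℂ :=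
  Ideal.add_mem _ (X_mem_idealOfVars v)
    (Ideal.mul_mem_left _ _ (by simpa using vf_mem_pow (d := 1) hχ v))

/-- The bound `A` on the coefficients of `χ`, with the gain of `1 + |∑ γ_v freq v|`. -/
def CoeffLE (χ : MvPolynomial (Var M) ℂ) (A : ℝ) : Prop :=
  ∀ γ, ‖χ.coeff γ‖ * (1 + |((Finsupp.weight freq γ : ℤ) : ℝ)|) ≤ A

theorem CoeffLE.nonneg {χ : MvPolynomial (Var M) ℂ} {A : ℝ} (h : CoeffLE χ A) : 0 ≤ A :=
  le_trans (by positivity) (h 0)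

/-- The bound `K` on the sums of the kernel `1 / (1 + |c + freq v|)`. -/
def KernelLE (M : ℕ) (K : ℝ) : Prop :=
  ∀ c : ℤ, ∑ v : Var M, 1 / (1 + |((c + freq v : ℤ) : ℝ)|) ≤ K

/-- The monomial γ of ∂_v χ comes from γ + e_v, whose total frequency is that of γ plus `freq v`.
The gain in the coefficients of χ therefore becomes a kernel in v; the factor D bounds the exponent
brought down by differentiation. -/
theorem maj_pderiv_le {χ : MvPolynomial (Var M) ℂ} {A : ℝ} (hχ : CoeffLE χ A) {D : ℕ}
    (hD : ∀ γ ∈ χ.support, γ.degree ≤ D) (v : Var M) {x : Var M → ℝ} (hx : 0 ≤ x) :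
    maj (pderiv v χ) x ≤ ∑ γ ∈ multiIndices (Var M) D,
      D * A * (1 / (1 + |((Finsupp.weight freq γ + freq v : ℤ) : ℝ)|)) * mon x γ := by
  have hA := hχ.nonneg
  have hs : (pderiv v χ).support ⊆ multiIndices (Var M) D := by
    intro γ hγ
    rw [mem_support_iff, coeff_pderiv] at hγ
    have := hD _ (mem_support_iff.mpr (left_ne_zero_of_mul hγ))
    rw [degree_add_single] at this
    rw [mem_multiIndices]
    omega
  rw [maj_eq_sum hs]
  refine Finset.sum_le_sum fun γ _ => mul_le_mul_of_nonneg_right ?_ (mon_nonneg hx γ)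
  rw [coeff_pderiv, norm_mul]
  by_cases h0 : χ.coeff (γ + Finsupp.single v 1) = 0
  · rw [h0, norm_zero, zero_mul]; positivity
  have h1 := hχ (γ + Finsupp.single v 1)
  rw [map_add, Finsupp.weight_single, one_smul] at h1
  have h2 : ‖(γ v : ℂ) + 1‖ ≤ D := by
    have := hD _ (mem_support_iff.mpr h0)
    rw [degree_add_single] at this
    have h3 := Finsupp.le_degree v γ
    have h4 : ‖(γ v : ℂ) + 1‖ = ((γ v + 1 : ℕ) : ℝ) := by
      rw [← Complex.norm_natCast]; push_cast; rfl
    rw [h4]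
    exact_mod_cast (by omega : γ v + 1 ≤ D)
  rw [mul_one_div, le_div_iff₀ (by positivity)]
  calc _ = ‖(γ v : ℂ) + 1‖ * (‖χ.coeff (γ + Finsupp.single v 1)‖ *
          (1 + |((Finsupp.weight freq γ + freq v : ℤ) : ℝ)|)) := by ring
    _ ≤ D * A := mul_le_mul h2 h1 (by positivity) (by positivity)

/-- Summing over v for a fixed monomial costs the kernel constant K instead of the number 2M of
variables. This ℓ¹ bound for the vector field is where the small-divisor gain is used in the formal
construction. -/
theorem sum_maj_pderiv_le {χ : MvPolynomial (Var M) ℂ} {A : ℝ} (hχ : CoeffLE χ A) {D : ℕ}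
    (hD : ∀ γ ∈ χ.support, γ.degree ≤ D) {K : ℝ} (hK : KernelLE M K) {x : Var M → ℝ} (hx : 0 ≤ x) :
    ∑ v, maj (pderiv v χ) x ≤ D * A * K * (1 + ∑ v, x v) ^ D := by
  have hA := hχ.nonneg
  have hK0 : 0 ≤ K := le_trans (Finset.sum_nonneg fun v _ => by positivity) (hK 0)
  calc ∑ v, maj (pderiv v χ) x
      ≤ ∑ v, ∑ γ ∈ multiIndices (Var M) D,
          D * A * (1 / (1 + |((Finsupp.weight freq γ + freq v : ℤ) : ℝ)|)) * mon x γ :=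
        Finset.sum_le_sum fun v _ => maj_pderiv_le hχ hD v hx
    _ = ∑ γ ∈ multiIndices (Var M) D, D * A * mon x γ *
          ∑ v, 1 / (1 + |((Finsupp.weight freq γ + freq v : ℤ) : ℝ)|) := by
        rw [Finset.sum_comm]
        refine Finset.sum_congr rfl fun γ _ => ?_
        rw [Finset.mul_sum]
        exact Finset.sum_congr rfl fun v _ => by ring
    _ ≤ ∑ γ ∈ multiIndices (Var M) D, D * A * mon x γ * K :=
        Finset.sum_le_sum fun γ _ => mul_le_mul_of_nonneg_left (hK _)
          (mul_nonneg (by positivity) (mon_nonneg hx γ))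
    _ = D * A * K * ∑ γ ∈ multiIndices (Var M) D, mon x γ := by
        rw [Finset.mul_sum]
        exact Finset.sum_congr rfl fun v _ => by ring
    _ ≤ _ := mul_le_mul_of_nonneg_left (sum_mon_le D hx) (by positivity)

theorem sum_maj_vf_le {χ : MvPolynomial (Var M) ℂ} {A : ℝ} (hχ : CoeffLE χ A) {D : ℕ}
    (hD : ∀ γ ∈ χ.support, γ.degree ≤ D) {K : ℝ} (hK : KernelLE M K) {x : Var M → ℝ} (hx : 0 ≤ x) :
    ∑ v, maj (vf χ v) x ≤ D * A * K * (1 + ∑ v, x v) ^ D := by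
  refine le_trans ?_ (sum_maj_pderiv_le hχ hD hK hx)
  refine (Finset.sum_le_sum fun v _ => maj_vf_le χ v hx).trans (le_of_eq ?_)
  exact Fintype.sum_equiv (Equiv.sumComm _ _) _ _ fun v => rfl

/-- The bound on a polynomial after the substitution `shift χ c`. -/
theorem majLE_aeval_shift {χ : MvPolynomial (Var M) ℂ} {A : ℝ} (hχ : CoeffLE χ A) {D : ℕ}
    (hD : ∀ γ ∈ χ.support, γ.degree ≤ D) {K : ℝ} (hK : KernelLE M K)
    {f : MvPolynomial (Var M) ℂ} (hfD : ∀ γ ∈ f.support, γ.degree ≤ D) {B : ℝ} (hf : MajLE f B)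
    {c : ℝ} (hc : |c| ≤ 1) :
    MajLE (aeval (shift χ c) f) ((1 + D * A * K * 2 ^ D) ^ D * B) := by
  intro x hx hx1
  have hA := hχ.nonneg
  have hK0 : 0 ≤ K := le_trans (Finset.sum_nonneg fun v _ => by positivity) (hK 0)
  refine (maj_aeval_le _ _ hx).trans ?_
  refine hf.le_pow hfD ?_ (fun v => maj_nonneg _ hx) ?_
  · have : 0 ≤ D * A * K * 2 ^ D := by positivity
    linarith
  -- The shift enlarges the ℓ¹ size from 1 to at most 1 + D A K 2^D, and a polynomial of degree at
  -- most D grows by at most the D-th power of this.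
  calc ∑ v, maj (shift χ c v) x ≤ ∑ v, (x v + maj (vf χ v) x) := by
        refine Finset.sum_le_sum fun v _ => (maj_add_le _ _ hx).trans ?_
        rw [maj_X]
        gcongr
        refine (maj_C_mul _ _ hx).trans ?_
        have := maj_nonneg (vf χ v) hx
        rw [Complex.norm_real, Real.norm_eq_abs]
        nlinarith
    _ = ∑ v, x v + ∑ v, maj (vf χ v) x := Finset.sum_add_distrib
    _ ≤ 1 + D * A * K * 2 ^ D := by
        refine add_le_add hx1 ((sum_maj_vf_le hχ hD hK hx).trans ?_)
        have : 0 ≤ ∑ v, x v := Finset.sum_nonneg fun v _ => hx v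
        refine mul_le_mul_of_nonneg_left ?_ (by positivity)
        exact pow_le_pow_left₀ (by linarith) (by linarith) D

end Var

end LowRegBNF
end


noncomputable section

namespace LowRegBNF

open MvPolynomial

/-! ### The formal normal form -/

section Formal

variable {M : ℕ}

/-- The monomials that commute with the actions of the modes up to `N`. -/
def IsResonant (N : ℕ) (γ : Var M →₀ ℕ) : Prop :=
  ∀ q : Fin M, (mode q : ℕ) ≤ N → γ (Sum.inl q) = γ (Sum.inr q)

theorem isResonant_swapIdx {N : ℕ} {γ : Var M →₀ ℕ} : IsResonant N (swapIdx γ) ↔ IsResonant N γ := by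
  simp [IsResonant, eq_comm]

/-- The constant `K` controls the degree `D`, the kernel sums and the small divisors. -/
structure IsControl (M N D : ℕ) (w : ℕ+ → ℝ) (K : ℝ) : Prop where
  two_le : 2 ≤ K
  degree_le : (D : ℝ) ≤ K
  kernel : KernelLE M K
  smallDivisor : ∀ γ : Var M →₀ ℕ, Finsupp.weight charge γ = 0 → γ.degree ≤ D → ¬IsResonant N γ →
    1 + |((Finsupp.weight freq γ : ℤ) : ℝ)| ≤ K * |Finsupp.weight (sfreq w) γ|

/-- The operator `χ ↦ dZ₂(X_χ)`. -/
def homOp (w : ℕ+ → ℝ) (χ : MvPolynomial (Var M) ℂ) : MvPolynomial (Var M) ℂ :=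
  mult (fun γ => -Complex.I * ((Finsupp.weight (sfreq w) γ : ℝ) : ℂ)) χ

/-- The part of the transformed Hamiltonian, in the midpoint variable, that comes from `P` and from
the normal form `Q`. -/
def substDiff (P χ Q : MvPolynomial (Var M) ℂ) : MvPolynomial (Var M) ℂ :=
  aeval (shift χ 1) P - aeval (shift χ (-1)) Q

/-- `χ` and `Q` put `Z₂ + P` into normal form up to degree `2 (p + n)`. -/
structure IsNormalForm (w : ℕ+ → ℝ) (N p n : ℕ) (P : MvPolynomial (Var M) ℂ) (A : ℝ)
    (χ Q : MvPolynomial (Var M) ℂ) : Prop where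
  ham_gen : IsHamPoly χ
  ham_nf : IsHamPoly Q
  order_gen : χ ∈ idealOfVars (Var M) ℂ ^ (2 * p + 2)
  order_nf : Q ∈ idealOfVars (Var M) ℂ ^ (2 * p + 2)
  degree_gen : ∀ γ ∈ χ.support, γ.degree ≤ 2 * (p + n)
  degree_nf : ∀ γ ∈ Q.support, γ.degree ≤ 2 * (p + n)
  coeff_gen : CoeffLE χ A
  maj_nf : MajLE Q A
  resonant : ∀ γ ∈ Q.support, IsResonant N γ
  remainder : homOp w χ + substDiff P χ Q ∈ idealOfVars (Var M) ℂ ^ (2 * (p + n) + 1)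

theorem shift_sub_shift (χ η : MvPolynomial (Var M) ℂ) (c : ℝ) (v : Var M) :
    shift (χ + η) c v - shift χ c v = C (c : ℂ) * vf η v := by
  rw [shift, shift, vf_add]; ring

theorem isHamPoly_homOp {χ : MvPolynomial (Var M) ℂ} (hχ : IsHamPoly χ) (w : ℕ+ → ℝ) :
    IsHamPoly (homOp w χ) :=
  hχ.mult fun γ => by rw [weight_swapIdx (sfreq_swap w)]; simp

theorem isHamPoly_substDiff {P χ Q : MvPolynomial (Var M) ℂ} (hP : IsHamPoly P) (hχ : IsHamPoly χ)
    (hQ : IsHamPoly Q) : IsHamPoly (substDiff P χ Q) :=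
  (hP.aeval (conjP_shift hχ 1) (shift_gauge hχ 1)).sub
    (hQ.aeval (conjP_shift hχ (-1)) (shift_gauge hχ (-1)))

variable {w : ℕ+ → ℝ} {N p n D e : ℕ} {K : ℝ} {P χ Q : MvPolynomial (Var M) ℂ}

theorem majLE_substDiff (hK : IsControl M N D w K) (he : 1 ≤ e)
    (hPD : ∀ γ ∈ P.support, γ.degree ≤ D) (hPK : MajLE P K) (hn : 2 * (p + n) ≤ D)
    (h : IsNormalForm w N p n P (K ^ e) χ Q) :
    MajLE (substDiff P χ Q) (K ^ ((e + D + 3) * D + e + 1)) := by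
  have hK1 : 1 ≤ K := by linarith [hK.two_le]
  have hχD : ∀ γ ∈ χ.support, γ.degree ≤ D := fun γ hγ => (h.degree_gen γ hγ).trans hn
  have hQD : ∀ γ ∈ Q.support, γ.degree ≤ D := fun γ hγ => (h.degree_nf γ hγ).trans hn
  have hPK' : MajLE P (K ^ e) := fun x hx hx1 => (hPK x hx hx1).trans (le_self_pow₀ hK1 (by omega))
  -- D and 2 are both at most K, so the enlarged ℓ¹ size is again a power of K. The final sum of two
  -- terms costs one more factor 2 ≤ K.
  have hT : 1 + D * K ^ e * K * 2 ^ D ≤ K ^ (e + D + 3) := by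
    have h1 : D * K ^ e * K * 2 ^ D ≤ K * K ^ e * K * K ^ D := by
      have := hK.two_le
      have := hK.degree_le
      gcongr
    have h2 : K * K ^ e * K * K ^ D = K ^ (e + D + 2) := by ring
    have h3 : 1 ≤ K ^ (e + D + 2) := one_le_pow₀ hK1
    have h4 : K ^ (e + D + 3) = K * K ^ (e + D + 2) := by ring
    rw [h4]
    nlinarith [hK.two_le]
  have hT0 : 0 ≤ 1 + D * K ^ e * K * 2 ^ D := by positivity
  have key : (1 + D * K ^ e * K * 2 ^ D) ^ D * K ^ e ≤ K ^ ((e + D + 3) * D + e) := by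
    rw [pow_add, pow_mul]
    gcongr
  intro x hx hx1
  refine (maj_sub_le _ _ hx).trans ?_
  have h1 := majLE_aeval_shift h.coeff_gen hχD hK.kernel hPD hPK' (c := 1) (by simp) x hx hx1
  have h2 := majLE_aeval_shift h.coeff_gen hχD hK.kernel hQD h.maj_nf (c := -1) (by simp) x hx hx1
  have h3 : K ^ ((e + D + 3) * D + e + 1) = K * K ^ ((e + D + 3) * D + e) := by ring
  have h4 : 0 ≤ K ^ ((e + D + 3) * D + e) := by positivity
  rw [h3]
  nlinarith [hK.two_le]

/-- `homOp` only multiplies existing coefficients and χ has degree at most 2(p + n), so the higher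
degrees come from the substitutions alone. This matters for the bounds: `homOp` multiplies by
frequencies, which are not bounded by powers of K. -/
theorem coeff_remainder (h : IsNormalForm w N p n P (K ^ e) χ Q) {γ : Var M →₀ ℕ}
    (hγ : 2 * (p + n) < γ.degree) :
    (homOp w χ + substDiff P χ Q).coeff γ = (substDiff P χ Q).coeff γ := by
  have : χ.coeff γ = 0 := by
    by_contra h0
    have := h.degree_gen γ (mem_support_iff.mpr h0)
    omega
  rw [coeff_add, homOp, coeff_mult, this, mul_zero, zero_add]

/-- By parity the remainder E starts at degree d = 2(p + n) + 2. Its degree-d part is removed by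
adding to χ the solution η of the homological equation on the non-resonant monomials, and to Q the
resonant part q. The effect of η and q inside the substitutions has order at least d + 2p, which
exceeds d because p ≥ 1. -/
theorem IsNormalForm.step (hK : IsControl M N D w K) (hp : 1 ≤ p) (he : 1 ≤ e)
    (hPham : IsHamPoly P) (hPord : P ∈ idealOfVars (Var M) ℂ ^ (2 * p + 2))
    (hPD : ∀ γ ∈ P.support, γ.degree ≤ D) (hPK : MajLE P K) (hn : 2 * (p + n) + 2 ≤ D)
    (h : IsNormalForm w N p n P (K ^ e) χ Q) :
    ∃ χ' Q', IsNormalForm w N p (n + 1) P (K ^ ((e + D + 4) * D + e + 3)) χ' Q' := by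
  classical
  have hK2 := hK.two_le
  have hK1 : 1 ≤ K := by linarith
  have hK0 : 0 < K := by linarith
  set E := homOp w χ + substDiff P χ Q with hE
  have hEham : IsHamPoly E :=
    (isHamPoly_homOp h.ham_gen w).add (isHamPoly_substDiff hPham h.ham_gen h.ham_nf)
  have hEord : E ∈ idealOfVars (Var M) ℂ ^ (2 * (p + n) + 2) := hEham.mem_pow_even h.remainder
  set d := 2 * (p + n) + 2 with hd
  -- `homOp` multiplies by −iΩ, so multiplying E by (iΩ)⁻¹ makes `homOp w η` cancel the non-resonant
  -- part of degree d.
  let φ : (Var M →₀ ℕ) → ℂ := fun γ =>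
    if γ.degree = d ∧ ¬IsResonant N γ then (Complex.I * ((Finsupp.weight (sfreq w) γ : ℝ) : ℂ))⁻¹
    else 0
  let ψ : (Var M →₀ ℕ) → ℂ := fun γ => if γ.degree = d ∧ IsResonant N γ then 1 else 0
  let η := mult φ E
  let q := mult ψ E
  -- Reality survives the division: the exchange of u and ū changes the sign of Ω, as conjugation
  -- does for i.
  have hη : IsHamPoly η := hEham.mult fun γ => by
    simp only [φ, degree_swapIdx, isResonant_swapIdx, weight_swapIdx (sfreq_swap w)]
    split_ifs <;> simp
  have hq : IsHamPoly q := hEham.mult fun γ => by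
    simp only [ψ, degree_swapIdx, isResonant_swapIdx]
    split_ifs <;> simp
  have hηdeg : ∀ γ ∈ η.support, γ.degree = d := by
    intro γ hγ
    rw [mem_support_iff, coeff_mult] at hγ
    have := left_ne_zero_of_mul hγ
    simp only [φ, ne_eq, ite_eq_right_iff, not_forall] at this
    exact this.1.1
  have hqdeg : ∀ γ ∈ q.support, γ.degree = d ∧ IsResonant N γ := by
    intro γ hγ
    rw [mem_support_iff, coeff_mult] at hγ
    have := left_ne_zero_of_mul hγ
    simp only [ψ, ne_eq, ite_eq_right_iff, not_forall] at this
    exact this.1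
  have hηord : η ∈ idealOfVars (Var M) ℂ ^ d :=
    (mem_pow_idealOfVars_iff _ _).mpr fun γ hγ => (hηdeg γ hγ).ge
  have hqord : q ∈ idealOfVars (Var M) ℂ ^ d :=
    (mem_pow_idealOfVars_iff _ _).mpr fun γ hγ => (hqdeg γ hγ).1.ge
  have hle : idealOfVars (Var M) ℂ ^ d ≤ idealOfVars (Var M) ℂ ^ (2 * p + 2) :=
    Ideal.pow_le_pow_right (by omega)
  have hχ'ord : χ + η ∈ idealOfVars (Var M) ℂ ^ (2 * p + 2) := Ideal.add_mem _ h.order_gen (hle hηord)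
  have hQ'ord : Q + q ∈ idealOfVars (Var M) ℂ ^ (2 * p + 2) := Ideal.add_mem _ h.order_nf (hle hqord)
  have hMaj := majLE_substDiff hK he hPD hPK (by omega) h
  set a := (e + D + 3) * D + e + 1 with ha
  have haE : a + D + 2 = (e + D + 4) * D + e + 3 := by rw [ha]; ring
  have hcoeffE : ∀ γ : Var M →₀ ℕ, γ.degree = d → E.coeff γ = (substDiff P χ Q).coeff γ :=
    fun γ hγ => coeff_remainder h (by omega)
  refine ⟨χ + η, Q + q, h.ham_gen.add hη, h.ham_nf.add hq, hχ'ord, hQ'ord, ?_, ?_, ?_, ?_, ?_, ?_⟩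
  · intro γ hγ
    rcases Finset.mem_union.mp (support_add hγ) with h1 | h1
    · have := h.degree_gen γ h1; omega
    · have := hηdeg γ h1; omega
  · intro γ hγ
    rcases Finset.mem_union.mp (support_add hγ) with h1 | h1
    · have := h.degree_nf γ h1; omega
    · have := (hqdeg γ h1).1; omega
  · intro γ
    have h1 := h.coeff_gen γ
    -- Reading a coefficient off the majorant costs D^D ≤ K^D, and the small divisor, together with
    -- the weight 1 + |Σ ±k|, costs one factor K. Adding the old generator costs the last factor K,
    -- which gives the exponent a + D + 2.
    have hη1 : ‖η.coeff γ‖ * (1 + |((Finsupp.weight freq γ : ℤ) : ℝ)|) ≤ K ^ (a + D + 1) := by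
      rw [coeff_mult]
      by_cases hc : γ.degree = d ∧ ¬IsResonant N γ
      · by_cases h0 : E.coeff γ = 0
        · rw [h0, mul_zero, norm_zero, zero_mul]; positivity
        have hsd := hK.smallDivisor γ (hEham.gauge h0) (by omega) hc.2
        have hpos : 0 < |Finsupp.weight (sfreq w) γ| := by
          by_contra hneg
          have h5 : |Finsupp.weight (sfreq w) γ| = 0 := le_antisymm (not_lt.mp hneg) (abs_nonneg _)
          rw [h5, mul_zero] at hsd
          linarith [abs_nonneg ((Finsupp.weight freq γ : ℤ) : ℝ)]
        have hcE : ‖E.coeff γ‖ ≤ K ^ (a + D) := by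
          rw [hcoeffE γ hc.1]
          refine (hMaj.norm_coeff_le (d := D) (by omega) γ (by omega)).trans ?_
          have hDK : (D : ℝ) ^ D ≤ K ^ D := pow_le_pow_left₀ (Nat.cast_nonneg D) hK.degree_le D
          rw [add_comm a D, pow_add K D a]
          exact mul_le_mul_of_nonneg_right hDK (pow_nonneg hK0.le a)
        have hφ : ‖φ γ‖ = |Finsupp.weight (sfreq w) γ|⁻¹ := by
          simp only [φ, if_pos hc]
          simp
        rw [norm_mul, hφ]
        calc _ = ‖E.coeff γ‖ * (|Finsupp.weight (sfreq w) γ|⁻¹ *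
                (1 + |((Finsupp.weight freq γ : ℤ) : ℝ)|)) := by ring
          _ ≤ K ^ (a + D) * K := by
              refine mul_le_mul hcE ?_ (by positivity) (by positivity)
              rw [inv_mul_le_iff₀ hpos]
              linarith
          _ = K ^ (a + D + 1) := by ring
      · simp only [φ, if_neg hc, zero_mul, norm_zero]; positivity
    have h2 : ‖(χ + η).coeff γ‖ ≤ ‖χ.coeff γ‖ + ‖η.coeff γ‖ := by
      rw [coeff_add]; exact norm_add_le _ _
    have h3 : K ^ e ≤ K ^ (a + D + 1) := pow_le_pow_right₀ hK1 (by rw [ha]; omega)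
    rw [← haE]
    have h4 : K ^ (a + D + 2) = K * K ^ (a + D + 1) := by ring
    have h5 : 0 ≤ K ^ (a + D + 1) := by positivity
    have h6 : 0 ≤ 1 + |((Finsupp.weight freq γ : ℤ) : ℝ)| := by positivity
    rw [h4]
    nlinarith [mul_le_mul_of_nonneg_right h2 h6]
  · intro x hx hx1
    have h1 := h.maj_nf x hx hx1
    have h2 : maj q x ≤ K ^ a := by
      refine (maj_le_of_coeff_le (fun γ => ?_) hx).trans (hMaj x hx hx1)
      rw [coeff_mult]
      by_cases hc : γ.degree = d ∧ IsResonant N γ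
      · rw [hcoeffE γ hc.1]
        simp [ψ, hc]
      · simp [ψ, hc]
    have h3 : K ^ e ≤ K ^ a := pow_le_pow_right₀ hK1 (by rw [ha]; omega)
    have h4 : K ^ (a + 1) ≤ K ^ ((e + D + 4) * D + e + 3) := pow_le_pow_right₀ hK1 (by omega)
    have h5 : 0 ≤ K ^ a := by positivity
    have h6 : K ^ (a + 1) = K * K ^ a := by ring
    refine (maj_add_le _ _ hx).trans ?_
    nlinarith
  · intro γ hγ
    rcases Finset.mem_union.mp (support_add hγ) with h1 | h1
    · exact h.resonant γ h1
    · exact (hqdeg γ h1).2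
  · have e2 : 2 * (p + (n + 1)) + 1 = d + 1 := by omega
    rw [e2]
    have hχ2 : χ ∈ idealOfVars (Var M) ℂ ^ 2 := Ideal.pow_le_pow_right (by omega) h.order_gen
    have hχ'2 : χ + η ∈ idealOfVars (Var M) ℂ ^ 2 := Ideal.pow_le_pow_right (by omega) hχ'ord
    have hdiff : ∀ c : ℝ, ∀ v, shift (χ + η) c v - shift χ c v ∈
        idealOfVars (Var M) ℂ ^ (d - 1) := fun c v => by
      rw [shift_sub_shift]
      exact Ideal.mul_mem_left _ _ (vf_mem_pow (by rwa [Nat.sub_add_cancel (by omega)]) v)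
    have hid : ∀ v, shift (χ + η) (-1) v - X v ∈ idealOfVars (Var M) ℂ ^ (2 * p + 1) := fun v => by
      rw [shift, add_sub_cancel_left]
      exact Ideal.mul_mem_left _ _ (vf_mem_pow hχ'ord v)
    -- Replacing χ by χ + η changes the shifts at order d − 1, and P and Q have order 2p + 2: the
    -- change has order (2p + 1) + (d − 1). Replacing q(m − Y) by q(m) changes order (d − 1) + (2p +
    -- 1). Both are d + 2p.
    have t1 := aeval_sub_aeval_mem_pow (shift_mem hχ'2 1) (shift_mem hχ2 1) (hdiff 1) hPord
    have t2 := aeval_sub_aeval_mem_pow (shift_mem hχ'2 (-1)) (shift_mem hχ2 (-1)) (hdiff (-1))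
      h.order_nf
    have t3 := aeval_sub_aeval_mem_pow (shift_mem hχ'2 (-1)) X_mem_idealOfVars hid hqord
    -- Below degree d everything vanishes by the order of E. At degree d the resonant monomials are
    -- cancelled by q and the others by `homOp w η`.
    have t4 : E + homOp w η - q ∈ idealOfVars (Var M) ℂ ^ (d + 1) := by
      rw [mem_pow_idealOfVars_iff']
      intro γ hγ
      rw [coeff_sub, coeff_add, homOp, coeff_mult, coeff_mult, coeff_mult]
      rcases Nat.lt_succ_iff_lt_or_eq.mp hγ with hlt | heq
      · rw [(mem_pow_idealOfVars_iff' _ _).mp hEord γ hlt]; simp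
      · by_cases h0 : E.coeff γ = 0
        · simp [h0]
        by_cases hr : IsResonant N γ
        · simp [φ, ψ, heq, hr]
        · have hsd := hK.smallDivisor γ (hEham.gauge h0) (by omega) hr
          have hne : ((Finsupp.weight (sfreq w) γ : ℝ) : ℂ) ≠ 0 := by
            intro h5
            rw [Complex.ofReal_eq_zero] at h5
            rw [h5, abs_zero, mul_zero] at hsd
            linarith [abs_nonneg ((Finsupp.weight freq γ : ℤ) : ℝ)]
          simp only [φ, ψ, heq, hr, not_false_eq_true, and_true, and_false, if_true, if_false]
          field_simp
          simp
    have hsplit : homOp w (χ + η) + substDiff P (χ + η) (Q + q) =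
        (E + homOp w η - q) + (aeval (shift (χ + η) 1) P - aeval (shift χ 1) P)
        - (aeval (shift (χ + η) (-1)) Q - aeval (shift χ (-1)) Q)
        - (aeval (shift (χ + η) (-1)) q - aeval X q) := by
      rw [hE, substDiff, substDiff, map_add, homOp, mult_add, aeval_X_left, AlgHom.id_apply]
      simp only [homOp]
      ring
    rw [hsplit]
    refine Ideal.sub_mem _ (Ideal.sub_mem _ (Ideal.add_mem _ t4 ?_) ?_) ?_
    · exact Ideal.pow_le_pow_right (by omega) t1
    · exact Ideal.pow_le_pow_right (by omega) t2
    · exact Ideal.pow_le_pow_right (by omega) t3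

/-- Existence of the formal normal form, with bounds by powers of `K`. -/
theorem exists_isNormalForm (p D n : ℕ) (hp : 1 ≤ p) (hn : 2 * (p + n) ≤ D) :
    ∃ e : ℕ, 1 ≤ e ∧ ∀ (M N : ℕ) (w : ℕ+ → ℝ) (K : ℝ) (P : MvPolynomial (Var M) ℂ),
      IsControl M N D w K → IsHamPoly P → P ∈ idealOfVars (Var M) ℂ ^ (2 * p + 2) →
      (∀ γ ∈ P.support, γ.degree ≤ D) → MajLE P K →
      ∃ χ Q, IsNormalForm w N p n P (K ^ e) χ Q := by
  induction n with
  | zero =>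
    -- With χ = Q = 0 the shifts are the identity and the remainder is P itself, which has order 2p
    -- + 2.
    refine ⟨1, le_rfl, fun M N w K P hK hham hord hdeg hmaj => ⟨0, 0, ?_⟩⟩
    have hK0 : 0 ≤ K := by linarith [hK.two_le]
    refine ⟨isHamPoly_zero, isHamPoly_zero, Ideal.zero_mem _, Ideal.zero_mem _, by simp, by simp,
      fun γ => by simpa using hK0, fun x _ _ => by simpa using hK0, by simp, ?_⟩
    have h1 : shift (0 : MvPolynomial (Var M) ℂ) 1 = X := by
      funext v; simp [shift, vf]
    have h2 : homOp w (0 : MvPolynomial (Var M) ℂ) = 0 := by simp [homOp, mult]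
    rw [h2, substDiff, map_zero, h1, aeval_X_left, AlgHom.id_apply, zero_add, sub_zero]
    exact Ideal.pow_le_pow_right (by omega) hord
  | succ n ih =>
    obtain ⟨e, he, h⟩ := ih (by omega)
    refine ⟨(e + D + 4) * D + e + 3, by omega, fun M N w K P hK hham hord hdeg hmaj => ?_⟩
    obtain ⟨χ, Q, hχ⟩ := h M N w K P hK hham hord hdeg hmaj
    exact hχ.step hK hp he hham hord hdeg hmaj (by omega)

end Formal

end LowRegBNF
end


noncomputable section

namespace LowRegBNF

open MvPolynomial

/-! ### Bilinear estimates -/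

section Bilinear

/-- The Euclidean norm of a finite family. -/
def nrm {ι : Type*} [Fintype ι] (a : ι → ℝ) : ℝ := √(∑ i, a i ^ 2)

theorem nrm_nonneg {ι : Type*} [Fintype ι] (a : ι → ℝ) : 0 ≤ nrm a := Real.sqrt_nonneg _

/-- Schur's test. -/
theorem schur_test {ι κ : Type*} [Fintype ι] [Fintype κ] {T : ι → κ → ℝ} (hT : ∀ i j, 0 ≤ T i j)
    {K : ℝ} (hrow : ∀ i, ∑ j, T i j ≤ K) (hcol : ∀ j, ∑ i, T i j ≤ K) (hK : 0 ≤ K)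
    (a : ι → ℝ) (b : κ → ℝ) : ∑ i, ∑ j, a i * b j * T i j ≤ K * (nrm a * nrm b) := by
  have h1 : ∑ i, ∑ j, a i * b j * T i j =
      ∑ q : ι × κ, (a q.1 * √(T q.1 q.2)) * (b q.2 * √(T q.1 q.2)) := by
    rw [Fintype.sum_prod_type]
    refine Finset.sum_congr rfl fun i _ => Finset.sum_congr rfl fun j _ => ?_
    calc a i * b j * T i j = a i * b j * (√(T i j) * √(T i j)) := by rw [Real.mul_self_sqrt (hT i j)]
      _ = _ := by ring
  have h2 : ∑ q : ι × κ, (a q.1 * √(T q.1 q.2)) ^ 2 ≤ K * ∑ i, a i ^ 2 := by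
    rw [Fintype.sum_prod_type, Finset.mul_sum]
    refine Finset.sum_le_sum fun i _ => ?_
    simp only [mul_pow, Real.sq_sqrt (hT _ _)]
    rw [← Finset.mul_sum, mul_comm]
    exact mul_le_mul_of_nonneg_right (hrow i) (sq_nonneg _)
  have h3 : ∑ q : ι × κ, (b q.2 * √(T q.1 q.2)) ^ 2 ≤ K * ∑ j, b j ^ 2 := by
    rw [Fintype.sum_prod_type_right, Finset.mul_sum]
    refine Finset.sum_le_sum fun j _ => ?_
    simp only [mul_pow, Real.sq_sqrt (hT _ _)]
    rw [← Finset.mul_sum, mul_comm]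
    exact mul_le_mul_of_nonneg_right (hcol j) (sq_nonneg _)
  rw [h1]
  refine (Real.sum_mul_le_sqrt_mul_sqrt _ _ _).trans ?_
  calc _ ≤ √(K * ∑ i, a i ^ 2) * √(K * ∑ j, b j ^ 2) := by gcongr
    _ = (√K * √K) * (nrm a * nrm b) := by
        rw [Real.sqrt_mul hK, Real.sqrt_mul hK, nrm, nrm]; ring
    _ = _ := by rw [Real.mul_self_sqrt hK]

variable {M : ℕ}

/-- The Japanese bracket of the mode of a variable. -/
def japV : Var M → ℝ := Sum.elim (fun k => jap (mode k)) fun k => jap (mode k)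

theorem jap_pos (k : ℕ+) : 0 < jap k := Real.sqrt_pos.mpr (by positivity)

theorem japV_pos (v : Var M) : 0 < japV v := by
  rcases v with k | k <;> exact jap_pos _

theorem le_jap (k : ℕ+) : ((k : ℕ) : ℝ) ≤ jap k := Real.le_sqrt_of_sq_le (by linarith)

theorem jap_le (k : ℕ+) : jap k ≤ 1 + ((k : ℕ) : ℝ) :=
  Real.sqrt_le_iff.mpr ⟨by positivity, by nlinarith [Nat.cast_nonneg (α := ℝ) (k : ℕ)]⟩

theorem abs_freq (v : Var M) : |((freq v : ℤ) : ℝ)| ≤ japV v ∧ japV v ≤ 1 + |((freq v : ℤ) : ℝ)| := by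
  have key : ∀ k : Fin M, (((mode k : ℕ+) : ℕ) : ℝ) = (k : ℝ) + 1 := fun k => by simp [mode]
  rcases v with k | k
  · have h1 := le_jap (mode k)
    have h2 := jap_le (mode k)
    rw [key] at h1 h2
    have h3 : |((freq (Sum.inl k : Var M) : ℤ) : ℝ)| = (k : ℝ) + 1 := by
      simp only [freq, Sum.elim_inl]; push_cast; exact abs_of_nonneg (by positivity)
    rw [h3]; exact ⟨h1, h2⟩
  · have h1 := le_jap (mode k)
    have h2 := jap_le (mode k)
    rw [key] at h1 h2
    have h3 : |((freq (Sum.inr k : Var M) : ℤ) : ℝ)| = (k : ℝ) + 1 := by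
      simp only [freq, Sum.elim_inr]; push_cast; rw [abs_neg]; exact abs_of_nonneg (by positivity)
    rw [h3]; exact ⟨h1, h2⟩

theorem sqrt_add_le' {a b : ℝ} (ha : 0 ≤ a) (hb : 0 ≤ b) : √(a + b) ≤ √a + √b := by
  refine Real.sqrt_le_iff.mpr ⟨by positivity, ?_⟩
  nlinarith [Real.sq_sqrt ha, Real.sq_sqrt hb, mul_nonneg (Real.sqrt_nonneg a) (Real.sqrt_nonneg b)]

theorem sqrt_sum_le {ι : Type*} (s : Finset ι) {f : ι → ℝ} (hf : ∀ i ∈ s, 0 ≤ f i) :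
    √(∑ i ∈ s, f i) ≤ ∑ i ∈ s, √(f i) := by
  classical
  induction s using Finset.induction_on with
  | empty => simp
  | insert a s ha ih =>
    rw [Finset.sum_insert ha, Finset.sum_insert ha]
    have h1 := hf a (Finset.mem_insert_self a s)
    have h2 : 0 ≤ ∑ i ∈ s, f i := Finset.sum_nonneg fun i hi => hf i (Finset.mem_insert_of_mem hi)
    refine (sqrt_add_le' h1 h2).trans ?_
    gcongr
    exact ih fun i hi => hf i (Finset.mem_insert_of_mem hi)

/-- The frequency of l is the total frequency minus those of k and of the factors of γ. Taking
square roots distributes the weight ⟨l⟩^{1/2} over the kernel, the index k and the factors of the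
monomial; this is how half a derivative moves from the output to the inputs. -/
theorem sqrt_japV_le (γ : Var M →₀ ℕ) (k l : Var M) :
    √(japV l) ≤ √(1 + |((Finsupp.weight freq γ + freq k + freq l : ℤ) : ℝ)|) + √(japV k) +
      ∑ i, (γ i : ℝ) * √(japV i) := by
  set s : ℤ := Finsupp.weight freq γ + freq k + freq l with hs
  have h1 : (freq l : ℝ) = s - freq k - ∑ i, (γ i : ℝ) * freq i := by
    rw [hs, Finsupp.weight_eq_sum]
    simp only [nsmul_eq_mul]
    push_cast
    ring
  have h2 : |((freq l : ℤ) : ℝ)| ≤ |(s : ℝ)| + |((freq k : ℤ) : ℝ)| + ∑ i, (γ i : ℝ) * japV i := by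
    rw [h1]
    refine (abs_sub _ _).trans (add_le_add (abs_sub _ _) ?_)
    refine (Finset.abs_sum_le_sum_abs _ _).trans (Finset.sum_le_sum fun i _ => ?_)
    rw [abs_mul, Nat.abs_cast]
    exact mul_le_mul_of_nonneg_left (abs_freq i).1 (Nat.cast_nonneg _)
  have h3 : japV l ≤ ((1 + |(s : ℝ)|) + japV k) + ∑ i, (γ i : ℝ) * japV i := by
    linarith [(abs_freq l).2, (abs_freq k).1]
  have hs0 : 0 ≤ ∑ i, (γ i : ℝ) * japV i :=
    Finset.sum_nonneg fun i _ => mul_nonneg (Nat.cast_nonneg _) (japV_pos i).le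
  refine (Real.sqrt_le_sqrt h3).trans ?_
  have hk := (japV_pos k).le
  refine (sqrt_add_le' (by positivity) hs0).trans (add_le_add ?_ ?_)
  · exact sqrt_add_le' (by positivity) hk
  · refine (sqrt_sum_le _ fun i _ => mul_nonneg (Nat.cast_nonneg _) (japV_pos i).le).trans ?_
    refine Finset.sum_le_sum fun i _ => ?_
    rw [Real.sqrt_mul (Nat.cast_nonneg _)]
    refine mul_le_mul_of_nonneg_right ?_ (Real.sqrt_nonneg _)
    rcases Nat.eq_zero_or_pos (γ i) with h | h
    · simp [h]
    · have h1 : (1 : ℝ) ≤ γ i := by exact_mod_cast h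
      exact Real.sqrt_le_iff.mpr ⟨by linarith, by nlinarith⟩

/-- One factor x_i is split off from each monomial that contains it. The argument of g stays γ + e_i
after the reindexing, so a kernel attached to the monomial keeps the frequency of i. -/
theorem sum_mul_mon_le (D : ℕ) {x : Var M → ℝ} (hx : 0 ≤ x) (i : Var M)
    {g : (Var M →₀ ℕ) → ℝ} (hg : ∀ γ, 0 ≤ g γ) :
    ∑ γ ∈ multiIndices (Var M) D, (γ i : ℝ) * (mon x γ * g γ) ≤
      D * x i * ∑ γ ∈ multiIndices (Var M) D, mon x γ * g (γ + Finsupp.single i 1) := by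
  classical
  have hnn : ∀ γ, 0 ≤ mon x γ * g γ := fun γ => mul_nonneg (mon_nonneg hx γ) (hg γ)
  calc ∑ γ ∈ multiIndices (Var M) D, (γ i : ℝ) * (mon x γ * g γ)
      = ∑ γ ∈ (multiIndices (Var M) D).filter (fun γ => γ i ≠ 0), (γ i : ℝ) * (mon x γ * g γ) := by
        rw [Finset.sum_filter_of_ne]
        intro γ _ h h0
        exact h (by simp [h0])
    _ ≤ ∑ γ ∈ (multiIndices (Var M) D).filter (fun γ => γ i ≠ 0), (D : ℝ) * (mon x γ * g γ) := by
        refine Finset.sum_le_sum fun γ hγ => mul_le_mul_of_nonneg_right ?_ (hnn γ)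
        have := mem_multiIndices.mp (Finset.mem_filter.mp hγ).1
        exact_mod_cast (Finsupp.le_degree i γ).trans this
    _ ≤ ∑ γ ∈ (multiIndices (Var M) D).image (fun δ => δ + Finsupp.single i 1),
          (D : ℝ) * (mon x γ * g γ) := by
        refine Finset.sum_le_sum_of_subset_of_nonneg ?_ fun γ _ _ =>
          mul_nonneg (Nat.cast_nonneg _) (hnn γ)
        intro γ hγ
        rw [Finset.mem_filter, mem_multiIndices] at hγ
        have e : γ - Finsupp.single i 1 + Finsupp.single i 1 = γ :=
          tsub_add_cancel_of_le (Finsupp.single_le_iff.mpr (Nat.one_le_iff_ne_zero.mpr hγ.2))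
        refine Finset.mem_image.mpr ⟨γ - Finsupp.single i 1, ?_, e⟩
        rw [mem_multiIndices]
        have := degree_add_single (γ - Finsupp.single i 1) i
        rw [e] at this
        omega
    _ = _ := by
        rw [Finset.sum_image fun a _ b _ h => add_right_cancel h, Finset.mul_sum]
        refine Finset.sum_congr rfl fun γ _ => ?_
        rw [mon_add, mon_single, pow_one]
        ring

theorem norm_coeff_pderiv_pderiv_le {χ : MvPolynomial (Var M) ℂ} {A : ℝ} (hχ : CoeffLE χ A) {D : ℕ}
    (hD : ∀ γ ∈ χ.support, γ.degree ≤ D) (k l : Var M) (γ : Var M →₀ ℕ) :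
    ‖(pderiv k (pderiv l χ)).coeff γ‖ ≤
      D ^ 2 * A * (1 / (1 + |((Finsupp.weight freq γ + freq k + freq l : ℤ) : ℝ)|)) := by
  have hA := hχ.nonneg
  rw [coeff_pderiv, coeff_pderiv, norm_mul, norm_mul]
  set δ := γ + Finsupp.single k 1 with hδ
  by_cases h0 : χ.coeff (δ + Finsupp.single l 1) = 0
  · rw [h0, norm_zero, zero_mul, zero_mul]; positivity
  have h1 := hχ (δ + Finsupp.single l 1)
  rw [hδ, map_add, map_add, Finsupp.weight_single, Finsupp.weight_single, one_smul, one_smul,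
    ← hδ] at h1
  have hdeg := hD _ (mem_support_iff.mpr h0)
  have hdegγ : δ.degree = γ.degree + 1 := degree_add_single _ _
  rw [degree_add_single] at hdeg
  have h4 : ∀ n : ℕ, n + 1 ≤ D → ‖(n : ℂ) + 1‖ ≤ D := fun n hn => by
    have : ‖(n : ℂ) + 1‖ = ((n + 1 : ℕ) : ℝ) := by rw [← Complex.norm_natCast]; push_cast; rfl
    rw [this]
    exact_mod_cast hn
  have h2 := h4 (δ l) (by have := Finsupp.le_degree l δ; omega)
  have h3 := h4 (γ k) (by have := Finsupp.le_degree k γ; omega)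
  rw [mul_one_div, le_div_iff₀ (by positivity)]
  calc _ = ‖((δ l : ℕ) : ℂ) + 1‖ * ‖((γ k : ℕ) : ℂ) + 1‖ * (‖χ.coeff (δ + Finsupp.single l 1)‖ *
          (1 + |((Finsupp.weight freq γ + freq k + freq l : ℤ) : ℝ)|)) := by ring
    _ ≤ D * D * A := mul_le_mul (mul_le_mul h2 h3 (by positivity) (by positivity)) h1
        (by positivity) (by positivity)
    _ = D ^ 2 * A := by ring

theorem maj_pderiv_pderiv_le {χ : MvPolynomial (Var M) ℂ} {A : ℝ} (hχ : CoeffLE χ A) {D : ℕ}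
    (hD : ∀ γ ∈ χ.support, γ.degree ≤ D) (k l : Var M) {x : Var M → ℝ} (hx : 0 ≤ x) :
    maj (pderiv k (pderiv l χ)) x ≤ ∑ γ ∈ multiIndices (Var M) D,
      D ^ 2 * A * (1 / (1 + |((Finsupp.weight freq γ + freq k + freq l : ℤ) : ℝ)|)) * mon x γ := by
  have hs : (pderiv k (pderiv l χ)).support ⊆ multiIndices (Var M) D := by
    intro γ hγ
    rw [mem_support_iff, coeff_pderiv, coeff_pderiv] at hγ
    have := hD _ (mem_support_iff.mpr (left_ne_zero_of_mul (left_ne_zero_of_mul hγ)))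
    rw [degree_add_single, degree_add_single] at this
    rw [mem_multiIndices]
    omega
  rw [maj_eq_sum hs]
  exact Finset.sum_le_sum fun γ _ =>
    mul_le_mul_of_nonneg_right (norm_coeff_pderiv_pderiv_le hχ hD k l γ) (mon_nonneg hx γ)

/-- The weighted norm `(∑ ⟨v⟩ a_v²)^{1/2}`. -/
def wNorm (a : Var M → ℝ) : ℝ := nrm fun v => √(japV v) * a v

/-- The weighted norm `(∑ ⟨v⟩⁻¹ a_v²)^{1/2}`. -/
def wNormDual (a : Var M → ℝ) : ℝ := nrm fun v => a v / √(japV v)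

/-- Cauchy–Schwarz against ⟨v⟩^{-1/2}: the embedding of h^{1/2} into ℓ¹ fails only logarithmically.
The bound √K is weakened to K. -/
theorem sum_le_wNorm {K : ℝ} (hJ : ∑ v : Var M, 1 / japV v ≤ K) (hK : 1 ≤ K) (a : Var M → ℝ) :
    ∑ v, a v ≤ K * wNorm a := by
  have h1 : ∑ v, a v = ∑ v, (1 / √(japV v)) * (√(japV v) * a v) :=
    Finset.sum_congr rfl fun v _ => by
      have := (Real.sqrt_pos.mpr (japV_pos v)).ne'
      field_simp
  rw [h1]
  refine (Real.sum_mul_le_sqrt_mul_sqrt _ _ _).trans ?_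
  refine mul_le_mul_of_nonneg_right ?_ (nrm_nonneg _)
  refine Real.sqrt_le_iff.mpr ⟨by linarith, ?_⟩
  have : ∑ v : Var M, (1 / √(japV v)) ^ 2 = ∑ v : Var M, 1 / japV v :=
    Finset.sum_congr rfl fun v _ => by rw [div_pow, Real.sq_sqrt (japV_pos v).le, one_pow]
  rw [this]
  nlinarith

/-- The bilinear estimate for the kernel at one monomial. -/
theorem sum_sum_kernel_le {K : ℝ} (hK : KernelLE M K) (hK1 : 1 ≤ K) {c : ℤ} (a b : Var M → ℝ) :
    ∑ k, ∑ l, a k * b l * (1 / (1 + |((c + freq k + freq l : ℤ) : ℝ)|)) ≤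
      K * (nrm a * nrm b) := by
  refine schur_test (fun _ _ => by positivity) (fun k => hK _) (fun l => ?_) (by linarith) a b
  refine le_of_eq_of_le (Finset.sum_congr rfl fun k _ => ?_) (hK (c + freq l))
  rw [add_right_comm]

/-- When the kernel absorbs the weight, only its square root is left. The square of that root is the
kernel itself, so Cauchy–Schwarz in l suffices for each k, and a is summed in ℓ¹. -/
theorem sum_sum_sqrt_kernel_le {K : ℝ} (hK : KernelLE M K) (hK1 : 1 ≤ K) {c : ℤ} {a b : Var M → ℝ}
    (ha : 0 ≤ a) :
    ∑ k, ∑ l, a k * b l * (√(1 + |((c + freq k + freq l : ℤ) : ℝ)|) *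
      (1 / (1 + |((c + freq k + freq l : ℤ) : ℝ)|))) ≤ K * ((∑ k, a k) * nrm b) := by
  have h : ∀ k : Var M, ∑ l, b l * (√(1 + |((c + freq k + freq l : ℤ) : ℝ)|) *
      (1 / (1 + |((c + freq k + freq l : ℤ) : ℝ)|))) ≤ K * nrm b := by
    intro k
    refine (Real.sum_mul_le_sqrt_mul_sqrt _ _ _).trans ?_
    rw [mul_comm]
    refine mul_le_mul_of_nonneg_right ?_ (nrm_nonneg _)
    refine Real.sqrt_le_iff.mpr ⟨by linarith, ?_⟩
    refine le_trans (le_of_eq_of_le (Finset.sum_congr rfl fun l _ => ?_) (hK (c + freq k)))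
      (by nlinarith)
    have h0 : 0 < 1 + |((c + freq k + freq l : ℤ) : ℝ)| := by positivity
    rw [mul_pow, Real.sq_sqrt h0.le]
    field_simp
  calc _ = ∑ k, a k * ∑ l, b l * (√(1 + |((c + freq k + freq l : ℤ) : ℝ)|) *
      (1 / (1 + |((c + freq k + freq l : ℤ) : ℝ)|))) := by
        refine Finset.sum_congr rfl fun k _ => ?_
        rw [Finset.mul_sum]
        exact Finset.sum_congr rfl fun l _ => by ring
    _ ≤ ∑ k, a k * (K * nrm b) :=
        Finset.sum_le_sum fun k _ => mul_le_mul_of_nonneg_left (h k) (ha k)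
    _ = _ := by rw [← Finset.sum_mul]; ring

/-- The weight on l is split by `sqrt_japV_le` into three terms, which fall in turn on the kernel,
on y and on a factor of the monomial. -/
theorem sum_mon_kernel_le {D : ℕ} {K : ℝ} (hK : KernelLE M K) (hK1 : 1 ≤ K)
    {x y b : Var M → ℝ} (hx : 0 ≤ x) (hy : 0 ≤ y) (hb : 0 ≤ b) :
    ∑ γ ∈ multiIndices (Var M) D, mon x γ * ∑ k, ∑ l, y k * b l * (√(japV l) *
      (1 / (1 + |((Finsupp.weight freq γ + freq k + freq l : ℤ) : ℝ)|))) ≤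
    (1 + ∑ v, x v) ^ D * (K * nrm b * ((∑ k, y k) + wNorm y + D * ((∑ k, y k) * wNorm x))) := by
  have hb0 := nrm_nonneg b
  have hK0 : 0 ≤ K := by linarith
  have hY : 0 ≤ ∑ k, y k := Finset.sum_nonneg fun k _ => hy k
  let κ : (Var M →₀ ℕ) → Var M → Var M → ℝ := fun γ k l =>
    1 / (1 + |((Finsupp.weight freq γ + freq k + freq l : ℤ) : ℝ)|)
  have hκ : ∀ γ k l, 0 ≤ κ γ k l := fun γ k l => by positivity
  let S : (Var M →₀ ℕ) → ℝ := fun γ => ∑ k, ∑ l, y k * b l * κ γ k l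
  have hS : ∀ γ, 0 ≤ S γ := fun γ => Finset.sum_nonneg fun k _ => Finset.sum_nonneg fun l _ =>
    mul_nonneg (mul_nonneg (hy k) (hb l)) (hκ γ k l)
  have hpt : ∀ γ, ∑ k, ∑ l, y k * b l * (√(japV l) * κ γ k l) ≤
      K * nrm b * ((∑ k, y k) + wNorm y) + ∑ i, √(japV i) * ((γ i : ℝ) * S γ) := by
    intro γ
    have h1 := sum_sum_sqrt_kernel_le hK hK1 (c := Finsupp.weight freq γ) (b := b) hy
    have h2 := sum_sum_kernel_le hK hK1 (c := Finsupp.weight freq γ) (fun v => √(japV v) * y v) b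
    calc ∑ k, ∑ l, y k * b l * (√(japV l) * κ γ k l)
        ≤ ∑ k, ∑ l, (y k * b l *
            (√(1 + |((Finsupp.weight freq γ + freq k + freq l : ℤ) : ℝ)|) * κ γ k l) +
            √(japV k) * y k * b l * κ γ k l +
            (∑ i, (γ i : ℝ) * √(japV i)) * (y k * b l * κ γ k l)) := by
          refine Finset.sum_le_sum fun k _ => Finset.sum_le_sum fun l _ => ?_
          have h3 := mul_le_mul_of_nonneg_right (sqrt_japV_le γ k l)
            (mul_nonneg (mul_nonneg (hy k) (hb l)) (hκ γ k l))
          linarith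
      _ = ∑ k, ∑ l, y k * b l *
            (√(1 + |((Finsupp.weight freq γ + freq k + freq l : ℤ) : ℝ)|) * κ γ k l) +
          ∑ k, ∑ l, √(japV k) * y k * b l * κ γ k l + (∑ i, (γ i : ℝ) * √(japV i)) * S γ := by
          simp only [S, Finset.sum_add_distrib, Finset.mul_sum]
      _ ≤ K * ((∑ k, y k) * nrm b) + K * (wNorm y * nrm b) +
          (∑ i, (γ i : ℝ) * √(japV i)) * S γ := add_le_add (add_le_add h1 h2) le_rfl
      _ = _ := by
          have hsum : (∑ i, (γ i : ℝ) * √(japV i)) * S γ = ∑ i, √(japV i) * ((γ i : ℝ) * S γ) := by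
            rw [Finset.sum_mul]
            exact Finset.sum_congr rfl fun i _ => by ring
          rw [hsum]
          ring
  -- The weight now sits on a factor x_i of the monomial. The roles of k and i are exchanged:
  -- Schur's test is applied in (i, l), with k as part of the fixed frequency, and y is summed in
  -- ℓ¹.
  have hthird : ∑ i, √(japV i) * ∑ γ ∈ multiIndices (Var M) D, (γ i : ℝ) * (mon x γ * S γ) ≤
      (1 + ∑ v, x v) ^ D * (D * (K * ((∑ k, y k) * (wNorm x * nrm b)))) := by
    calc ∑ i, √(japV i) * ∑ γ ∈ multiIndices (Var M) D, (γ i : ℝ) * (mon x γ * S γ)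
        ≤ ∑ i, √(japV i) * (D * x i * ∑ γ ∈ multiIndices (Var M) D,
            mon x γ * S (γ + Finsupp.single i 1)) :=
          Finset.sum_le_sum fun i _ => mul_le_mul_of_nonneg_left
            (sum_mul_mon_le D hx i hS) (Real.sqrt_nonneg _)
      _ = ∑ γ ∈ multiIndices (Var M) D, mon x γ * (D * ∑ k, y k * ∑ i, ∑ l,
            (√(japV i) * x i) * b l *
              (1 / (1 + |(((Finsupp.weight freq γ + freq k) + freq i + freq l : ℤ) : ℝ)|))) := by
          simp only [S, κ, Finset.mul_sum]
          rw [Finset.sum_comm]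
          refine Finset.sum_congr rfl fun γ _ => ?_
          rw [Finset.sum_comm]
          refine Finset.sum_congr rfl fun k _ => Finset.sum_congr rfl fun i _ =>
            Finset.sum_congr rfl fun l _ => ?_
          rw [map_add, Finsupp.weight_single, one_smul, add_right_comm (Finsupp.weight freq γ)]
          ring
      _ ≤ ∑ γ ∈ multiIndices (Var M) D, mon x γ * (D * (K * ((∑ k, y k) * (wNorm x * nrm b)))) := by
          refine Finset.sum_le_sum fun γ _ => mul_le_mul_of_nonneg_left
            (mul_le_mul_of_nonneg_left ?_ (Nat.cast_nonneg _)) (mon_nonneg hx γ)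
          calc _ ≤ ∑ k, y k * (K * (wNorm x * nrm b)) := Finset.sum_le_sum fun k _ =>
                mul_le_mul_of_nonneg_left (sum_sum_kernel_le hK hK1 _ _) (hy k)
            _ = _ := by rw [← Finset.sum_mul]; ring
      _ ≤ _ := by
          rw [← Finset.sum_mul]
          refine mul_le_mul_of_nonneg_right (sum_mon_le D hx) ?_
          have : 0 ≤ wNorm x := nrm_nonneg _
          positivity
  calc _ ≤ ∑ γ ∈ multiIndices (Var M) D, mon x γ * (K * nrm b * ((∑ k, y k) + wNorm y) +
          ∑ i, √(japV i) * ((γ i : ℝ) * S γ)) :=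
        Finset.sum_le_sum fun γ _ => mul_le_mul_of_nonneg_left (hpt γ) (mon_nonneg hx γ)
    _ = (∑ γ ∈ multiIndices (Var M) D, mon x γ) * (K * nrm b * ((∑ k, y k) + wNorm y)) +
          ∑ i, √(japV i) * ∑ γ ∈ multiIndices (Var M) D, (γ i : ℝ) * (mon x γ * S γ) := by
        simp only [mul_add (mon x _), Finset.sum_add_distrib, Finset.sum_mul]
        congr 1
        simp only [Finset.mul_sum]
        rw [Finset.sum_comm]
        exact Finset.sum_congr rfl fun i _ => Finset.sum_congr rfl fun γ _ => by ring
    _ ≤ (1 + ∑ v, x v) ^ D * (K * nrm b * ((∑ k, y k) + wNorm y)) +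
          (1 + ∑ v, x v) ^ D * (D * (K * ((∑ k, y k) * (wNorm x * nrm b)))) := by
        refine add_le_add (mul_le_mul_of_nonneg_right (sum_mon_le D hx) ?_) hthird
        have : 0 ≤ wNorm y := nrm_nonneg _
        positivity
    _ = _ := by ring

/-- The second derivative of a generator is bounded from `h^{1/2}` to `h^{1/2}`. -/
theorem sum_sum_maj_le {χ : MvPolynomial (Var M) ℂ} {e : ℕ} {K : ℝ} (hχ : CoeffLE χ (K ^ e))
    {D : ℕ} (hD : ∀ γ ∈ χ.support, γ.degree ≤ D) (hDK : (D : ℝ) ≤ K) (hK : KernelLE M K)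
    (hJ : ∑ v : Var M, 1 / japV v ≤ K) (hK2 : 2 ≤ K) {x y z : Var M → ℝ} (hx : 0 ≤ x) (hy : 0 ≤ y)
    (hz : 0 ≤ z) (hx1 : wNorm x ≤ 1) :
    ∑ k, ∑ l, y k * z l * maj (pderiv k (pderiv l χ)) x ≤
      K ^ (e + 2 * D + 7) * (wNorm y * wNormDual z) := by
  have hK1 : 1 ≤ K := by linarith
  have hK0 : 0 ≤ K := by linarith
  -- Dividing z by ⟨l⟩^{1/2} makes the dual norm of z the Euclidean norm of b, and leaves the weight
  -- ⟨l⟩^{1/2} to be redistributed.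
  let b : Var M → ℝ := fun l => z l / √(japV l)
  have hb : 0 ≤ b := fun l => div_nonneg (hz l) (Real.sqrt_nonneg _)
  have hzb : ∀ l, z l = b l * √(japV l) := fun l => by
    have := (Real.sqrt_pos.mpr (japV_pos l)).ne'
    simp only [b]
    field_simp
  have hyw : 0 ≤ wNorm y := nrm_nonneg _
  have hzw : 0 ≤ wNormDual z := nrm_nonneg _
  have hxw : 0 ≤ wNorm x := nrm_nonneg _
  have hsy := sum_le_wNorm hJ hK1 y
  have hsx := sum_le_wNorm hJ hK1 x
  have hsx0 : 0 ≤ ∑ v, x v := Finset.sum_nonneg fun v _ => hx v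
  have hsy0 : 0 ≤ ∑ v, y v := Finset.sum_nonneg fun v _ => hy v
  have h1 : (1 + ∑ v, x v) ^ D ≤ K ^ (2 * D) := by
    rw [pow_mul]
    exact pow_le_pow_left₀ (by linarith) (by nlinarith) D
  have h2 : (∑ k, y k) + wNorm y + D * ((∑ k, y k) * wNorm x) ≤ K ^ 3 * wNorm y := by
    have h3 : D * ((∑ k, y k) * wNorm x) ≤ K * (K * wNorm y * 1) := by gcongr
    have h4 : K + 1 + K ^ 2 ≤ K ^ 3 := by nlinarith
    nlinarith
  calc ∑ k, ∑ l, y k * z l * maj (pderiv k (pderiv l χ)) x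
      ≤ ∑ k, ∑ l, y k * z l * ∑ γ ∈ multiIndices (Var M) D, D ^ 2 * K ^ e *
        (1 / (1 + |((Finsupp.weight freq γ + freq k + freq l : ℤ) : ℝ)|)) * mon x γ :=
        Finset.sum_le_sum fun k _ => Finset.sum_le_sum fun l _ => mul_le_mul_of_nonneg_left
          (maj_pderiv_pderiv_le hχ hD k l hx) (mul_nonneg (hy k) (hz l))
    _ = D ^ 2 * K ^ e * ∑ γ ∈ multiIndices (Var M) D, mon x γ * ∑ k, ∑ l, y k * b l * (√(japV l) *
        (1 / (1 + |((Finsupp.weight freq γ + freq k + freq l : ℤ) : ℝ)|))) := by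
        simp only [Finset.mul_sum, hzb]
        rw [Finset.sum_comm' (t' := Finset.univ) (s' := fun _ => Finset.univ) (by simp)]
        conv_rhs => rw [Finset.sum_comm]
        rw [Finset.sum_comm]
        refine Finset.sum_congr rfl fun k _ => ?_
        rw [Finset.sum_comm]
        exact Finset.sum_congr rfl fun γ _ => Finset.sum_congr rfl fun l _ => by ring
    _ ≤ D ^ 2 * K ^ e * ((1 + ∑ v, x v) ^ D *
          (K * nrm b * ((∑ k, y k) + wNorm y + D * ((∑ k, y k) * wNorm x)))) :=
        mul_le_mul_of_nonneg_left (sum_mon_kernel_le hK hK1 hx hy hb) (by positivity)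
    _ ≤ K ^ 2 * K ^ e * (K ^ (2 * D) * (K * wNormDual z * (K ^ 3 * wNorm y))) := by
        have : nrm b = wNormDual z := rfl
        rw [this]
        gcongr
    _ = K ^ (e + 2 * D + 6) * (wNorm y * wNormDual z) := by ring
    _ ≤ _ := by
        refine mul_le_mul_of_nonneg_right (pow_le_pow_right₀ hK1 (by omega)) (by positivity)

end Bilinear

end LowRegBNF
end


noncomputable section

namespace LowRegBNF

open MvPolynomial

/-! ### Polynomials as functions on phase space -/

section Eval

variable {M : ℕ}

/-- The values of the variables at `u`. -/
def pt (u : Phase M) : Var M → ℂ := Sum.elim u fun k => (starRingEnd ℂ) (u k)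

/-- The value of a variable, as a linear form. -/
def ptL : Var M → Phase M →L[ℝ] ℂ :=
  Sum.elim (fun k => ContinuousLinearMap.proj k)
    fun k => (Complex.conjCLE : ℂ →L[ℝ] ℂ).comp (ContinuousLinearMap.proj k)

@[simp] theorem ptL_apply (v : Var M) (u : Phase M) : ptL v u = pt u v := by
  rcases v with k | k <;> simp [ptL, pt]

theorem conj_pt (u : Phase M) (v : Var M) : (starRingEnd ℂ) (pt u v) = pt u v.swap := by
  rcases v with k | k <;> simp [pt]

theorem eval_conjP (f : MvPolynomial (Var M) ℂ) (u : Phase M) :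
    eval (pt u) (conjP f) = (starRingEnd ℂ) (eval (pt u) f) := by
  induction f using MvPolynomial.induction_on with
  | C c => simp
  | add f g hf hg => simp [hf, hg]
  | mul_X f v hf => rw [map_mul, map_mul, map_mul, map_mul, hf, conjP_X, eval_X, eval_X, conj_pt]

/-- The real part of the value of a polynomial. -/
def reEval (f : MvPolynomial (Var M) ℂ) (u : Phase M) : ℝ := (eval (pt u) f).re

theorem coe_ptL (v : Var M) : ⇑(ptL v) = fun u : Phase M => pt u v := funext fun u => ptL_apply v u

theorem hasFDerivAt_eval (f : MvPolynomial (Var M) ℂ) (u : Phase M) :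
    HasFDerivAt (𝕜 := ℝ) (fun u => eval (pt u) f) (∑ v, eval (pt u) (pderiv v f) • ptL v) u := by
  classical
  induction f using MvPolynomial.induction_on with
  | C c =>
    simp only [eval_C]
    refine (hasFDerivAt_const (𝕜 := ℝ) c u).congr_fderiv (ContinuousLinearMap.ext fun w => ?_)
    simp
  | add f g hf hg =>
    simp only [map_add]
    refine (hf.fun_add hg).congr_fderiv (ContinuousLinearMap.ext fun w => ?_)
    simp only [add_apply, sum_apply, smul_apply, smul_eq_mul,
      add_mul, Finset.sum_add_distrib]
  | mul_X f v hf =>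
    have hX : HasFDerivAt (fun u : Phase M => pt u v) (ptL v) u := by
      rw [← coe_ptL]
      exact (ptL v).hasFDerivAt
    simp only [map_mul, eval_X]
    refine (hf.fun_mul hX).congr_fderiv (ContinuousLinearMap.ext fun w => ?_)
    have h1 : ∀ i, eval (pt u) (pderiv i (f * X v)) =
        pt u v * eval (pt u) (pderiv i f) + if i = v then eval (pt u) f else 0 := by
      intro i
      rw [pderiv_mul, map_add, map_mul, map_mul, eval_X]
      by_cases h : i = v
      · subst h; simp; ring
      · rw [pderiv_X_of_ne (Ne.symm h)]; simp [h]; ring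
    simp only [add_apply, sum_apply, smul_apply, smul_eq_mul, h1,
      add_mul, Finset.sum_add_distrib, ite_mul, zero_mul, Finset.sum_ite_eq',
      Finset.mem_univ, if_true, Finset.mul_sum, mul_assoc]
    rw [add_comm]

theorem contDiff_eval (f : MvPolynomial (Var M) ℂ) : ContDiff ℝ ∞ fun u : Phase M => eval (pt u) f := by
  have hpt : ∀ v : Var M, ContDiff ℝ ∞ fun u : Phase M => pt u v := fun v => by
    rw [← coe_ptL]
    exact (ptL v).contDiff
  simp only [eval_eq']
  exact ContDiff.sum fun γ _ => contDiff_const.mul (contDiff_prod fun v _ => (hpt v).pow _)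

theorem contDiff_reEval (f : MvPolynomial (Var M) ℂ) : ContDiff ℝ ∞ (reEval f) :=
  Complex.reCLM.contDiff.comp (contDiff_eval f)

theorem fderiv_reEval (f : MvPolynomial (Var M) ℂ) (u v : Phase M) :
    fderiv ℝ (reEval f) u v = (∑ i, eval (pt u) (pderiv i f) * pt v i).re := by
  have h : HasFDerivAt (reEval f) _ u := Complex.reCLM.hasFDerivAt.comp u (hasFDerivAt_eval f u)
  rw [h.fderiv]
  simp

/-- Half of the Hamiltonian vector field of `χ`. -/
def vfield (χ : MvPolynomial (Var M) ℂ) (u : Phase M) : Phase M := fun k =>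
  eval (pt u) (vf χ (Sum.inl k))

theorem contDiff_vfield (χ : MvPolynomial (Var M) ℂ) : ContDiff ℝ ∞ (vfield χ) :=
  contDiff_pi.mpr fun _ => contDiff_eval _

theorem fderiv_vfield (χ : MvPolynomial (Var M) ℂ) (u v : Phase M) (k : Fin M) :
    fderiv ℝ (vfield χ) u v k =
      Complex.I * ∑ i, eval (pt u) (pderiv i (pderiv (Sum.inr k) χ)) * pt v i := by
  have h : HasFDerivAt (vfield χ) (ContinuousLinearMap.pi fun k =>
      ∑ i, eval (pt u) (pderiv i (vf χ (Sum.inl k))) • ptL i) u :=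
    hasFDerivAt_pi.mpr fun k => hasFDerivAt_eval _ u
  rw [h.fderiv]
  simp only [ContinuousLinearMap.pi_apply, sum_apply, smul_apply, smul_eq_mul,
    ptL_apply, vf, pderiv_C_mul, map_mul, eval_C, Finset.mul_sum, mul_assoc]
  simp [charge, -Fintype.sum_sum_type]

/-- Translation by a multiple of the field is a polynomial substitution, exactly. Reality of χ is
needed for the ū-components to be the conjugates of the u-components. -/
theorem pt_add_smul_vfield {χ : MvPolynomial (Var M) ℂ} (hχ : IsHamPoly χ) (c : ℝ) (u : Phase M) :
    pt (u + c • vfield χ u) = fun v => eval (pt u) (shift χ c v) := by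
  funext v
  rcases v with k | k
  · simp [pt, shift, vfield]
  · have h : eval (pt u) (vf χ (Sum.inr k)) = (starRingEnd ℂ) (vfield χ u k) := by
      rw [vfield, ← eval_conjP, conjP_vf hχ]; rfl
    rw [shift, map_add, map_mul, h, eval_X, eval_C]
    simp [pt]

theorem eval_add_smul_vfield {χ : MvPolynomial (Var M) ℂ} (hχ : IsHamPoly χ) (c : ℝ) (u : Phase M)
    (f : MvPolynomial (Var M) ℂ) :
    eval (pt (u + c • vfield χ u)) f = eval (pt u) (aeval (shift χ c) f) := by
  rw [pt_add_smul_vfield hχ]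
  induction f using MvPolynomial.induction_on with
  | C a => simp [algebraMap_eq]
  | add f g hf hg => rw [map_add, map_add, map_add, hf, hg]
  | mul_X f v hf => rw [map_mul, map_mul, map_mul, hf, aeval_X, eval_X]

theorem vfield_zero {χ : MvPolynomial (Var M) ℂ} (h : χ ∈ idealOfVars (Var M) ℂ ^ 2) :
    vfield χ 0 = 0 := by
  funext k
  have h1 : (vf χ (Sum.inl k)).coeff 0 = 0 :=
    (mem_pow_idealOfVars_iff' _ _).mp (vf_mem_pow (d := 1) h (Sum.inl k)) 0 (by simp)
  have h2 : pt (0 : Phase M) = 0 := by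
    funext v
    rcases v with k | k <;> simp [pt]
  rw [vfield, h2]
  simpa [constantCoeff_eq] using h1

theorem pderiv_pderiv_comm {σ : Type*} (i j : σ) (f : MvPolynomial σ ℂ) :
    pderiv i (pderiv j f) = pderiv j (pderiv i f) := by
  classical
  ext γ
  simp only [coeff_pderiv]
  rw [add_right_comm γ]
  by_cases h : i = j
  · subst h; rfl
  · simp [h, Ne.symm h]
    ring

/-- The differential of the vector field is antisymmetric for the symplectic form. -/
theorem vfield_antisymm {χ : MvPolynomial (Var M) ℂ} (hχ : IsHamPoly χ) (u y z : Phase M) :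
    l2 (Complex.I • fderiv ℝ (vfield χ) u y) z + l2 (Complex.I • y) (fderiv ℝ (vfield χ) u z) = 0 := by
  have hl : ∀ a b : Phase M, l2 (Complex.I • a) b =
      (∑ k, -Complex.I * ((starRingEnd ℂ) (a k) * b k)).re := by
    intro a b
    rw [l2, Complex.re_sum]
    refine Finset.sum_congr rfl fun k _ => ?_
    simp
    ring
  have hI1 : ∀ S z : ℂ, -Complex.I * (-Complex.I * S * z) = -(S * z) := fun S z => by
    linear_combination S * z * Complex.I_sq
  have hI2 : ∀ S z : ℂ, -Complex.I * (z * (Complex.I * S)) = S * z := fun S z => by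
    linear_combination -S * z * Complex.I_sq
  obtain ⟨T, hT⟩ : ∃ T : Var M → Var M → ℂ, ∀ i j, eval (pt u) (pderiv i (pderiv j χ)) = T i j :=
    ⟨_, fun _ _ => rfl⟩
  have hTs : ∀ i j, T i j = T j i := fun i j => by rw [← hT, ← hT, pderiv_pderiv_comm]
  have hTc : ∀ i j, (starRingEnd ℂ) (T i j) = T i.swap j.swap := fun i j => by
    rw [← hT, ← hT, ← eval_conjP, conjP_pderiv, conjP_pderiv, hχ.real]
  have hF : ∀ v k, fderiv ℝ (vfield χ) u v k = Complex.I * ∑ i, T i (Sum.inr k) * pt v i :=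
    fun v k => by rw [fderiv_vfield]; simp only [hT]
  have e1 : ∑ k, -Complex.I * ((starRingEnd ℂ) (fderiv ℝ (vfield χ) u y k) * z k) =
      -∑ k, ∑ i, T i (Sum.inl k) * pt y i * z k := by
    rw [← Finset.sum_neg_distrib]
    refine Finset.sum_congr rfl fun k _ => ?_
    have : (starRingEnd ℂ) (fderiv ℝ (vfield χ) u y k) =
        -Complex.I * ∑ i, T i (Sum.inl k) * pt y i := by
      rw [hF, map_mul, map_sum, Complex.conj_I]
      refine congrArg _ (Fintype.sum_equiv (Equiv.sumComm _ _) _ _ fun i => ?_)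
      rw [map_mul, conj_pt, hTc, Equiv.sumComm_apply, Sum.swap_inr]
    rw [this, ← Finset.sum_mul, hI1]
  have e2 : ∑ k, -Complex.I * ((starRingEnd ℂ) (y k) * fderiv ℝ (vfield χ) u z k) =
      ∑ k, ∑ i, T i (Sum.inr k) * pt z i * (starRingEnd ℂ) (y k) := by
    refine Finset.sum_congr rfl fun k _ => ?_
    rw [hF, ← Finset.sum_mul, hI2]
  rw [hl, hl, e1, e2]
  simp only [Fintype.sum_sum_type, pt, Sum.elim_inl, Sum.elim_inr, Finset.sum_add_distrib]
  -- The mixed blocks cancel by the symmetry of the Hessian. The pure blocks are conjugate to each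
  -- other, because χ is real, and so have equal real parts.
  have e3 : ∑ k, ∑ i, T (Sum.inr i) (Sum.inl k) * (starRingEnd ℂ) (y i) * z k =
      ∑ k, ∑ i, T (Sum.inl i) (Sum.inr k) * z i * (starRingEnd ℂ) (y k) := by
    rw [Finset.sum_comm]
    refine Finset.sum_congr rfl fun k _ => Finset.sum_congr rfl fun i _ => ?_
    rw [hTs]; ring
  have e4 : (∑ k, ∑ i, T (Sum.inl i) (Sum.inl k) * y i * z k).re =
      (∑ k, ∑ i, T (Sum.inr i) (Sum.inr k) * (starRingEnd ℂ) (z i) * (starRingEnd ℂ) (y k)).re := by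
    rw [← Complex.conj_re, Finset.sum_comm]
    simp only [map_sum]
    refine congrArg Complex.re (Finset.sum_congr rfl fun k _ => Finset.sum_congr rfl fun i _ => ?_)
    rw [map_mul, map_mul, hTc, hTs, Sum.swap_inl, Sum.swap_inl]
    ring
  rw [e3, Complex.neg_re, Complex.add_re, Complex.add_re, e4]
  ring

end Eval

end LowRegBNF
end


noncomputable section

namespace LowRegBNF

open MvPolynomial

/-! ### Discrete Sobolev norms -/

section Norms

variable {M : ℕ}

/-- Multiplication by `⟨k⟩^s`, an isometry from `h^s` to `ℓ²`. -/
def wE (s : ℝ) : Phase M ≃L[ℝ] EuclideanSpace ℂ (Fin M) :=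
  LinearEquiv.toContinuousLinearEquiv
    { toFun := fun u => WithLp.toLp 2 fun k => ((jap (mode k) ^ s : ℝ) : ℂ) * u k
      map_add' := fun u v => by ext k; simp [mul_add]
      map_smul' := fun c u => by ext k; simp; ring
      invFun := fun x k => ((jap (mode k) ^ (-s) : ℝ) : ℂ) * x k
      left_inv := fun u => by
        funext k
        have : jap (mode k) ^ (-s) * jap (mode k) ^ s = 1 := by
          rw [← Real.rpow_add (jap_pos _)]; simp
        simp only
        rw [← mul_assoc, ← Complex.ofReal_mul, this]
        simp
      right_inv := fun x => by
        ext k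
        have : jap (mode k) ^ s * jap (mode k) ^ (-s) = 1 := by
          rw [← Real.rpow_add (jap_pos _)]; simp
        simp only
        rw [← mul_assoc, ← Complex.ofReal_mul, this]
        simp }

theorem wE_apply (s : ℝ) (u : Phase M) (k : Fin M) :
    wE s u k = ((jap (mode k) ^ s : ℝ) : ℂ) * u k := rfl

theorem norm_wE (s : ℝ) (u : Phase M) : ‖wE s u‖ = hNorm s u := by
  rw [EuclideanSpace.norm_eq, hNorm]
  congr 1
  refine Finset.sum_congr rfl fun k _ => ?_
  have h := jap_pos (mode k)
  rw [wE_apply, norm_mul, Complex.norm_real, Real.norm_of_nonneg (Real.rpow_nonneg h.le _), mul_pow,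
    ← Real.rpow_natCast, ← Real.rpow_mul h.le]
  congr 2
  push_cast
  ring

theorem hNorm_nonneg (s : ℝ) (u : Phase M) : 0 ≤ hNorm s u := Real.sqrt_nonneg _

theorem hNorm_add_le (s : ℝ) (u v : Phase M) : hNorm s (u + v) ≤ hNorm s u + hNorm s v := by
  simp only [← norm_wE, map_add]
  exact norm_add_le _ _

theorem hNorm_neg (s : ℝ) (u : Phase M) : hNorm s (-u) = hNorm s u := by
  simp only [← norm_wE, map_neg, norm_neg]

theorem hNorm_smul (s c : ℝ) (u : Phase M) : hNorm s (c • u) = |c| * hNorm s u := by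
  simp only [← norm_wE, map_smul, norm_smul, Real.norm_eq_abs]

@[simp] theorem hNorm_zero (s : ℝ) : hNorm s (0 : Phase M) = 0 := by
  rw [← norm_wE, map_zero, norm_zero]

theorem hNorm_eq_zero {s : ℝ} {u : Phase M} : hNorm s u = 0 ↔ u = 0 := by
  rw [← norm_wE, norm_eq_zero, EmbeddingLike.map_eq_zero_iff]

theorem hNorm_half_sq (u : Phase M) : hNorm (1 / 2) u ^ 2 = ∑ k, jap (mode k) * ‖u k‖ ^ 2 := by
  rw [hNorm, Real.sq_sqrt]
  · norm_num
  · exact Finset.sum_nonneg fun k _ =>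
      mul_nonneg (Real.rpow_nonneg (jap_pos _).le _) (sq_nonneg _)

theorem hNorm_neg_half_sq (u : Phase M) :
    hNorm (-(1 / 2)) u ^ 2 = ∑ k, ‖u k‖ ^ 2 / jap (mode k) := by
  rw [hNorm, Real.sq_sqrt]
  · refine Finset.sum_congr rfl fun k _ => ?_
    have : (2 * -(1 / 2) : ℝ) = -1 := by norm_num
    rw [this, Real.rpow_neg_one]
    ring
  · exact Finset.sum_nonneg fun k _ =>
      mul_nonneg (Real.rpow_nonneg (jap_pos _).le _) (sq_nonneg _)

/-- The moduli of the variables at `u`. -/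
def absV (u : Phase M) : Var M → ℝ := fun v => ‖pt u v‖

theorem absV_nonneg (u : Phase M) : 0 ≤ absV u := fun _ => norm_nonneg _

@[simp] theorem absV_inl (u : Phase M) (k : Fin M) : absV u (Sum.inl k) = ‖u k‖ := rfl

@[simp] theorem absV_inr (u : Phase M) (k : Fin M) : absV u (Sum.inr k) = ‖u k‖ := by
  simp [absV, pt]

theorem nrm_sq {ι : Type*} [Fintype ι] (a : ι → ℝ) : nrm a ^ 2 = ∑ i, a i ^ 2 :=
  Real.sq_sqrt (Finset.sum_nonneg fun _ _ => sq_nonneg _)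

theorem wNorm_sq (a : Var M → ℝ) : wNorm a ^ 2 = ∑ v, japV v * a v ^ 2 := by
  rw [wNorm, nrm_sq]
  exact Finset.sum_congr rfl fun v _ => by rw [mul_pow, Real.sq_sqrt (japV_pos v).le]

theorem wNormDual_sq (a : Var M → ℝ) : wNormDual a ^ 2 = ∑ v, a v ^ 2 / japV v := by
  rw [wNormDual, nrm_sq]
  exact Finset.sum_congr rfl fun v _ => by rw [div_pow, Real.sq_sqrt (japV_pos v).le]

theorem wNorm_absV_le (u : Phase M) : wNorm (absV u) ≤ 2 * hNorm (1 / 2) u := by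
  refine abs_le_of_sq_le_sq' ?_ (by have := hNorm_nonneg (1 / 2) u; positivity) |>.2
  rw [wNorm_sq, mul_pow, hNorm_half_sq, Fintype.sum_sum_type]
  simp only [absV_inl, absV_inr, japV, Sum.elim_inl, Sum.elim_inr]
  have : 0 ≤ ∑ k, jap (mode k) * ‖u k‖ ^ 2 :=
    Finset.sum_nonneg fun k _ => mul_nonneg (jap_pos _).le (sq_nonneg _)
  linarith

theorem wNormDual_absV_le (u : Phase M) : wNormDual (absV u) ≤ 2 * hNorm (-(1 / 2)) u := by
  refine abs_le_of_sq_le_sq' ?_ (by have := hNorm_nonneg (-(1 / 2)) u; positivity) |>.2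
  rw [wNormDual_sq, mul_pow, hNorm_neg_half_sq, Fintype.sum_sum_type]
  simp only [absV_inl, absV_inr, japV, Sum.elim_inl, Sum.elim_inr]
  have : 0 ≤ ∑ k, ‖u k‖ ^ 2 / jap (mode k) :=
    Finset.sum_nonneg fun k _ => div_nonneg (sq_nonneg _) (jap_pos _).le
  linarith

theorem wNorm_smul {t : ℝ} (ht : 0 ≤ t) (a : Var M → ℝ) : wNorm (t • a) = t * wNorm a := by
  have : wNorm (t • a) ^ 2 = (t * wNorm a) ^ 2 := by
    rw [wNorm_sq, mul_pow, wNorm_sq, Finset.mul_sum]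
    exact Finset.sum_congr rfl fun v _ => by simp; ring
  exact (pow_left_inj₀ (nrm_nonneg _) (mul_nonneg ht (nrm_nonneg _)) two_ne_zero).mp this

/-- Every state is a multiple of a family of norm at most one. -/
theorem exists_absV_eq_smul (u : Phase M) :
    ∃ x : Var M → ℝ, 0 ≤ x ∧ wNorm x ≤ 1 ∧ absV u = (2 * hNorm (1 / 2) u) • x := by
  by_cases h : hNorm (1 / 2) u = 0
  · refine ⟨0, le_rfl, ?_, ?_⟩
    · simp [wNorm, nrm]
    · rw [hNorm_eq_zero.mp h]
      funext v
      rcases v with k | k <;> simp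
  · have hpos : 0 < 2 * hNorm (1 / 2) u := by
      have := (hNorm_nonneg (1 / 2) u).lt_of_ne' h
      linarith
    refine ⟨(2 * hNorm (1 / 2) u)⁻¹ • absV u, smul_nonneg (by positivity) (absV_nonneg u), ?_, ?_⟩
    · rw [wNorm_smul (by positivity), inv_mul_le_iff₀ hpos, mul_one]
      exact wNorm_absV_le u
    · rw [smul_smul, mul_inv_cancel₀ hpos.ne', one_smul]

theorem le_of_sq_le_mul {a b : ℝ} (ha : 0 ≤ a) (hb : 0 ≤ b) (h : a ^ 2 ≤ b * a) : a ≤ b := by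
  rcases ha.eq_or_lt with h0 | h0
  · rw [← h0]; exact hb
  · exact le_of_mul_le_mul_right (by nlinarith) h0

/-! ### Bounds for the differential of the generating vector field. -/

section Generator

variable {χ : MvPolynomial (Var M) ℂ} {e D p : ℕ} {K : ℝ}

/-- The second derivatives of χ have order 2p, so rescaling u to unit size yields the factor
(2‖u‖)^{2p}. The 2 allows for each mode being counted twice, as u and as ū. -/
theorem sum_sum_maj_absV_le (hχ : CoeffLE χ (K ^ e)) (hD : ∀ γ ∈ χ.support, γ.degree ≤ D)
    (hord : χ ∈ idealOfVars (Var M) ℂ ^ (2 * p + 2)) (hDK : (D : ℝ) ≤ K) (hK : KernelLE M K)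
    (hJ : ∑ v : Var M, 1 / japV v ≤ K) (hK2 : 2 ≤ K) {y z : Var M → ℝ} (hy : 0 ≤ y) (hz : 0 ≤ z)
    {u : Phase M} (hu : 2 * hNorm (1 / 2) u ≤ 1) :
    ∑ k, ∑ l, y k * z l * maj (pderiv k (pderiv l χ)) (absV u) ≤
      (2 * hNorm (1 / 2) u) ^ (2 * p) * (K ^ (e + 2 * D + 7) * (wNorm y * wNormDual z)) := by
  obtain ⟨x, hx, hx1, hux⟩ := exists_absV_eq_smul u
  have ht : 0 ≤ 2 * hNorm (1 / 2) u := by have := hNorm_nonneg (1 / 2) u; positivity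
  refine le_trans ?_ (mul_le_mul_of_nonneg_left
    (sum_sum_maj_le hχ hD hDK hK hJ hK2 hx hy hz hx1) (by positivity))
  rw [Finset.mul_sum]
  refine Finset.sum_le_sum fun k _ => ?_
  rw [Finset.mul_sum]
  refine Finset.sum_le_sum fun l _ => ?_
  have := maj_smul_le_of_mem_pow (pderiv_mem_pow (pderiv_mem_pow hord l) k) ht hu hx
  rw [hux]
  calc _ ≤ y k * z l * ((2 * hNorm (1 / 2) u) ^ (2 * p) * maj (pderiv k (pderiv l χ)) x) :=
        mul_le_mul_of_nonneg_left this (mul_nonneg (hy k) (hz l))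
    _ = _ := by ring

theorem norm_fderiv_vfield_le (χ : MvPolynomial (Var M) ℂ) (u v : Phase M) (k : Fin M) :
    ‖fderiv ℝ (vfield χ) u v k‖ ≤
      ∑ i, maj (pderiv i (pderiv (Sum.inr k) χ)) (absV u) * absV v i := by
  rw [fderiv_vfield, norm_mul, Complex.norm_I, one_mul]
  refine (norm_sum_le _ _).trans (Finset.sum_le_sum fun i _ => ?_)
  rw [norm_mul]
  exact mul_le_mul_of_nonneg_right (norm_eval_le _ _) (norm_nonneg _)

/-- Duality: the bilinear bound is tested with ⟨k⟩ |f_k| on the ū-side, where f is the image vector.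
Its dual norm is the h^{1/2} norm of f, so one factor of that norm cancels. -/
theorem hNorm_half_fderiv_vfield_le (hχ : CoeffLE χ (K ^ e)) (hD : ∀ γ ∈ χ.support, γ.degree ≤ D)
    (hord : χ ∈ idealOfVars (Var M) ℂ ^ (2 * p + 2)) (hDK : (D : ℝ) ≤ K) (hK : KernelLE M K)
    (hJ : ∑ v : Var M, 1 / japV v ≤ K) (hK2 : 2 ≤ K)
    {u : Phase M} (hu : 2 * hNorm (1 / 2) u ≤ 1) (v : Phase M) :
    hNorm (1 / 2) (fderiv ℝ (vfield χ) u v) ≤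
      (2 * hNorm (1 / 2) u) ^ (2 * p) * K ^ (e + 2 * D + 8) * hNorm (1 / 2) v := by
  set f := fderiv ℝ (vfield χ) u v with hf
  let z : Var M → ℝ := Sum.elim (fun _ => 0) fun k => jap (mode k) * ‖f k‖
  have hz : 0 ≤ z := fun i => by
    rcases i with k | k
    · exact le_rfl
    · exact mul_nonneg (jap_pos _).le (norm_nonneg _)
  have hzN : wNormDual z = hNorm (1 / 2) f := by
    refine (pow_left_inj₀ (nrm_nonneg _) (hNorm_nonneg _ _) two_ne_zero).mp ?_
    change wNormDual z ^ 2 = _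
    rw [wNormDual_sq, hNorm_half_sq, Fintype.sum_sum_type]
    simp only [z, japV, Sum.elim_inl, Sum.elim_inr]
    rw [Finset.sum_eq_zero (fun k _ => by simp), zero_add]
    refine Finset.sum_congr rfl fun k _ => ?_
    have := (jap_pos (mode k)).ne'
    field_simp
  have h1 := sum_sum_maj_absV_le hχ hD hord hDK hK hJ hK2 (absV_nonneg v) hz hu
  have h2 : hNorm (1 / 2) f ^ 2 ≤
      ∑ k, ∑ l, absV v k * z l * maj (pderiv k (pderiv l χ)) (absV u) := by
    rw [hNorm_half_sq, Finset.sum_comm, Fintype.sum_sum_type]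
    simp only [z, Sum.elim_inl, Sum.elim_inr, mul_zero, zero_mul, Finset.sum_const_zero, zero_add]
    refine Finset.sum_le_sum fun k _ => ?_
    have h3 := mul_le_mul_of_nonneg_left (norm_fderiv_vfield_le χ u v k)
      (mul_nonneg (jap_pos (mode k)).le (norm_nonneg (f k)))
    rw [Finset.mul_sum] at h3
    calc jap (mode k) * ‖f k‖ ^ 2 = jap (mode k) * ‖f k‖ * ‖f k‖ := by ring
      _ ≤ _ := h3
      _ = _ := Finset.sum_congr rfl fun i _ => by ring
  have hu0 := hNorm_nonneg (1 / 2) u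
  have hv0 := hNorm_nonneg (1 / 2) v
  have hf0 := hNorm_nonneg (1 / 2) f
  have hK0 : 0 ≤ K := by linarith
  refine le_of_sq_le_mul hf0 (by positivity) (h2.trans (h1.trans ?_))
  rw [hzN]
  have h4 : wNorm (absV v) ≤ K * hNorm (1 / 2) v := (wNorm_absV_le v).trans (by gcongr)
  calc _ ≤ (2 * hNorm (1 / 2) u) ^ (2 * p) *
        (K ^ (e + 2 * D + 7) * (K * hNorm (1 / 2) v * hNorm (1 / 2) f)) := by gcongr
    _ = _ := by ring

/-- The Hessian is symmetric, so the same bilinear bound read in the other direction gives the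
estimate on the dual space; now |f_k|/⟨k⟩ occupies the slot of the strong norm. -/
theorem hNorm_neg_half_fderiv_vfield_le (hχ : CoeffLE χ (K ^ e))
    (hD : ∀ γ ∈ χ.support, γ.degree ≤ D)
    (hord : χ ∈ idealOfVars (Var M) ℂ ^ (2 * p + 2)) (hDK : (D : ℝ) ≤ K) (hK : KernelLE M K)
    (hJ : ∑ v : Var M, 1 / japV v ≤ K) (hK2 : 2 ≤ K)
    {u : Phase M} (hu : 2 * hNorm (1 / 2) u ≤ 1) (v : Phase M) :
    hNorm (-(1 / 2)) (fderiv ℝ (vfield χ) u v) ≤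
      (2 * hNorm (1 / 2) u) ^ (2 * p) * K ^ (e + 2 * D + 8) * hNorm (-(1 / 2)) v := by
  set f := fderiv ℝ (vfield χ) u v with hf
  let z : Var M → ℝ := Sum.elim (fun _ => 0) fun k => ‖f k‖ / jap (mode k)
  have hz : 0 ≤ z := fun i => by
    rcases i with k | k
    · exact le_rfl
    · exact div_nonneg (norm_nonneg _) (jap_pos _).le
  have hzN : wNorm z = hNorm (-(1 / 2)) f := by
    refine (pow_left_inj₀ (nrm_nonneg _) (hNorm_nonneg _ _) two_ne_zero).mp ?_
    change wNorm z ^ 2 = _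
    rw [wNorm_sq, hNorm_neg_half_sq, Fintype.sum_sum_type]
    simp only [z, japV, Sum.elim_inl, Sum.elim_inr]
    rw [Finset.sum_eq_zero (fun k _ => by simp), zero_add]
    refine Finset.sum_congr rfl fun k _ => ?_
    have := (jap_pos (mode k)).ne'
    field_simp
  have h1 := sum_sum_maj_absV_le hχ hD hord hDK hK hJ hK2 hz (absV_nonneg v) hu
  have h2 : hNorm (-(1 / 2)) f ^ 2 ≤
      ∑ k, ∑ l, z k * absV v l * maj (pderiv k (pderiv l χ)) (absV u) := by
    rw [hNorm_neg_half_sq, Fintype.sum_sum_type]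
    simp only [z, Sum.elim_inl, Sum.elim_inr, zero_mul, Finset.sum_const_zero, zero_add]
    refine Finset.sum_le_sum fun k _ => ?_
    have h3 := mul_le_mul_of_nonneg_left (norm_fderiv_vfield_le χ u v k)
      (div_nonneg (norm_nonneg (f k)) (jap_pos (mode k)).le)
    rw [Finset.mul_sum] at h3
    calc ‖f k‖ ^ 2 / jap (mode k) = ‖f k‖ / jap (mode k) * ‖f k‖ := by ring
      _ ≤ _ := h3
      _ = _ := Finset.sum_congr rfl fun i _ => by
        rw [pderiv_pderiv_comm]; ring
  have hu0 := hNorm_nonneg (1 / 2) u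
  have hv0 := hNorm_nonneg (-(1 / 2)) v
  have hf0 := hNorm_nonneg (-(1 / 2)) f
  have hK0 : 0 ≤ K := by linarith
  refine le_of_sq_le_mul hf0 (by positivity) (h2.trans (h1.trans ?_))
  rw [hzN]
  have h4 : wNormDual (absV v) ≤ K * hNorm (-(1 / 2)) v := (wNormDual_absV_le v).trans (by gcongr)
  calc _ ≤ (2 * hNorm (1 / 2) u) ^ (2 * p) *
        (K ^ (e + 2 * D + 7) * (hNorm (-(1 / 2)) f * (K * hNorm (-(1 / 2)) v))) := by
        have := nrm_nonneg (fun i => absV v i / √(japV i))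
        gcongr
    _ = _ := by ring

end Generator

/-! ### The gradient of the remainder -/

theorem l2_grad (R : Phase M → ℝ) (u v : Phase M) : l2 (grad R u) v = fderiv ℝ R u v := by
  have hv : v = ∑ k, ((v k).re • (Pi.single k 1 : Phase M) +
      (v k).im • (Pi.single k Complex.I : Phase M)) := by
    funext j
    rw [Finset.sum_apply, Finset.sum_eq_single j]
    · simp [Complex.re_add_im]
    · intro k _ hk
      simp [hk.symm]
    · simp
  conv_rhs => rw [hv, map_sum]
  refine Finset.sum_congr rfl fun k _ => ?_
  rw [map_add, map_smul, map_smul]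
  simp [grad]
  ring

/-- The differential is tested on v_k = g_k/⟨k⟩, the dual vector of the gradient g. -/
theorem hNorm_grad_le {R : Phase M → ℝ} {u : Phase M} {B : ℝ} (hB : 0 ≤ B)
    (h : ∀ v, |fderiv ℝ R u v| ≤ B * hNorm (1 / 2) v) : hNorm (-(1 / 2)) (grad R u) ≤ B := by
  set g := grad R u with hg
  let v : Phase M := fun k => ((jap (mode k))⁻¹ : ℝ) • g k
  have h1 : l2 g v = hNorm (-(1 / 2)) g ^ 2 := by
    rw [hNorm_neg_half_sq, l2]
    refine Finset.sum_congr rfl fun k _ => ?_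
    rw [← Complex.normSq_eq_norm_sq, Complex.normSq_apply]
    simp [v]
    ring
  have h2 : hNorm (1 / 2) v = hNorm (-(1 / 2)) g := by
    refine (pow_left_inj₀ (hNorm_nonneg _ _) (hNorm_nonneg _ _) two_ne_zero).mp ?_
    rw [hNorm_half_sq, hNorm_neg_half_sq]
    refine Finset.sum_congr rfl fun k _ => ?_
    have hj := jap_pos (mode k)
    simp only [v, norm_smul, norm_inv, Real.norm_of_nonneg hj.le, mul_pow]
    field_simp
  have h3 := (le_abs_self _).trans (h v)
  rw [← l2_grad, ← hg, h1, h2] at h3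
  exact le_of_sq_le_mul (hNorm_nonneg _ _) hB h3

theorem succ_mul_pow_mul_le {x s : ℝ} (hx : 0 ≤ x) (hs : 0 ≤ s) (n : ℕ) :
    ((n : ℝ) + 1) * x ^ n * s ≤ (x + s) ^ (n + 1) := by
  induction n with
  | zero => simp [hx]
  | succ n ih =>
    have h1 : x ^ (n + 1) ≤ (x + s) ^ (n + 1) := pow_le_pow_left₀ hx (by linarith) _
    have h2 := mul_le_mul_of_nonneg_left ih hx
    have h3 := mul_le_mul_of_nonneg_left h1 hs
    push_cast
    calc _ = x * (((n : ℝ) + 1) * x ^ n * s) + s * x ^ (n + 1) := by ring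
      _ ≤ x * (x + s) ^ (n + 1) + s * (x + s) ^ (n + 1) := add_le_add h2 h3
      _ = _ := by ring

/-- A Cauchy estimate for majorants: all terms are nonnegative, so (n + 1) xⁿ s is one of the terms
that make up (x + s)^{n+1}, or smaller. -/
theorem mul_maj_pderiv_le {σ : Type*} [Fintype σ] [DecidableEq σ] (f : MvPolynomial σ ℂ) (v : σ)
    {x : σ → ℝ} (hx : 0 ≤ x) {s : ℝ} (hs : 0 ≤ s) :
    maj (pderiv v f) x * s ≤ maj f (x + Pi.single v s) := by
  have hxs : 0 ≤ x + Pi.single v s := add_nonneg hx (Pi.single_nonneg.mpr hs)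
  have h1 : maj (pderiv v f) x ≤ ∑ γ ∈ f.support, maj (pderiv v (monomial γ (f.coeff γ))) x := by
    conv_lhs => rw [as_sum f, map_sum]
    exact maj_sum_le _ _ hx
  refine (mul_le_mul_of_nonneg_right h1 hs).trans ?_
  rw [Finset.sum_mul, maj]
  refine Finset.sum_le_sum fun γ _ => ?_
  rw [pderiv_monomial, maj_monomial]
  by_cases h0 : γ v = 0
  · simp only [h0, Nat.cast_zero, mul_zero, norm_zero, zero_mul]
    exact mul_nonneg (norm_nonneg _) (mon_nonneg hxs γ)
  obtain ⟨δ, rfl⟩ : ∃ δ, γ = δ + Finsupp.single v 1 :=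
    ⟨γ - Finsupp.single v 1, (tsub_add_cancel_of_le
      (Finsupp.single_le_iff.mpr (Nat.one_le_iff_ne_zero.mpr h0))).symm⟩
  rw [add_tsub_cancel_right]
  have e1 : mon x δ = x v ^ δ v * ∏ i ∈ Finset.univ.erase v, x i ^ δ i :=
    (Finset.mul_prod_erase _ _ (Finset.mem_univ v)).symm
  have e2 : mon (x + Pi.single v s) (δ + Finsupp.single v 1) =
      (x v + s) ^ (δ v + 1) * ∏ i ∈ Finset.univ.erase v, x i ^ δ i := by
    rw [mon, ← Finset.mul_prod_erase _ _ (Finset.mem_univ v)]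
    refine congrArg₂ _ (by simp) (Finset.prod_congr rfl fun i hi => ?_)
    have := Finset.ne_of_mem_erase hi
    simp [this]
  have e3 : 0 ≤ ∏ i ∈ Finset.univ.erase v, x i ^ δ i :=
    Finset.prod_nonneg fun i _ => pow_nonneg (hx i) _
  have e4 : ‖(((δ + Finsupp.single v 1 : σ →₀ ℕ) v : ℕ) : ℂ)‖ = (δ v : ℝ) + 1 := by
    rw [Complex.norm_natCast]; simp
  rw [norm_mul, e4, e1, e2]
  calc _ = ‖f.coeff (δ + Finsupp.single v 1)‖ * ((((δ v : ℝ) + 1) * x v ^ δ v * s) *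
        ∏ i ∈ Finset.univ.erase v, x i ^ δ i) := by ring
    _ ≤ _ := mul_le_mul_of_nonneg_left
        (mul_le_mul_of_nonneg_right (succ_mul_pow_mul_le (hx v) hs _) e3) (norm_nonneg _)

/-- The differential of a polynomial of high order is small in `h^{-1/2}`. -/
theorem abs_fderiv_reEval_le {f : MvPolynomial (Var M) ℂ} {d : ℕ}
    (hf : f ∈ idealOfVars (Var M) ℂ ^ (d + 1)) {B : ℝ} (hB : MajLE f B) {K : ℝ} (hK1 : 1 ≤ K)
    (hJ : ∑ v : Var M, 1 / japV v ≤ K) {m : Phase M} (hm : 4 * K * hNorm (1 / 2) m ≤ 1)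
    (y : Phase M) :
    |fderiv ℝ (reEval f) m y| ≤
      4 * B * K * (4 * K * hNorm (1 / 2) m) ^ d * hNorm (1 / 2) y := by
  classical
  obtain ⟨x, hx, hx1, hmx⟩ := exists_absV_eq_smul m
  have hm0 := hNorm_nonneg (1 / 2) m
  have hy0 := hNorm_nonneg (1 / 2) y
  have hB0 := hB.nonneg
  set t := 4 * K * hNorm (1 / 2) m with ht
  have ht0 : 0 ≤ t := by positivity
  -- With this normalisation x' has ℓ¹ size at most 1/2, which leaves room in the simplex for the
  -- Cauchy step s = 1/2.
  let x' : Var M → ℝ := (2 * K)⁻¹ • x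
  have hx' : 0 ≤ x' := smul_nonneg (by positivity) hx
  have hmx' : absV m = t • x' := by
    rw [hmx, smul_smul]
    congr 1
    rw [ht]
    field_simp
    ring
  have hsum : ∑ v, x' v ≤ 1 / 2 := by
    simp only [x', Pi.smul_apply, smul_eq_mul, ← Finset.mul_sum]
    rw [inv_mul_le_iff₀ (by positivity)]
    have := sum_le_wNorm hJ hK1 x
    nlinarith
  have hpd : ∀ v, maj (pderiv v f) (absV m) ≤ 2 * B * t ^ d := by
    intro v
    rw [hmx']
    refine (maj_smul_le_of_mem_pow (pderiv_mem_pow hf v) ht0 hm hx').trans ?_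
    have h1 := mul_maj_pderiv_le f v hx' (s := 1 / 2) (by norm_num)
    have h2 := hB (x' + Pi.single v (1 / 2)) (add_nonneg hx' (Pi.single_nonneg.mpr (by norm_num)))
      (by simp only [Pi.add_apply, Finset.sum_add_distrib, Finset.sum_pi_single', Finset.mem_univ,
            if_true]
          linarith)
    rw [mul_comm]
    exact mul_le_mul_of_nonneg_right (by linarith) (by positivity)
  rw [fderiv_reEval]
  refine (Complex.abs_re_le_norm _).trans ((norm_sum_le _ _).trans ?_)
  calc ∑ v, ‖eval (pt m) (pderiv v f) * pt y v‖ ≤ ∑ v, 2 * B * t ^ d * absV y v := by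
        refine Finset.sum_le_sum fun v _ => ?_
        rw [norm_mul]
        exact mul_le_mul_of_nonneg_right ((norm_eval_le _ _).trans (hpd v)) (norm_nonneg _)
    _ = 2 * B * t ^ d * ∑ v, absV y v := by rw [Finset.mul_sum]
    _ ≤ 2 * B * t ^ d * (K * (2 * hNorm (1 / 2) y)) := by
        refine mul_le_mul_of_nonneg_left ?_ (by positivity)
        exact (sum_le_wNorm hJ hK1 _).trans (mul_le_mul_of_nonneg_left (wNorm_absV_le y) (by linarith))
    _ = _ := by ring

end Norms

end LowRegBNF
end


noncomputable section

namespace LowRegBNF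

/-! ### Cayley transforms of vector fields -/

section Inverse

variable {E : Type*} [NormedAddCommGroup E] [NormedSpace ℝ E]

theorem norm_sub_le_of_fderiv_le {g : E → E} (hg : ContDiff ℝ ∞ g) {ρ c : ℝ}
    (hd : ∀ x ∈ Metric.ball (0 : E) ρ, ‖fderiv ℝ g x‖ ≤ c) {x y : E} (hx : x ∈ Metric.ball (0 : E) ρ)
    (hy : y ∈ Metric.ball (0 : E) ρ) : ‖g x - g y‖ ≤ c * ‖x - y‖ :=
  (convex_ball (0 : E) ρ).norm_image_sub_le_of_norm_fderiv_le
    (fun z _ => (hg.differentiable (by simp)).differentiableAt) hd hy hx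

/-- The inverse of a perturbation of the identity by a contraction. -/
theorem exists_inverse_sub [CompleteSpace E] [Nontrivial E] {g : E → E} (hg : ContDiff ℝ ∞ g)
    (h0 : g 0 = 0) {ρ : ℝ} (hd : ∀ x ∈ Metric.ball (0 : E) ρ, ‖fderiv ℝ g x‖ ≤ 1 / 2) :
    ∃ G : E → E, ContDiffOn ℝ ∞ G (Metric.ball 0 (ρ / 2)) ∧
      ∀ u ∈ Metric.ball (0 : E) (ρ / 2), G u ∈ Metric.ball (0 : E) ρ ∧ G u - g (G u) = u := by
  let s := Metric.ball (0 : E) ρ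
  let f : E → E := fun x => x - g x
  have hf : ApproximatesLinearOn f ((ContinuousLinearEquiv.refl ℝ E : E ≃L[ℝ] E) : E →L[ℝ] E) s
      (1 / 2) := by
    intro x hx y hy
    have h1 := norm_sub_le_of_fderiv_le hg hd hx hy
    have h2 : f x - f y - ((ContinuousLinearEquiv.refl ℝ E : E ≃L[ℝ] E) : E →L[ℝ] E) (x - y) =
        -(g x - g y) := by
      simp only [f, ContinuousLinearEquiv.coe_refl, ContinuousLinearMap.id_apply]
      abel
    rw [h2, norm_neg]
    simpa using h1
  have hN : ‖((ContinuousLinearEquiv.refl ℝ E).symm : E →L[ℝ] E)‖₊ = 1 := by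
    rw [ContinuousLinearEquiv.refl_symm, ContinuousLinearEquiv.coe_refl]
    exact NNReal.eq ContinuousLinearMap.norm_id
  have hc : Subsingleton E ∨
      (1 / 2 : NNReal) < ‖((ContinuousLinearEquiv.refl ℝ E).symm : E →L[ℝ] E)‖₊⁻¹ := by
    right
    rw [hN, inv_one]
    exact NNReal.half_lt_self one_ne_zero
  let e := hf.toOpenPartialHomeomorph f s hc Metric.isOpen_ball
  -- A 1/2-contractive perturbation of the identity maps the ball of radius 2‖u‖ onto a set
  -- containing the ball of radius ‖u‖.
  have htarget : Metric.ball (0 : E) (ρ / 2) ⊆ e.target := by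
    intro u hu
    have hu' : ‖u‖ < ρ / 2 := by simpa using hu
    have hε : Metric.closedBall (0 : E) (2 * ‖u‖) ⊆ s :=
      Metric.closedBall_subset_ball (by linarith)
    refine hf.closedBall_subset_target hc Metric.isOpen_ball (by positivity) hε ?_
    rw [hN]
    have : f 0 = 0 := by simp [f, h0]
    rw [this, mem_closedBall_zero_iff]
    have hhalf : (((1 : NNReal)⁻¹ : NNReal) : ℝ) - ((1 / 2 : NNReal) : ℝ) = 1 / 2 := by
      push_cast; norm_num
    rw [hhalf]
    linarith
  have hmem : ∀ u ∈ Metric.ball (0 : E) (ρ / 2), e.symm u ∈ s := fun u hu =>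
    e.map_target (htarget hu)
  refine ⟨e.symm, fun u hu => ?_, fun u hu => ⟨hmem u hu, e.right_inv (htarget hu)⟩⟩
  -- The derivative 1 − dg is invertible by a Neumann series, so the inverse is as smooth as g.
  have hlt : ‖fderiv ℝ g (e.symm u)‖ < 1 := lt_of_le_of_lt (hd _ (hmem u hu)) (by norm_num)
  let L : E ≃L[ℝ] E := ContinuousLinearEquiv.ofUnit (Units.oneSub (fderiv ℝ g (e.symm u)) hlt)
  have hL : (L : E →L[ℝ] E) = ContinuousLinearMap.id ℝ E - fderiv ℝ g (e.symm u) := rfl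
  have hder : HasFDerivAt e (L : E →L[ℝ] E) (e.symm u) := by
    rw [hL]
    exact (hasFDerivAt_id _).sub (hg.differentiable (by simp)).differentiableAt.hasFDerivAt
  exact (e.contDiffAt_symm (htarget hu) hder (contDiff_id.sub hg).contDiffAt).contDiffWithinAt

end Inverse

section Cayley

variable {M : ℕ}

theorem isOpen_hBall (ρ : ℝ) : IsOpen (hBall M ρ) := by
  have : hBall M ρ = wE (1 / 2) ⁻¹' Metric.ball 0 ρ := by
    ext u
    simp [hBall, norm_wE]
  rw [this]
  exact Metric.isOpen_ball.preimage (wE (1 / 2)).continuous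

/-- The map `g` in the coordinates in which the norm of `h^{1/2}` is Euclidean. -/
def conjW (g : Phase M → Phase M) : EuclideanSpace ℂ (Fin M) → EuclideanSpace ℂ (Fin M) :=
  fun x => wE (1 / 2) (g ((wE (1 / 2)).symm x))

theorem contDiff_conjW {g : Phase M → Phase M} (hg : ContDiff ℝ ∞ g) : ContDiff ℝ ∞ (conjW g) :=
  (wE (1 / 2)).contDiff.comp (hg.comp (wE (1 / 2)).symm.contDiff)

theorem norm_fderiv_conjW_le {g : Phase M → Phase M} (hg : ContDiff ℝ ∞ g) {ρ c : ℝ} (hc : 0 ≤ c)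
    (hd : ∀ x ∈ hBall M ρ, ∀ v, hNorm (1 / 2) (fderiv ℝ g x v) ≤ c * hNorm (1 / 2) v)
    {x : EuclideanSpace ℂ (Fin M)} (hx : x ∈ Metric.ball (0 : EuclideanSpace ℂ (Fin M)) ρ) :
    ‖fderiv ℝ (conjW g) x‖ ≤ c := by
  have h : HasFDerivAt (conjW g) _ x := (wE (1 / 2)).hasFDerivAt.comp x
    ((hg.differentiable (by simp)).differentiableAt.hasFDerivAt.comp x
      ((wE (1 / 2)).symm.hasFDerivAt (x := x)))
  rw [h.fderiv]
  refine ContinuousLinearMap.opNorm_le_bound _ hc fun v => ?_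
  have hx' : (wE (1 / 2)).symm x ∈ hBall M ρ := by
    simpa [hBall, ← norm_wE] using hx
  have := hd _ hx' ((wE (1 / 2)).symm v)
  rw [← norm_wE, ← norm_wE, ContinuousLinearEquiv.apply_symm_apply] at this
  exact this

theorem hNorm_sub_le_of_fderiv_le {g : Phase M → Phase M} (hg : ContDiff ℝ ∞ g) {ρ c : ℝ}
    (hc : 0 ≤ c) (hd : ∀ x ∈ hBall M ρ, ∀ v, hNorm (1 / 2) (fderiv ℝ g x v) ≤ c * hNorm (1 / 2) v)
    {x y : Phase M} (hx : x ∈ hBall M ρ) (hy : y ∈ hBall M ρ) :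
    hNorm (1 / 2) (g x - g y) ≤ c * hNorm (1 / 2) (x - y) := by
  have hmem : ∀ z ∈ hBall M ρ, wE (1 / 2) z ∈ Metric.ball (0 : EuclideanSpace ℂ (Fin M)) ρ :=
    fun z hz => by simpa [hBall, norm_wE] using hz
  have := norm_sub_le_of_fderiv_le (contDiff_conjW hg)
    (fun z hz => norm_fderiv_conjW_le hg hc hd hz) (hmem x hx) (hmem y hy)
  simpa only [conjW, ContinuousLinearEquiv.symm_apply_apply, ← map_sub, norm_wE] using this

theorem eq_of_sub_eq {g : Phase M → Phase M} (hg : ContDiff ℝ ∞ g) {ρ : ℝ}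
    (hd : ∀ x ∈ hBall M ρ, ∀ v, hNorm (1 / 2) (fderiv ℝ g x v) ≤ 1 / 2 * hNorm (1 / 2) v)
    {x y : Phase M} (hx : x ∈ hBall M ρ) (hy : y ∈ hBall M ρ) (h : x - g x = y - g y) : x = y := by
  have h1 := hNorm_sub_le_of_fderiv_le hg (by norm_num) hd hx hy
  have h2 : g x - g y = x - y := by
    have : x - y = g x - g y := by linear_combination (exp := 1) h
    exact this.symm
  rw [h2] at h1
  have h3 := hNorm_nonneg (1 / 2) (x - y)
  exact sub_eq_zero.mp (hNorm_eq_zero.mp (by linarith : hNorm (1 / 2) (x - y) = 0))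

theorem exists_hBall_inverse (hM : 1 ≤ M) {g : Phase M → Phase M} (hg : ContDiff ℝ ∞ g)
    (h0 : g 0 = 0) {ρ : ℝ}
    (hd : ∀ x ∈ hBall M ρ, ∀ v, hNorm (1 / 2) (fderiv ℝ g x v) ≤ 1 / 2 * hNorm (1 / 2) v) :
    ∃ G : Phase M → Phase M, ContDiffOn ℝ ∞ G (hBall M (ρ / 2)) ∧
      ∀ u ∈ hBall M (ρ / 2), G u ∈ hBall M ρ ∧ G u - g (G u) = u := by
  have : Nonempty (Fin M) := ⟨⟨0, hM⟩⟩
  have : Nontrivial (EuclideanSpace ℂ (Fin M)) := (wE (1 / 2)).symm.toEquiv.nontrivial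
  have h0' : conjW g 0 = 0 := by simp [conjW, h0]
  obtain ⟨G, hG, hG'⟩ := exists_inverse_sub (contDiff_conjW hg) h0' (ρ := ρ)
    (fun z hz => norm_fderiv_conjW_le hg (by norm_num) hd hz)
  have hmem : ∀ u ∈ hBall M (ρ / 2),
      wE (1 / 2) u ∈ Metric.ball (0 : EuclideanSpace ℂ (Fin M)) (ρ / 2) :=
    fun z hz => by simpa [hBall, norm_wE] using hz
  refine ⟨fun u => (wE (1 / 2)).symm (G (wE (1 / 2) u)), ?_, fun u hu => ⟨?_, ?_⟩⟩
  · exact (wE (1 / 2)).symm.contDiff.comp_contDiffOn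
      (hG.comp (wE (1 / 2)).contDiff.contDiffOn hmem)
  · have := (hG' _ (hmem u hu)).1
    simpa [hBall, ← norm_wE] using this
  · have := congrArg (wE (1 / 2)).symm (hG' _ (hmem u hu)).2
    simpa [conjW] using this

theorem l2_add_left (a b c : Phase M) : l2 (a + b) c = l2 a c + l2 b c := by
  simp only [l2, Pi.add_apply, map_add, add_mul, Complex.add_re, Finset.sum_add_distrib]

theorem l2_add_right (a b c : Phase M) : l2 a (b + c) = l2 a b + l2 a c := by
  simp only [l2, Pi.add_apply, mul_add, Complex.add_re, Finset.sum_add_distrib]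

theorem l2_neg_left (a b : Phase M) : l2 (-a) b = -l2 a b := by
  simp only [l2, Pi.neg_apply, map_neg, neg_mul, Complex.neg_re, Finset.sum_neg_distrib]

theorem l2_neg_right (a b : Phase M) : l2 a (-b) = -l2 a b := by
  simp only [l2, Pi.neg_apply, mul_neg, Complex.neg_re, Finset.sum_neg_distrib]

/-- The Cayley transform `x - g x ↦ x + g x` of an infinitesimally symplectic contraction `g`. -/
theorem exists_cayley (hM : 1 ≤ M) {g : Phase M → Phase M} (hg : ContDiff ℝ ∞ g) (h0 : g 0 = 0)
    {ρ : ℝ} (hd : ∀ x ∈ hBall M ρ, ∀ v, hNorm (1 / 2) (fderiv ℝ g x v) ≤ 1 / 2 * hNorm (1 / 2) v)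
    (hd' : ∀ x ∈ hBall M ρ, ∀ v,
      hNorm (-(1 / 2)) (fderiv ℝ g x v) ≤ 1 / 2 * hNorm (-(1 / 2)) v)
    (hs : ∀ x y z, l2 (Complex.I • fderiv ℝ g x y) z + l2 (Complex.I • y) (fderiv ℝ g x z) = 0) :
    ∃ G τ : Phase M → Phase M, ContDiffOn ℝ ∞ G (hBall M (ρ / 2)) ∧
      IsSmoothSymplecticOn τ (hBall M (ρ / 2)) ∧
      ∀ u ∈ hBall M (ρ / 2), G u ∈ hBall M ρ ∧ G u - g (G u) = u ∧ τ u = G u + g (G u) ∧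
        hNorm (1 / 2) (G u) ≤ 2 * hNorm (1 / 2) u ∧
        ∀ v, hNorm (1 / 2) (fderiv ℝ G u v) ≤ 2 * hNorm (1 / 2) v ∧
          hNorm (1 / 2) (fderiv ℝ τ u v) ≤ 4 * hNorm (1 / 2) v ∧
          hNorm (-(1 / 2)) (fderiv ℝ τ u v) ≤ 4 * hNorm (-(1 / 2)) v := by
  obtain ⟨G, hG, hG'⟩ := exists_hBall_inverse hM hg h0 hd
  have hgd : Differentiable ℝ g := hg.differentiable (by simp)
  let τ : Phase M → Phase M := fun u => G u + g (G u)
  have hGd : ∀ u ∈ hBall M (ρ / 2), HasFDerivAt G (fderiv ℝ G u) u := fun u hu =>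
    ((hG.contDiffAt ((isOpen_hBall _).mem_nhds hu)).differentiableAt (by simp)).hasFDerivAt
  have hτd : ∀ u ∈ hBall M (ρ / 2), ∀ v, fderiv ℝ τ u v =
      fderiv ℝ G u v + fderiv ℝ g (G u) (fderiv ℝ G u v) := fun u hu v => by
    have : HasFDerivAt τ (fderiv ℝ G u + (fderiv ℝ g (G u)).comp (fderiv ℝ G u)) u :=
      (hGd u hu).add ((hgd (G u)).hasFDerivAt.comp u (hGd u hu))
    rw [this.fderiv]
    rfl
  have hid : ∀ u ∈ hBall M (ρ / 2), ∀ v,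
      fderiv ℝ G u v - fderiv ℝ g (G u) (fderiv ℝ G u v) = v := fun u hu v => by
    have h1 : HasFDerivAt (fun u => G u - g (G u))
        (fderiv ℝ G u - (fderiv ℝ g (G u)).comp (fderiv ℝ G u)) u :=
      (hGd u hu).sub ((hgd (G u)).hasFDerivAt.comp u (hGd u hu))
    have h2 : HasFDerivAt (fun u => G u - g (G u)) (ContinuousLinearMap.id ℝ (Phase M)) u := by
      refine (hasFDerivAt_id u).congr_of_eventuallyEq ?_
      filter_upwards [(isOpen_hBall _).mem_nhds hu] with z hz
      exact (hG' z hz).2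
    exact DFunLike.congr_fun (h1.unique h2) v
  -- If v = y − Ay with ‖Ay‖ ≤ ‖y‖/2, then ‖y‖ ≤ 2‖v‖ and ‖y + Ay‖ ≤ 4‖v‖. This is used for the maps
  -- themselves and for their differentials in both norms.
  have hbound : ∀ s : ℝ, ∀ y Ay v : Phase M, y - Ay = v → hNorm s Ay ≤ 1 / 2 * hNorm s y →
      hNorm s y ≤ 2 * hNorm s v ∧ hNorm s (y + Ay) ≤ 4 * hNorm s v := by
    intro s y Ay v hv hA
    have h1 : y = v + Ay := by rw [← hv]; abel
    have h2 : hNorm s y ≤ hNorm s v + hNorm s Ay := by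
      conv_lhs => rw [h1]
      exact hNorm_add_le s v Ay
    have h3 := hNorm_add_le s y Ay
    have h4 := hNorm_nonneg s v
    exact ⟨by linarith, by linarith⟩
  have hgle : ∀ x ∈ hBall M ρ, hNorm (1 / 2) (g x) ≤ 1 / 2 * hNorm (1 / 2) x := fun x hx => by
    have h0m : (0 : Phase M) ∈ hBall M ρ := by
      have : hNorm (1 / 2) x < ρ := hx
      simpa [hBall] using lt_of_le_of_lt (hNorm_nonneg _ _) this
    simpa [h0] using hNorm_sub_le_of_fderiv_le hg (by norm_num) hd hx h0m
  refine ⟨G, τ, hG, ⟨?_, ?_⟩, fun u hu => ⟨(hG' u hu).1, (hG' u hu).2, rfl, ?_, fun v => ⟨?_, ?_, ?_⟩⟩⟩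
  · exact hG.add (hg.comp_contDiffOn hG)
  · intro u hu v w
    rw [hτd u hu, hτd u hu]
    conv_rhs => rw [← hid u hu v, ← hid u hu w]
    set y := fderiv ℝ G u v
    set z := fderiv ℝ G u w
    -- With A = dg, the two sides are the form at (y + Ay, z + Az) and at (y − Ay, z − Az). They
    -- differ by twice the cross terms, which cancel by antisymmetry.
    have := hs (G u) y z
    rw [sub_eq_add_neg, sub_eq_add_neg, smul_add, smul_add, smul_neg]
    simp only [l2_add_left, l2_add_right, l2_neg_left, l2_neg_right]
    linarith
  · exact (hbound (1 / 2) _ _ _ (hG' u hu).2 (hgle _ (hG' u hu).1)).1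
  · exact (hbound (1 / 2) _ _ _ (hid u hu v) (hd _ (hG' u hu).1 _)).1
  · rw [hτd u hu]
    exact (hbound (1 / 2) _ _ _ (hid u hu v) (hd _ (hG' u hu).1 _)).2
  · rw [hτd u hu]
    exact (hbound (-(1 / 2)) _ _ _ (hid u hu v) (hd' _ (hG' u hu).1 _)).2

end Cayley

end LowRegBNF
end


noncomputable section

namespace LowRegBNF

open MeasureTheory

/-! ### Comparison of spectra -/

section Spectra

/-- One half of the min-max principle for two orthonormal bases of eigenvectors. -/
theorem eigenvalue_le_add {H : Type*} [NormedAddCommGroup H] [InnerProductSpace ℝ H]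
    (e e' : HilbertBasis ℕ+ ℝ H) {w w' : ℕ+ → ℝ} (hw : Monotone w) (hw' : Monotone w')
    (B : H →ₗ[ℝ] H) {ρ : ℝ} (hB : ∀ x, inner ℝ (B x) x ≤ ρ * ‖x‖ ^ 2)
    (h : ∀ i k, w' i * inner ℝ (e' i) (e k) + inner ℝ (B (e' i)) (e k) =
      w k * inner ℝ (e' i) (e k)) (j : ℕ+) : w j ≤ w' j + ρ := by
  obtain ⟨n, rfl⟩ : ∃ n : ℕ, j = Nat.succPNat n := ⟨j.natPred, (PNat.succPNat_natPred j).symm⟩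
  let v : Fin (n + 1) → H := fun i => e' (Nat.succPNat i)
  have hv : Orthonormal ℝ v := e'.orthonormal.comp (fun i : Fin (n + 1) => Nat.succPNat i)
    fun a b hab => Fin.ext (Nat.succPNat_injective hab)
  -- Dimension count: some nonzero combination x of the first n + 1 vectors of e' is orthogonal to
  -- the first n vectors of e.
  let T : (Fin (n + 1) → ℝ) →ₗ[ℝ] (Fin n → ℝ) :=
    LinearMap.pi fun k => ∑ i, (LinearMap.proj i).smulRight (inner ℝ (v i) (e (Nat.succPNat k)))
  have hker : LinearMap.ker T ≠ ⊥ := LinearMap.ker_ne_bot_of_finrank_lt (by simp)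
  obtain ⟨c, hcT, hc0⟩ := Submodule.exists_mem_ne_zero_of_ne_bot hker
  let x : H := ∑ i, c i • v i
  have hx : ∀ k, inner ℝ x (e k) = ∑ i, c i * inner ℝ (v i) (e k) := fun k => by
    simp only [x, sum_inner, real_inner_smul_left]
  have horth : ∀ k : ℕ+, k < Nat.succPNat n → inner ℝ x (e k) = 0 := by
    intro k hk
    obtain ⟨m, rfl⟩ : ∃ m : ℕ, k = Nat.succPNat m := ⟨k.natPred, (PNat.succPNat_natPred k).symm⟩
    have hm : m < n := Nat.succPNat_lt_succPNat.mp hk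
    have := congrFun (LinearMap.mem_ker.mp hcT) ⟨m, hm⟩
    simp only [T, LinearMap.pi_apply, LinearMap.sum_apply, LinearMap.smulRight_apply,
      LinearMap.proj_apply, smul_eq_mul, Pi.zero_apply] at this
    rw [hx, this]
  have hnorm : ‖x‖ ^ 2 = ∑ i, c i ^ 2 := by
    rw [← real_inner_self_eq_norm_sq, hv.inner_sum c c Finset.univ]
    exact Finset.sum_congr rfl fun i _ => by simp [sq]
  have hpos : 0 < ‖x‖ ^ 2 := by
    rw [hnorm]
    obtain ⟨i, hi⟩ := Function.ne_iff.mp hc0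
    exact Finset.sum_pos' (fun i _ => sq_nonneg _) ⟨i, Finset.mem_univ i, by
      have : c i ≠ 0 := hi
      positivity⟩
  -- S is the sum of the operator with eigenvalues w' applied to x and of Bx. By h its coordinates
  -- in e are those of the operator with eigenvalues w, so Parseval bounds ⟨S, x⟩ from below.
  let S : H := ∑ i : Fin (n + 1), (c i * w' (Nat.succPNat i)) • v i + B x
  have hBx : B x = ∑ i, c i • B (v i) := by simp [x]
  have hS : ∀ k, inner ℝ S (e k) = w k * inner ℝ x (e k) := by
    intro k
    simp only [S, hBx, hx, inner_add_left, sum_inner, real_inner_smul_left, Finset.mul_sum]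
    rw [← Finset.sum_add_distrib]
    refine Finset.sum_congr rfl fun i _ => ?_
    linear_combination c i * h (Nat.succPNat i) k
  have hSx : inner ℝ S x ≤ (w' (Nat.succPNat n) + ρ) * ‖x‖ ^ 2 := by
    have h1 : inner ℝ (∑ i : Fin (n + 1), (c i * w' (Nat.succPNat i)) • v i) x ≤
        w' (Nat.succPNat n) * ‖x‖ ^ 2 := by
      rw [hv.inner_sum (fun i : Fin (n + 1) => c i * w' (Nat.succPNat i)) c Finset.univ, hnorm,
        Finset.mul_sum]
      refine Finset.sum_le_sum fun i _ => ?_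
      have hi : w' (Nat.succPNat i) ≤ w' (Nat.succPNat n) :=
        hw' (Nat.succPNat_le_succPNat.mpr (Nat.lt_succ_iff.mp i.2))
      simp only [conj_trivial]
      nlinarith [sq_nonneg (c i)]
    have h2 := hB x
    simp only [S, inner_add_left]
    linarith
  have s1 := e.hasSum_inner_mul_inner S x
  have s2 := (e.hasSum_inner_mul_inner x x).mul_left (w (Nat.succPNat n))
  have hle : w (Nat.succPNat n) * inner ℝ x x ≤ inner ℝ S x := by
    refine hasSum_le (fun k => ?_) s2 s1
    rw [hS, real_inner_comm x (e k)]
    rcases lt_or_ge k (Nat.succPNat n) with hk | hk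
    · rw [horth k hk]; simp
    · have := hw hk
      nlinarith [mul_self_nonneg (inner ℝ x (e k))]
  rw [real_inner_self_eq_norm_sq] at hle
  exact le_of_mul_le_mul_right (hle.trans hSx) hpos

/-! ### Weak formulation of the eigenvalue problem and perturbation of the potential. -/

theorem integrable_mul_of_memLp {f g : ℝ → ℝ} (hf : MemLp f 2) (hg : MemLp g 2) :
    Integrable (fun x => f x * g x) :=
  hf.integrable_mul hg

theorem inner_toLp {f g : ℝ → ℝ} (hf : MemLp f 2) (hg : MemLp g 2) :
    inner ℝ (hf.toLp f) (hg.toLp g) = ∫ x, f x * g x := by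
  rw [L2.inner_def]
  refine integral_congr_ae ?_
  filter_upwards [hf.coeFn_toLp, hg.coeFn_toLp] with x h1 h2
  rw [h1, h2]
  simp [mul_comm]

/-- Twice integrating by parts. -/
theorem integral_deriv_deriv_mul {V W : ℝ → ℝ} {Λ Θ : ℝ} {f g : ℝ → ℝ} (hf : IsEigenfunction V Λ f)
    (hg : IsEigenfunction W Θ g) :
    ∫ x, deriv (deriv f) x * g x = ∫ x, f x * deriv (deriv g) x := by
  have d1 : ∀ {φ : ℝ → ℝ}, ContDiff ℝ 2 φ → ∀ x, HasDerivAt φ (deriv φ x) x := fun hφ x =>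
    (hφ.differentiable (by norm_num)).differentiableAt.hasDerivAt
  have d2 : ∀ {φ : ℝ → ℝ}, ContDiff ℝ 2 φ → ∀ x, HasDerivAt (deriv φ) (deriv (deriv φ) x) x :=
    fun {φ} hφ x => by
      have h2 : ContDiff ℝ 1 (deriv φ) :=
        ((contDiff_succ_iff_deriv (n := 1) (f := φ)).mp (by simpa using! hφ)).2.2
      exact (h2.differentiable (by norm_num)).differentiableAt.hasDerivAt
  have e1 : ∫ x, g x * deriv (deriv f) x = -∫ x, deriv g x * deriv f x :=
    integral_mul_deriv_eq_deriv_mul_of_integrable (fun x _ => d1 hg.contDiff x)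
      (fun x _ => d2 hf.contDiff x) (integrable_mul_of_memLp hg.memLp hf.memLp_deriv2)
      (integrable_mul_of_memLp hg.memLp_deriv hf.memLp_deriv)
      (integrable_mul_of_memLp hg.memLp hf.memLp_deriv)
  have e2 : ∫ x, f x * deriv (deriv g) x = -∫ x, deriv f x * deriv g x :=
    integral_mul_deriv_eq_deriv_mul_of_integrable (fun x _ => d1 hf.contDiff x)
      (fun x _ => d2 hg.contDiff x) (integrable_mul_of_memLp hf.memLp hg.memLp_deriv2)
      (integrable_mul_of_memLp hf.memLp_deriv hg.memLp_deriv)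
      (integrable_mul_of_memLp hf.memLp hg.memLp_deriv)
  rw [e2]
  simp only [mul_comm (deriv (deriv f) _), e1, mul_comm (deriv f _)]

theorem memLp_bdd_mul {U : ℝ → ℝ} (hU : Continuous U) {ρ : ℝ} (hρ : ∀ x, |U x| ≤ ρ) {f : ℝ → ℝ}
    (hf : MemLp f 2) : MemLp (fun x => U x * f x) 2 := by
  refine (hf.const_mul ρ).mono (hU.aestronglyMeasurable.mul hf.1) (Filter.Eventually.of_forall ?_)
  intro x
  have := hρ x
  have h0 : 0 ≤ ρ := (abs_nonneg _).trans this
  rw [norm_mul, norm_mul, Real.norm_eq_abs, Real.norm_eq_abs ρ, abs_of_nonneg h0]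
  exact mul_le_mul_of_nonneg_right this (norm_nonneg _)

/-- Multiplication by a bounded continuous function on `L²`. -/
def mulL2 {U : ℝ → ℝ} (hU : Continuous U) {ρ : ℝ} (hρ : ∀ x, |U x| ≤ ρ) :
    Lp ℝ 2 (volume : Measure ℝ) →ₗ[ℝ] Lp ℝ 2 (volume : Measure ℝ) where
  toFun f := (memLp_bdd_mul hU hρ (Lp.memLp f)).toLp _
  map_add' f g := by
    rw [← MemLp.toLp_add, MemLp.toLp_eq_toLp_iff]
    filter_upwards [Lp.coeFn_add f g] with x hx
    rw [hx]
    exact mul_add _ _ _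
  map_smul' c f := by
    rw [RingHom.id_apply, ← MemLp.toLp_const_smul, MemLp.toLp_eq_toLp_iff]
    filter_upwards [Lp.coeFn_smul c f] with x hx
    simp [hx]
    ring

theorem mulL2_toLp {U : ℝ → ℝ} (hU : Continuous U) {ρ : ℝ} (hρ : ∀ x, |U x| ≤ ρ) {f : ℝ → ℝ}
    (hf : MemLp f 2) : mulL2 hU hρ (hf.toLp f) = (memLp_bdd_mul hU hρ hf).toLp _ := by
  change (memLp_bdd_mul hU hρ (Lp.memLp (hf.toLp f))).toLp _ = _
  rw [MemLp.toLp_eq_toLp_iff]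
  filter_upwards [hf.coeFn_toLp] with x hx
  rw [hx]

theorem inner_mulL2_le {U : ℝ → ℝ} (hU : Continuous U) {ρ : ℝ} (hρ : ∀ x, |U x| ≤ ρ)
    (f : Lp ℝ 2 (volume : Measure ℝ)) : inner ℝ (mulL2 hU hρ f) f ≤ ρ * ‖f‖ ^ 2 := by
  have hf := Lp.memLp f
  have e1 : inner ℝ (mulL2 hU hρ f) f = ∫ x, (U x * f x) * f x := by
    conv_lhs => rw [← Lp.toLp_coeFn f hf]
    rw [mulL2_toLp, inner_toLp]
  have e2 : ‖f‖ ^ 2 = ∫ x, f x * f x := by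
    rw [← real_inner_self_eq_norm_sq]
    conv_lhs => rw [← Lp.toLp_coeFn f hf]
    rw [inner_toLp]
  rw [e1, e2, ← integral_const_mul]
  refine integral_mono (integrable_mul_of_memLp (memLp_bdd_mul hU hρ hf) hf)
    ((integrable_mul_of_memLp hf hf).const_mul ρ) fun x => ?_
  have := (abs_le.mp (hρ x)).2
  change U x * f x * f x ≤ ρ * (f x * f x)
  nlinarith [mul_self_nonneg (f x)]

/-- The eigenvalues move by at most the supremum of the perturbation of the potential. -/
theorem IsSpectrum.le_add {V W : ℝ → ℝ} {w w' : ℕ+ → ℝ} (hV : IsSpectrum V w) (hW : IsSpectrum W w')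
    (hVc : Continuous V) (hWc : Continuous W) {ρ : ℝ} (hρ : ∀ x, |V x - W x| ≤ ρ) (j : ℕ+) :
    w j ≤ w' j + ρ := by
  obtain ⟨hwm, e, he⟩ := hV
  obtain ⟨hwm', e', he'⟩ := hW
  choose ψ hψ hψe using he
  choose ψ' hψ' hψe' using he'
  have hUc : Continuous fun x => V x - W x := hVc.sub hWc
  have E : ∀ k, e k = (hψ k).memLp.toLp _ := fun k =>
    Lp.ext ((hψe k).trans (hψ k).memLp.coeFn_toLp.symm)
  have E' : ∀ k, e' k = (hψ' k).memLp.toLp _ := fun k =>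
    Lp.ext ((hψe' k).trans (hψ' k).memLp.coeFn_toLp.symm)
  -- The two operators differ by multiplication by V − W. This identity is needed only between pairs
  -- of eigenfunctions, so no unbounded operator has to be defined.
  refine eigenvalue_le_add e e' hwm.monotone hwm'.monotone (mulL2 hUc hρ) (inner_mulL2_le hUc hρ)
    (fun i k => ?_) j
  rw [E, E', mulL2_toLp, inner_toLp, inner_toLp]
  have h1 := integral_deriv_deriv_mul (hψ' i) (hψ k)
  have i1 := integrable_mul_of_memLp (hψ' i).memLp (hψ k).memLp
  have i2 := integrable_mul_of_memLp (memLp_bdd_mul hUc hρ (hψ' i).memLp) (hψ k).memLp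
  have i3 := integrable_mul_of_memLp (hψ' i).memLp_deriv2 (hψ k).memLp
  have i4 := integrable_mul_of_memLp (hψ' i).memLp (hψ k).memLp_deriv2
  have key : ∀ x, w' i * (ψ' i x * ψ k x) + (V x - W x) * ψ' i x * ψ k x +
      deriv (deriv (ψ' i)) x * ψ k x = w k * (ψ' i x * ψ k x) + ψ' i x * deriv (deriv (ψ k)) x := by
    intro x
    linear_combination -ψ k x * (hψ' i).eigen x + ψ' i x * (hψ k).eigen x
  have h2 := integral_congr_ae (μ := volume) (Filter.Eventually.of_forall key)
  have i5 : Integrable (fun x => w' i * (ψ' i x * ψ k x) + (V x - W x) * ψ' i x * ψ k x) :=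
    (i1.const_mul _).add i2
  rw [integral_add i5 i3, integral_add (i1.const_mul _) i2,
    integral_add (i1.const_mul _) i4, integral_const_mul, integral_const_mul, h1] at h2
  linarith

/-- V(x)² is the integral of 2 V V' over (−∞, x], and 2 V V' ≤ V² + V'². -/
theorem IsPotential.abs_le {V : ℝ → ℝ} (hV : IsPotential V) (x : ℝ) : |V x| ≤ hatH1Norm V := by
  have hd : ∀ y, HasDerivAt V (deriv V y) y := fun y =>
    (hV.contDiff.differentiable (by norm_num)).differentiableAt.hasDerivAt
  have hd2 : ∀ y, HasDerivAt (fun z => V z * V z) (deriv V y * V y + V y * deriv V y) y :=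
    fun y => (hd y).mul (hd y)
  have i0 := integrable_mul_of_memLp hV.memLp hV.memLp
  have i1 := (integrable_mul_of_memLp hV.memLp_deriv hV.memLp).add
    (integrable_mul_of_memLp hV.memLp hV.memLp_deriv)
  have i2 : Integrable (fun y => V y ^ 2) := by simpa [sq] using i0
  have i3 : Integrable (fun y => deriv V y ^ 2) := by
    simpa [sq] using integrable_mul_of_memLp hV.memLp_deriv hV.memLp_deriv
  have ht := tendsto_zero_of_hasDerivAt_of_integrableOn_Iic (a := x) (fun y _ => hd2 y)
    i1.integrableOn i0.integrableOn
  have h1 := integral_Iic_of_hasDerivAt_of_tendsto' (a := x) (fun y _ => hd2 y) i1.integrableOn ht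
  rw [sub_zero] at h1
  have h2 : V x * V x ≤ (∫ y, V y ^ 2) + ∫ y, deriv V y ^ 2 := by
    rw [← h1, ← integral_add i2 i3]
    refine (integral_mono i1.integrableOn (i2.add i3).integrableOn fun y => ?_).trans
      (setIntegral_le_integral (i2.add i3) (Filter.Eventually.of_forall fun y => ?_))
    · simp only [Pi.add_apply]
      nlinarith [sq_nonneg (V y - deriv V y)]
    · simp only [Pi.add_apply, Pi.zero_apply]
      positivity
  refine Real.le_sqrt_of_sq_le ?_
  have h3 : 0 ≤ ∫ x : ℝ, (√(1 + x ^ 2) * V x) ^ 2 := integral_nonneg fun x => sq_nonneg _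
  rw [sq_abs, sq]
  linarith

end Spectra

end LowRegBNF
end


noncomputable section

namespace LowRegBNF

open MeasureTheory Polynomial

/-! ### The harmonic oscillator -/

section Hermite

/-- The function `p(x) e^{-x²/2}`. -/
def gaussMul (p : ℝ[X]) (x : ℝ) : ℝ := p.eval x * Real.exp (-(1 / 2) * x ^ 2)

theorem hasDerivAt_gaussMul (p : ℝ[X]) (x : ℝ) :
    HasDerivAt (gaussMul p) (gaussMul (derivative p - X * p) x) x := by
  have h1 : HasDerivAt (fun y : ℝ => -(1 / 2) * y ^ 2) (-(1 / 2) * (2 * x)) x := by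
    simpa using (hasDerivAt_pow 2 x).const_mul (-(1 / 2) : ℝ)
  refine ((p.hasDerivAt x).mul h1.exp).congr_deriv ?_
  simp only [gaussMul, eval_sub, eval_mul, eval_X]
  ring

theorem deriv_gaussMul (p : ℝ[X]) : deriv (gaussMul p) = gaussMul (derivative p - X * p) :=
  funext fun x => (hasDerivAt_gaussMul p x).deriv

theorem contDiff_gaussMul (p : ℝ[X]) {n : ℕ∞} : ContDiff ℝ n (gaussMul p) := by
  have : ContDiff ℝ n fun x : ℝ => Real.exp (-(1 / 2) * x ^ 2) := by fun_prop
  have hp : ContDiff ℝ n fun x : ℝ => p.eval x := by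
    simpa using p.contDiff_aeval (𝕜 := ℝ) (R := ℝ) n
  exact hp.mul this

theorem integrable_eval_mul_exp (p : ℝ[X]) {b : ℝ} (hb : 0 < b) :
    Integrable fun x : ℝ => p.eval x * Real.exp (-b * x ^ 2) := by
  simp only [eval_eq_sum_range, Finset.sum_mul]
  refine integrable_finsetSum _ fun n _ => ?_
  have h := (integrable_rpow_mul_exp_neg_mul_sq hb (s := n)
    (lt_of_lt_of_le (by norm_num) n.cast_nonneg)).const_mul (p.coeff n)
  simpa [mul_assoc] using h

theorem memLp_gaussMul (p : ℝ[X]) : MemLp (gaussMul p) 2 := by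
  rw [memLp_two_iff_integrable_sq
    (contDiff_gaussMul p (n := 0)).continuous.aestronglyMeasurable]
  refine (integrable_eval_mul_exp (p ^ 2) one_pos).congr (Filter.Eventually.of_forall fun x => ?_)
  simp only [gaussMul, eval_pow, mul_pow, ← Real.exp_nat_mul]
  congr 2
  push_cast
  ring

/-- The Hermite polynomials of the harmonic oscillator. -/
def hermiteH : ℕ → ℝ[X]
  | 0 => 1
  | n + 1 => 2 * X * hermiteH n - derivative (hermiteH n)

theorem derivative_hermiteH (n : ℕ) :
    derivative (hermiteH (n + 1)) = 2 * ((n : ℝ[X]) + 1) * hermiteH n := by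
  induction n with
  | zero => simp [hermiteH]
  | succ n ih =>
    rw [hermiteH, derivative_sub, derivative_mul, ih]
    have h2 : derivative (2 * X : ℝ[X]) = 2 := by simp
    have h3 : derivative (2 * ((n : ℝ[X]) + 1) * hermiteH n) =
        2 * ((n : ℝ[X]) + 1) * derivative (hermiteH n) := by simp
    rw [h2, h3, hermiteH]
    push_cast
    ring

theorem hermiteH_ode (n : ℕ) : derivative (derivative (hermiteH n)) =
    2 * X * derivative (hermiteH n) - 2 * (n : ℝ[X]) * hermiteH n := by
  cases n with
  | zero => simp [hermiteH]
  | succ n =>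
    have h3 : derivative (2 * ((n : ℝ[X]) + 1) * hermiteH n) =
        2 * ((n : ℝ[X]) + 1) * derivative (hermiteH n) := by simp
    rw [derivative_hermiteH, h3, hermiteH]
    push_cast
    ring

theorem hermiteH_ne_zero (n : ℕ) : hermiteH n ≠ 0 := by
  induction n with
  | zero => simp [hermiteH]
  | succ n ih =>
    intro h
    have h1 := derivative_hermiteH n
    rw [h, derivative_zero] at h1
    have h2 : (2 * ((n : ℝ[X]) + 1)) ≠ 0 := by
      have : (2 * ((n : ℝ[X]) + 1)) = ((2 * (n + 1) : ℕ) : ℝ[X]) := by push_cast; ring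
      rw [this]
      exact_mod_cast (by positivity : 2 * (n + 1) ≠ 0)
    exact (mul_ne_zero h2 ih) h1.symm

theorem isEigenfunction_gaussMul (c : ℝ) (n : ℕ) :
    IsEigenfunction 0 (2 * n + 1) (gaussMul (C c * hermiteH n)) where
  contDiff := contDiff_gaussMul _ (n := 2)
  memLp := memLp_gaussMul _
  memLp_deriv := by rw [deriv_gaussMul]; exact memLp_gaussMul _
  memLp_deriv2 := by rw [deriv_gaussMul, deriv_gaussMul]; exact memLp_gaussMul _
  memLp_weight := by
    refine (memLp_gaussMul ((1 + X ^ 2) * (C c * hermiteH n))).ae_eq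
      (Filter.Eventually.of_forall fun x => ?_)
    simp [gaussMul, mul_assoc]
  eigen x := by
    have h := congrArg (eval x) (hermiteH_ode n)
    rw [deriv_gaussMul, deriv_gaussMul]
    simp only [eval_sub, eval_mul, eval_X, eval_ofNat, eval_natCast] at h
    simp only [gaussMul, eval_sub, eval_mul, eval_X, eval_C, derivative_sub, derivative_mul,
      derivative_X, derivative_C, Pi.zero_apply, zero_mul, zero_add, eval_add, one_mul]
    linear_combination (-c * Real.exp (-(1 / 2) * x ^ 2)) * h

/-- Eigenfunctions for different eigenvalues are orthogonal. -/
theorem IsEigenfunction.integral_mul_eq_zero {V : ℝ → ℝ} {Λ Θ : ℝ} {f g : ℝ → ℝ}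
    (hf : IsEigenfunction V Λ f) (hg : IsEigenfunction V Θ g) (h : Λ ≠ Θ) :
    ∫ x, f x * g x = 0 := by
  have h1 := integral_deriv_deriv_mul hf hg
  have i3 := integrable_mul_of_memLp hf.memLp_deriv2 hg.memLp
  have i4 := integrable_mul_of_memLp hf.memLp hg.memLp_deriv2
  have key : ∀ x, (Λ - Θ) * (f x * g x) = f x * deriv (deriv g) x - deriv (deriv f) x * g x := by
    intro x
    linear_combination -g x * hf.eigen x + f x * hg.eigen x
  have h2 := integral_congr_ae (μ := volume) (Filter.Eventually.of_forall key)
  rw [integral_const_mul, integral_sub i4 i3, h1, sub_self] at h2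
  exact (mul_eq_zero.mp h2).resolve_left (sub_ne_zero.mpr h)

/-- The span is stable under multiplication by X, since X Hₙ = (Hₙ₊₁ + Hₙ')/2 and Hₙ' is a multiple
of Hₙ₋₁. -/
theorem mem_span_hermiteH (p : ℝ[X]) : p ∈ Submodule.span ℝ (Set.range hermiteH) := by
  have hX : ∀ q ∈ Submodule.span ℝ (Set.range hermiteH),
      X * q ∈ Submodule.span ℝ (Set.range hermiteH) := by
    intro q hq
    induction hq using Submodule.span_induction with
    | mem q hq =>
      obtain ⟨n, rfl⟩ := hq
      have h1 : X * hermiteH n = (1 / 2 : ℝ) • (hermiteH (n + 1) + derivative (hermiteH n)) := by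
        rw [hermiteH, sub_add_cancel, smul_eq_C_mul, ← mul_assoc, ← mul_assoc]
        have : (C (1 / 2 : ℝ) : ℝ[X]) * 2 = 1 := by
          rw [← C_ofNat, ← C_mul]; norm_num
        rw [this, one_mul]
      rw [h1]
      refine Submodule.smul_mem _ _ (Submodule.add_mem _ (Submodule.subset_span ⟨_, rfl⟩) ?_)
      cases n with
      | zero => simp [hermiteH]
      | succ n =>
        have h2 : derivative (hermiteH (n + 1)) = (2 * ((n : ℝ) + 1)) • hermiteH n := by
          rw [derivative_hermiteH, smul_eq_C_mul]
          simp only [map_mul, map_add, map_natCast, map_one, map_ofNat]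
        rw [h2]
        exact Submodule.smul_mem _ _ (Submodule.subset_span ⟨_, rfl⟩)
    | zero => simp
    | add a b _ _ ha hb => rw [mul_add]; exact Submodule.add_mem _ ha hb
    | smul c a _ ha => rw [mul_smul_comm]; exact Submodule.smul_mem _ _ ha
  have hpow : ∀ n : ℕ, (X ^ n : ℝ[X]) ∈ Submodule.span ℝ (Set.range hermiteH) := by
    intro n
    induction n with
    | zero => exact Submodule.subset_span ⟨0, by simp [hermiteH]⟩
    | succ n ih => rw [pow_succ']; exact hX _ ih
  rw [p.as_sum_range_C_mul_X_pow]
  refine Submodule.sum_mem _ fun n _ => ?_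
  rw [← smul_eq_C_mul]
  exact Submodule.smul_mem _ _ (hpow n)

/-- An integrable function with vanishing Fourier transform vanishes. -/
theorem ae_eq_zero_of_integral_cexp {g : ℝ → ℝ} (hg : Integrable g)
    (h : ∀ t : ℝ, ∫ x, (g x : ℂ) * Complex.exp (t * x * Complex.I) = 0) :
    g =ᵐ[volume] 0 := by
  -- The positive and negative parts of g are densities of finite measures with the same
  -- characteristic function, so they coincide almost everywhere.
  have hm : ∀ f : ℝ → ℝ, Integrable f → AEMeasurable (fun x => ENNReal.ofReal (f x)) volume :=
    fun f hf => hf.aemeasurable.ennreal_ofReal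
  have hfin : ∀ f : ℝ → ℝ, Integrable f → ∫⁻ x, ENNReal.ofReal (f x) ≠ ⊤ := fun f hf =>
    hf.lintegral_lt_top.ne
  have F1 : IsFiniteMeasure (volume.withDensity fun x => ENNReal.ofReal (g x)) :=
    isFiniteMeasure_withDensity (hfin g hg)
  have F2 : IsFiniteMeasure (volume.withDensity fun x => ENNReal.ofReal (-g x)) :=
    isFiniteMeasure_withDensity (hfin _ hg.neg)
  have hc : ∀ f : ℝ → ℝ, Integrable f → ∀ t : ℝ,
      charFun (volume.withDensity fun x => ENNReal.ofReal (f x)) t =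
        ∫ x, ((max (f x) 0 : ℝ) : ℂ) * Complex.exp (t * x * Complex.I) := by
    intro f hf t
    rw [charFun_apply_real, integral_withDensity_eq_integral_toReal_smul₀ (hm f hf) (by simp)]
    refine integral_congr_ae (Filter.Eventually.of_forall fun x => ?_)
    simp only [ENNReal.toReal_ofReal', Complex.real_smul]
  have hi : ∀ f : ℝ → ℝ, Integrable f → ∀ t : ℝ,
      Integrable fun x => ((max (f x) 0 : ℝ) : ℂ) * Complex.exp (t * x * Complex.I) := by
    intro f hf t
    have hcont : Continuous fun x : ℝ => Complex.exp (t * x * Complex.I) := by fun_prop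
    refine (hf.pos_part.ofReal (𝕜 := ℂ)).mul_bdd (c := 1) hcont.aestronglyMeasurable
      (Filter.Eventually.of_forall fun x => ?_)
    rw [← Complex.ofReal_mul, Complex.norm_exp_ofReal_mul_I]
  have heq : volume.withDensity (fun x => ENNReal.ofReal (g x)) =
      volume.withDensity fun x => ENNReal.ofReal (-g x) := by
    refine Measure.ext_of_charFun (funext fun t => ?_)
    rw [hc g hg t, hc (fun x => -g x) hg.neg t, ← sub_eq_zero,
      ← integral_sub (hi g hg t) (hi (fun x => -g x) hg.neg t), ← h t]
    refine integral_congr_ae (Filter.Eventually.of_forall fun x => ?_)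
    change _ - _ = _
    rw [← sub_mul, ← Complex.ofReal_sub]
    congr 2
    rcases le_total 0 (g x) with h0 | h0
    · rw [max_eq_left h0, max_eq_right (by linarith)]; ring
    · rw [max_eq_right h0, max_eq_left (by linarith)]; ring
  have hae := (withDensity_eq_iff (hm g hg) (hm _ hg.neg) (hfin g hg)).mp heq
  filter_upwards [hae] with x hx
  rcases le_total 0 (g x) with h0 | h0
  · have h2 : ENNReal.ofReal (-g x) = 0 := ENNReal.ofReal_eq_zero.mpr (by linarith)
    rw [show (-g) x = -g x from rfl, h2, ENNReal.ofReal_eq_zero] at hx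
    exact le_antisymm hx h0
  · have h2 : ENNReal.ofReal (g x) = 0 := ENNReal.ofReal_eq_zero.mpr (by linarith)
    rw [h2, show (-g) x = -g x from rfl, eq_comm, ENNReal.ofReal_eq_zero] at hx
    exact le_antisymm h0 (by simpa using hx)

/-- The Gaussian absorbs the exponential through 2|t||x| ≤ 2t² + x²/2. This is the domination that
permits integrating the series of e^{itx} term by term. -/
theorem memLp_exp_sub_sq (t : ℝ) :
    MemLp (fun x : ℝ => Real.exp (-(1 / 2) * x ^ 2) * Real.exp |t * x|) 2 := by
  have hc : Continuous fun x : ℝ => Real.exp (-(1 / 2) * x ^ 2) * Real.exp |t * x| := by fun_prop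
  rw [memLp_two_iff_integrable_sq hc.aestronglyMeasurable]
  refine ((integrable_exp_neg_mul_sq (b := 1 / 2) (by norm_num)).const_mul
    (Real.exp (2 * t ^ 2))).mono' (hc.pow 2).aestronglyMeasurable
    (Filter.Eventually.of_forall fun x => ?_)
  rw [Real.norm_of_nonneg (sq_nonneg _), ← Real.exp_add, ← Real.exp_add, ← Real.exp_nat_mul]
  refine Real.exp_le_exp.mpr ?_
  rw [abs_mul, ← sq_abs t, ← sq_abs x]
  push_cast
  nlinarith [sq_nonneg (2 * |t| - |x|)]

/-- A function in `L²` that is orthogonal to all `p(x) e^{-x²/2}` vanishes. -/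
theorem ae_eq_zero_of_integral_gaussMul {f : ℝ → ℝ} (hf : MemLp f 2)
    (h : ∀ n : ℕ, ∫ x, f x * gaussMul (X ^ n) x = 0) : f =ᵐ[volume] 0 := by
  have hg : Integrable fun x => f x * Real.exp (-(1 / 2) * x ^ 2) := by
    have := integrable_mul_of_memLp hf (memLp_gaussMul 1)
    simpa [gaussMul] using this
  have key := ae_eq_zero_of_integral_cexp hg fun t => by
    -- The exponential is expanded in powers of x; each term integrates to zero because it is a
    -- multiple of a vanishing moment.
    let F : ℕ → ℝ → ℂ := fun n x =>
      ((f x * Real.exp (-(1 / 2) * x ^ 2) : ℝ) : ℂ) * ((t * x * Complex.I) ^ n / (n.factorial : ℂ))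
    have hb : ∀ x : ℝ, HasSum (fun n : ℕ => ‖f x * Real.exp (-(1 / 2) * x ^ 2)‖ *
        (|t * x| ^ n / (n.factorial : ℝ)))
        (‖f x * Real.exp (-(1 / 2) * x ^ 2)‖ * Real.exp |t * x|) := fun x => by
      have := NormedSpace.expSeries_div_hasSum_exp (𝔸 := ℝ) |t * x|
      rw [← Real.exp_eq_exp_ℝ] at this
      exact this.mul_left _
    have hs : HasSum (fun n => ∫ x, F n x) (∫ x, ((f x * Real.exp (-(1 / 2) * x ^ 2) : ℝ) : ℂ) *
        Complex.exp (t * x * Complex.I)) := by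
      refine hasSum_integral_of_dominated_convergence
        (fun n x => ‖f x * Real.exp (-(1 / 2) * x ^ 2)‖ * (|t * x| ^ n / (n.factorial : ℝ)))
        (fun n => ?_) (fun n => Filter.Eventually.of_forall fun x => ?_)
        (Filter.Eventually.of_forall fun x => (hb x).summable) ?_
        (Filter.Eventually.of_forall fun x => ?_)
      · have hc : Continuous fun x : ℝ => (t * x * Complex.I) ^ n / (n.factorial : ℂ) := by fun_prop
        exact (hg.ofReal (𝕜 := ℂ)).1.mul hc.aestronglyMeasurable
      · simp only [F, norm_mul, norm_div, norm_pow, Complex.norm_real, Complex.norm_I, mul_one,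
          Complex.norm_natCast, Real.norm_eq_abs, abs_mul]
        exact le_rfl
      · simp only [(hb _).tsum_eq]
        have := (integrable_mul_of_memLp hf (memLp_exp_sub_sq t)).norm
        refine this.congr (Filter.Eventually.of_forall fun x => ?_)
        simp only [norm_mul, Real.norm_eq_abs, Real.abs_exp]
        ring
      · have := NormedSpace.expSeries_div_hasSum_exp (𝔸 := ℂ) (t * x * Complex.I)
        rw [← Complex.exp_eq_exp_ℂ] at this
        exact this.mul_left _
    have hz : ∀ n, ∫ x, F n x = 0 := fun n => by
      have : ∀ x, F n x = ((t * Complex.I) ^ n / (n.factorial : ℂ)) *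
          ((f x * gaussMul (X ^ n) x : ℝ) : ℂ) := fun x => by
        simp only [F, gaussMul, eval_pow, eval_X]
        push_cast
        ring
      simp only [this, integral_const_mul]
      rw [integral_complex_ofReal, h n]
      simp
    simp only [hz] at hs
    exact hs.unique hasSum_zero
  filter_upwards [key] with x hx
  exact (mul_eq_zero.mp hx).resolve_right (Real.exp_ne_zero _)

/-- Orthogonality comes from distinct eigenvalues, completeness from the determination of f by its
Gaussian moments. The k-th eigenfunction is built on the Hermite polynomial of index k − 1. -/
theorem isSpectrum_zero : IsSpectrum 0 (fun k : ℕ+ => 2 * (k : ℝ) - 1) := by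
  refine ⟨fun a b hab => ?_, ?_⟩
  · have : (a : ℝ) < b := by exact_mod_cast hab
    simp only
    linarith
  let v : ℕ+ → Lp ℝ 2 (volume : Measure ℝ) := fun k =>
    (memLp_gaussMul (hermiteH k.natPred)).toLp _
  have hv0 : ∀ k, v k ≠ 0 := fun k h0 => by
    have h1 : gaussMul (hermiteH k.natPred) =ᵐ[volume] 0 := by
      refine (memLp_gaussMul (hermiteH k.natPred)).coeFn_toLp.symm.trans ?_
      change (v k : ℝ → ℝ) =ᵐ[volume] 0
      rw [h0]
      exact Lp.coeFn_zero _ _ _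
    have h2 := (contDiff_gaussMul (hermiteH k.natPred) (n := 0)).continuous.ae_eq_iff_eq
      (μ := volume) (g := 0) continuous_zero |>.mp h1
    refine hermiteH_ne_zero k.natPred (Polynomial.funext fun x => ?_)
    have h3 := congrFun h2 x
    rw [eval_zero]
    exact (mul_eq_zero.mp h3).resolve_right (Real.exp_ne_zero _)
  have horth : ∀ i j, i ≠ j → inner ℝ (v i) (v j) = 0 := fun i j hij => by
    rw [inner_toLp]
    have h1 := isEigenfunction_gaussMul 1 i.natPred
    have h2 := isEigenfunction_gaussMul 1 j.natPred
    rw [C_1, one_mul] at h1 h2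
    refine h1.integral_mul_eq_zero h2 fun h => hij (PNat.natPred_injective ?_)
    have : (i.natPred : ℝ) = j.natPred := by linarith
    exact_mod_cast this
  have hon : Orthonormal ℝ fun k => ‖v k‖⁻¹ • v k := by
    refine ⟨fun k => ?_, fun i j hij => ?_⟩
    · rw [norm_smul, norm_inv, norm_norm, inv_mul_cancel₀ (norm_ne_zero_iff.mpr (hv0 k))]
    · simp only [real_inner_smul_left, real_inner_smul_right, horth i j hij, mul_zero]
  have hbot : (Submodule.span ℝ (Set.range fun k => ‖v k‖⁻¹ • v k))ᗮ = ⊥ := by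
    rw [eq_bot_iff]
    intro f hf
    rw [Submodule.mem_bot]
    have hfv : ∀ n, ∫ x, f x * gaussMul (hermiteH n) x = 0 := by
      intro n
      have h1 := (Submodule.mem_orthogonal' _ _).mp hf (‖v (Nat.succPNat n)‖⁻¹ •
        v (Nat.succPNat n)) (Submodule.subset_span ⟨_, rfl⟩)
      rw [real_inner_smul_right] at h1
      have h2 := (mul_eq_zero.mp h1).resolve_left
        (inv_ne_zero (norm_ne_zero_iff.mpr (hv0 _)))
      rw [← Lp.toLp_coeFn f (Lp.memLp f), inner_toLp] at h2
      simpa using h2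
    have hall : ∀ q ∈ Submodule.span ℝ (Set.range hermiteH), ∫ x, f x * gaussMul q x = 0 := by
      intro q hq
      induction hq using Submodule.span_induction with
      | mem q hq =>
        obtain ⟨n, rfl⟩ := hq
        exact hfv n
      | zero => simp [gaussMul]
      | add a b _ _ ha hb =>
        have : ∀ x, f x * gaussMul (a + b) x = f x * gaussMul a x + f x * gaussMul b x := fun x => by
          simp only [gaussMul, eval_add]; ring
        simp only [this]
        rw [integral_add (integrable_mul_of_memLp (Lp.memLp f) (memLp_gaussMul a))
          (integrable_mul_of_memLp (Lp.memLp f) (memLp_gaussMul b)), ha, hb, add_zero]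
      | smul c a _ ha =>
        have : ∀ x, f x * gaussMul (c • a) x = c * (f x * gaussMul a x) := fun x => by
          simp only [gaussMul, eval_smul, smul_eq_mul]; ring
        simp only [this]
        rw [integral_const_mul, ha, mul_zero]
    have h0 := ae_eq_zero_of_integral_gaussMul (Lp.memLp f) fun n => hall _ (mem_span_hermiteH _)
    exact Lp.ext (h0.trans (Lp.coeFn_zero _ _ _).symm)
  refine ⟨HilbertBasis.mkOfOrthogonalEqBot hon hbot, fun k =>
    ⟨gaussMul (C ‖v k‖⁻¹ * hermiteH k.natPred), ?_, ?_⟩⟩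
  · have h1 := isEigenfunction_gaussMul ‖v k‖⁻¹ k.natPred
    have h2 : 2 * (k.natPred : ℝ) + 1 = 2 * (k : ℝ) - 1 := by
      have : ((k.natPred + 1 : ℕ) : ℝ) = ((k : ℕ) : ℝ) := by rw [PNat.natPred_add_one]
      push_cast at this
      linarith
    rwa [h2] at h1
  · rw [HilbertBasis.coe_mkOfOrthogonalEqBot]
    filter_upwards [Lp.coeFn_smul ‖v k‖⁻¹ (v k),
      (memLp_gaussMul (hermiteH k.natPred)).coeFn_toLp] with x h1 h2
    rw [h1, Pi.smul_apply, h2]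
    simp only [gaussMul, eval_mul, eval_C, smul_eq_mul, mul_assoc]

/-- The eigenvalues of `-∂ₓₓ + x² + V` stay close to those of the harmonic oscillator. -/
theorem IsSpectrum.abs_sub_le {V : ℝ → ℝ} {w : ℕ+ → ℝ} {ρ : ℝ} (h : IsSpectrum V w)
    (hV : IsPotential V) (hρ : hatH1Norm V ≤ ρ) (k : ℕ+) : |w k - (2 * (k : ℝ) - 1)| ≤ ρ := by
  have hb : ∀ x, |V x| ≤ ρ := fun x => (hV.abs_le x).trans hρ
  have h1 := h.le_add isSpectrum_zero hV.contDiff.continuous continuous_zero (ρ := ρ)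
    (fun x => by simpa using hb x) k
  have h2 := isSpectrum_zero.le_add h continuous_zero hV.contDiff.continuous (ρ := ρ)
    (fun x => by simpa using hb x) k
  rw [abs_le]
  constructor <;> linarith

end Hermite

end LowRegBNF
end


noncomputable section

namespace LowRegBNF

/-! ### The constants -/

section Constants

variable {M : ℕ}

/-- An interval of m + 1 consecutive integers has an endpoint of modulus at least m/2, whose term is
at most 2/(m + 1). Removing that endpoint gives the induction, uniformly in the position a. -/
theorem sum_inv_one_add_abs_le (m : ℕ) (a : ℤ) :
    ∑ k ∈ Finset.range m, 1 / (1 + |((a + k : ℤ) : ℝ)|) ≤ 2 * (harmonic m : ℝ) := by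
  induction m generalizing a with
  | zero => simp
  | succ m ih =>
    have hstep : ∀ z : ℤ, (m : ℝ) ≤ 2 * |(z : ℝ)| → 1 / (1 + |(z : ℝ)|) ≤ 2 * (1 / ((m : ℝ) + 1)) := by
      intro z hz
      rw [mul_one_div, div_le_div_iff₀ (by positivity) (by positivity)]
      linarith
    have hh : (harmonic (m + 1) : ℝ) = harmonic m + 1 / ((m : ℝ) + 1) := by
      rw [harmonic_succ]; push_cast; ring
    rw [hh, mul_add]
    rcases le_total (m : ℤ) (2 * |a|) with h | h
    · rw [Finset.sum_range_succ']
      refine add_le_add ?_ ?_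
      · refine le_trans (le_of_eq (Finset.sum_congr rfl fun k _ => ?_)) (ih (a + 1))
        push_cast
        congr 3
        ring
      · have := hstep a (by exact_mod_cast h)
        simpa using this
    · rw [Finset.sum_range_succ]
      refine add_le_add (ih a) (hstep _ ?_)
      have h1 : (m : ℤ) ≤ 2 * |a + m| := by
        rcases abs_cases a with h2 | h2 <;> rcases abs_cases (a + m) with h3 | h3 <;> omega
      exact_mod_cast h1

theorem harmonic_le_log {M : ℕ} (hM : 2 ≤ M) : (harmonic M : ℝ) ≤ 3 * Real.log M := by
  have h1 := harmonic_le_one_add_log M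
  have h2 : Real.log 2 ≤ Real.log M := Real.log_le_log (by norm_num) (by exact_mod_cast hM)
  have h3 := Real.log_two_gt_d9
  linarith

theorem kernelLE_log (hM : 2 ≤ M) : KernelLE M (12 * Real.log M) := by
  intro c
  have h1 : ∑ k : Fin M, 1 / (1 + |((c + freq (Sum.inl k) : ℤ) : ℝ)|) ≤ 2 * (harmonic M : ℝ) := by
    simp only [freq, Sum.elim_inl]
    rw [Fin.sum_univ_eq_sum_range (fun k : ℕ => 1 / (1 + |((c + ((k : ℤ) + 1) : ℤ) : ℝ)|)) M]
    refine le_trans (le_of_eq (Finset.sum_congr rfl fun k _ => ?_))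
      (sum_inv_one_add_abs_le M (c + 1))
    congr 4
    ring
  have h2 : ∑ k : Fin M, 1 / (1 + |((c + freq (Sum.inr k) : ℤ) : ℝ)|) ≤ 2 * (harmonic M : ℝ) := by
    simp only [freq, Sum.elim_inr]
    rw [Fin.sum_univ_eq_sum_range (fun k : ℕ => 1 / (1 + |((c + -((k : ℤ) + 1) : ℤ) : ℝ)|)) M]
    refine le_trans (le_of_eq (Finset.sum_congr rfl fun k _ => ?_))
      (sum_inv_one_add_abs_le M (1 - c))
    rw [← abs_neg]
    congr 2
    push_cast
    congr 1
    ring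
  rw [Fintype.sum_sum_type]
  linarith [harmonic_le_log hM]

theorem sum_inv_japV_le (hM : 2 ≤ M) : ∑ v : Var M, 1 / japV v ≤ 12 * Real.log M := by
  have h1 : ∑ k : Fin M, 1 / jap (mode k) ≤ (harmonic M : ℝ) := by
    have : (harmonic M : ℝ) = ∑ k ∈ Finset.range M, 1 / ((k : ℝ) + 1) := by
      simp [harmonic]
    rw [this, ← Fin.sum_univ_eq_sum_range (fun k : ℕ => 1 / ((k : ℝ) + 1)) M]
    refine Finset.sum_le_sum fun k _ => one_div_le_one_div_of_le (by positivity) ?_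
    have := le_jap (mode k)
    simpa [mode] using this
  rw [Fintype.sum_sum_type]
  simp only [japV, Sum.elim_inl, Sum.elim_inr]
  have h0 : 0 ≤ Real.log M := Real.log_natCast_nonneg M
  linarith [harmonic_le_log hM]

/-! ### From monomials to small divisors. -/

theorem exists_tuple {α : Type*} (s : Multiset α) {n : ℕ} (h : s.card = n) :
    ∃ f : Fin n → α, Finset.univ.val.map f = s := by
  subst h
  refine ⟨fun i => s.toList.get (i.cast (by simp)), ?_⟩
  rw [Fin.univ_val_map]
  conv_rhs => rw [← s.coe_toList]
  refine congrArg _ (List.ext_get (by simp) fun i h1 h2 => by simp)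

/-- The modes of the variables `u` in the monomial, completed by the mode `1`. -/
def modeMultiset (n : ℕ) (c : Fin M → ℕ) : Multiset ℕ+ :=
  ∑ k, Multiset.replicate (c k) (mode k) + Multiset.replicate (n - ∑ k, c k) 1

theorem card_modeMultiset {n : ℕ} {c : Fin M → ℕ} (h : ∑ k, c k ≤ n) :
    (modeMultiset n c).card = n := by
  simp [modeMultiset, h]

theorem mode_injective : Function.Injective (mode : Fin M → ℕ+) := fun _ _ h =>
  Fin.ext (Nat.succPNat_injective h)

theorem count_modeMultiset (n : ℕ) (c : Fin M → ℕ) (q : Fin M) :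
    (modeMultiset n c).count (mode q) =
      c q + (Multiset.replicate (n - ∑ k, c k) (1 : ℕ+)).count (mode q) := by
  rw [modeMultiset, Multiset.count_add, Multiset.count_sum']
  congr 1
  rw [Finset.sum_eq_single q]
  · simp
  · intro k _ hk
    rw [Multiset.count_replicate, if_neg fun h => hk (mode_injective h)]
  · simp

theorem sum_map_modeMultiset (w : ℕ+ → ℝ) (n : ℕ) (c : Fin M → ℕ) :
    ((modeMultiset n c).map w).sum =
      ∑ k, (c k : ℝ) * w (mode k) + ((n - ∑ k, c k : ℕ) : ℝ) * w 1 := by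
  rw [modeMultiset, Multiset.map_add, Multiset.sum_add]
  congr 1
  · have : ∀ s : Finset (Fin M), ((∑ k ∈ s, Multiset.replicate (c k) (mode k)).map w).sum =
        ∑ k ∈ s, (c k : ℝ) * w (mode k) := by
      intro s
      induction s using Finset.cons_induction with
      | empty => simp
      | cons a s ha ih =>
        rw [Finset.sum_cons, Finset.sum_cons, Multiset.map_add, Multiset.sum_add, ih]
        simp
    exact this _
  · simp

theorem excess_eq {n : ℕ} (j ℓ : Fin n → ℕ+) (s : ℕ+) : excess j ℓ s =
    ((Finset.univ.val.map j).count s : ℤ) - ((Finset.univ.val.map ℓ).count s : ℤ) := by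
  have : ∀ f : Fin n → ℕ+, ((Finset.univ.val.map f).count s : ℤ) = ∑ i, if f i = s then 1 else 0 := by
    intro f
    rw [Multiset.count_map, ← Finset.filter_val, Finset.card_val, Finset.card_filter]
    push_cast
    simp only [eq_comm]
  rw [this, this, excess, Finset.sum_sub_distrib]

/-- The small divisor of a monomial that is not resonant. -/
theorem NonResonant.le_abs_weight {w : ℕ+ → ℝ} {n N : ℕ} {β : ℝ} (h : NonResonant w n N β)
    {γ : Var M →₀ ℕ} (hc : Finsupp.weight charge γ = 0) (hd : γ.degree ≤ 2 * n)
    (hr : ¬IsResonant N γ) : β ≤ |Finsupp.weight (sfreq w) γ| := by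
  rw [Finsupp.weight_eq_sum, Fintype.sum_sum_type] at hc
  rw [degree_eq_sum, Fintype.sum_sum_type] at hd
  simp only [charge, Sum.elim_inl, Sum.elim_inr, smul_neg, Finset.sum_neg_distrib, nsmul_eq_mul,
    mul_one] at hc
  have hlr : (∑ k, γ (Sum.inl k) : ℕ) = ∑ k, γ (Sum.inr k) := by zify; linarith
  have hl : ∑ k, γ (Sum.inl k) ≤ n := by omega
  -- By neutrality both sides have the same number of modes, hence are padded by the same number of
  -- modes 1. The padding cancels in the small divisor and in the excess.
  obtain ⟨j, hj⟩ := exists_tuple _ (card_modeMultiset hl)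
  obtain ⟨ℓ, hℓ⟩ := exists_tuple _ (card_modeMultiset (hlr ▸ hl))
  have hΩ : Finsupp.weight (sfreq w) γ = smallDivisor w j ℓ := by
    have e : ∀ f : Fin n → ℕ+, ∑ i, w (f i) = ((Finset.univ.val.map f).map w).sum := fun f => by
      rw [Multiset.map_map]; rfl
    rw [smallDivisor, e, e, hj, hℓ, sum_map_modeMultiset, sum_map_modeMultiset, hlr,
      Finsupp.weight_eq_sum, Fintype.sum_sum_type]
    simp only [sfreq, Sum.elim_inl, Sum.elim_inr, smul_neg, Finset.sum_neg_distrib, nsmul_eq_mul]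
    ring
  rw [hΩ]
  refine h j ℓ ?_
  simp only [IsResonant, not_forall] at hr
  obtain ⟨q, hq, hne⟩ := hr
  refine le_trans (iInf₂_le (mode q) ?_) (by exact_mod_cast hq)
  rw [excess_eq, hj, hℓ, count_modeMultiset, count_modeMultiset, hlr]
  push_cast
  intro h0
  apply hne
  zify
  linarith

/-- Each eigenvalue is within ρ + 1 of 2k, so every factor of the monomial contributes at most that
error. -/
theorem abs_weight_sfreq_sub_le {w : ℕ+ → ℝ} {ρ : ℝ} (hw : ∀ k : ℕ+, |w k - (2 * (k : ℝ) - 1)| ≤ ρ)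
    (γ : Var M →₀ ℕ) :
    |Finsupp.weight (sfreq w) γ - 2 * ((Finsupp.weight freq γ : ℤ) : ℝ)| ≤ γ.degree * (ρ + 1) := by
  have hv : ∀ v : Var M, |sfreq w v - 2 * (freq v : ℝ)| ≤ ρ + 1 := by
    have hk : ∀ k : Fin M, |w (mode k) - 2 * ((k : ℝ) + 1)| ≤ ρ + 1 := fun k => by
      have h1 := abs_le.mp (hw (mode k))
      have h2 : ((mode k : ℕ+) : ℝ) = (k : ℝ) + 1 := by simp [mode]
      rw [h2] at h1
      rw [abs_le]
      constructor <;> linarith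
    rintro (k | k)
    · have := hk k
      simpa [sfreq, freq] using this
    · have := hk k
      rw [← abs_neg] at this
      simp only [sfreq, freq, Sum.elim_inr]
      push_cast
      convert this using 2
      ring
  rw [Finsupp.weight_eq_sum, Finsupp.weight_eq_sum, degree_eq_sum]
  simp only [nsmul_eq_mul]
  push_cast
  rw [Finset.mul_sum, ← Finset.sum_sub_distrib, Finset.sum_mul]
  refine (Finset.abs_sum_le_sum_abs _ _).trans (Finset.sum_le_sum fun v _ => ?_)
  have : (γ v : ℝ) * sfreq w v - 2 * ((γ v : ℝ) * (freq v : ℝ)) =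
      γ v * (sfreq w v - 2 * freq v) := by ring
  rw [this, abs_mul, Nat.abs_cast]
  exact mul_le_mul_of_nonneg_left (hv v) (Nat.cast_nonneg _)

/-- A control constant of the size of `log M`. -/
theorem exists_isControl (n : ℕ) {C₀ β ρ : ℝ} (hC₀ : 0 < C₀) (hβ : 0 < β) (hρ : 0 < ρ) :
    ∃ C, 1 ≤ C ∧ ∀ (M N : ℕ) (w : ℕ+ → ℝ), 2 ≤ M → (∀ k : ℕ+, |w k - (2 * (k : ℝ) - 1)| ≤ ρ) →
      NonResonant w n N β → IsControl M N (2 * n) w (C * Real.log M) ∧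
        ∑ v : Var M, 1 / japV v ≤ C * Real.log M ∧ C₀ ≤ C * Real.log M := by
  -- From 2|σ| ≤ |Ω| + 2n(ρ + 1), the constant 1 + 2n(ρ + 1) is absorbed into |Ω| by the lower bound
  -- |Ω| ≥ β; this gives 1 + |σ| ≤ S |Ω|.
  set S : ℝ := 1 + (1 + 2 * n * (ρ + 1)) / β with hS
  have hS0 : 0 < S := by positivity
  have hn : (0 : ℝ) ≤ n := n.cast_nonneg
  refine ⟨12 + 4 * n + 2 * C₀ + 2 * S, by linarith, ?_⟩
  intro M N w hM hw hres
  -- Since log M > 1/2 for M ≥ 2, fixed constants become multiples of log M at the price of a factor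
  -- 2.
  have hlog : 1 / 2 < Real.log M := by
    have h2 : Real.log 2 ≤ Real.log M := Real.log_le_log (by norm_num) (by exact_mod_cast hM)
    have h3 := Real.log_two_gt_d9
    linarith
  set L := Real.log M with hL
  have b1 : 12 * L ≤ (12 + 4 * n + 2 * C₀ + 2 * S) * L :=
    mul_le_mul_of_nonneg_right (by linarith) (by linarith)
  have b2 : 2 * (n : ℝ) + C₀ + S ≤ (12 + 4 * n + 2 * C₀ + 2 * S) * L := by nlinarith
  refine ⟨⟨by linarith, ?_, fun c => (kernelLE_log hM c).trans b1, ?_⟩,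
    (sum_inv_japV_le hM).trans b1, by linarith⟩
  · push_cast
    linarith
  · intro γ hc hd hr
    have h1 := hres.le_abs_weight hc hd hr
    have h2 := abs_weight_sfreq_sub_le hw γ
    have h3 : (γ.degree : ℝ) * (ρ + 1) ≤ 2 * n * (ρ + 1) := by
      refine mul_le_mul_of_nonneg_right ?_ (by linarith)
      exact_mod_cast hd
    set Ω := Finsupp.weight (sfreq w) γ
    set σ := ((Finsupp.weight freq γ : ℤ) : ℝ)
    have h4 : 2 * |σ| ≤ |Ω| + 2 * n * (ρ + 1) := by
      have := abs_sub_abs_le_abs_sub (2 * σ) Ω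
      rw [abs_mul, abs_two, abs_sub_comm] at this
      linarith
    have h5 : 1 + 2 * n * (ρ + 1) ≤ (1 + 2 * n * (ρ + 1)) / β * |Ω| := by
      rw [div_mul_eq_mul_div, le_div_iff₀ hβ]
      exact mul_le_mul_of_nonneg_left h1 (by positivity)
    have h6 : S * |Ω| ≤ (12 + 4 * n + 2 * C₀ + 2 * S) * L * |Ω| :=
      mul_le_mul_of_nonneg_right (by linarith) (abs_nonneg _)
    have h7 : S * |Ω| = |Ω| + (1 + 2 * n * (ρ + 1)) / β * |Ω| := by rw [hS]; ring
    linarith [abs_nonneg σ]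

end Constants

end LowRegBNF
end


noncomputable section

namespace LowRegBNF

open MvPolynomial

/-! ### Hamiltonians as polynomials -/

section HamPoly

variable {M n : ℕ}

/-- The exponent of the monomial `u_{j₁} ⋯ u_{jₙ} ū_{ℓ₁} ⋯ ū_{ℓₙ}`. -/
def idx (j ℓ : Fin n → Fin M) : Var M →₀ ℕ :=
  ∑ i, Finsupp.single (Sum.inl (j i)) 1 + ∑ i, Finsupp.single (Sum.inr (ℓ i)) 1

theorem prod_pow_idx {R : Type*} [CommSemiring R] (x : Var M → R) (j ℓ : Fin n → Fin M) :
    ∏ v, x v ^ idx j ℓ v = (∏ i, x (Sum.inl (j i))) * ∏ i, x (Sum.inr (ℓ i)) := by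
  classical
  have key : ∀ f : Fin n → Var M,
      ∏ v, x v ^ (∑ i, Finsupp.single (f i) 1 : Var M →₀ ℕ) v = ∏ i, x (f i) := by
    intro f
    simp only [Finsupp.finsetSum_apply, ← Finset.prod_pow_eq_pow_sum]
    rw [Finset.prod_comm]
    refine Finset.prod_congr rfl fun i _ => ?_
    rw [Finset.prod_eq_single (f i)]
    · simp
    · intro v _ hv
      simp [hv.symm]
    · simp
  simp only [idx, Finsupp.add_apply, pow_add, Finset.prod_mul_distrib, key]

theorem degree_idx (j ℓ : Fin n → Fin M) : (idx j ℓ).degree = 2 * n := by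
  simp [idx, map_add, map_sum, two_mul]

theorem weight_charge_idx (j ℓ : Fin n → Fin M) : Finsupp.weight charge (idx j ℓ) = 0 := by
  simp [idx, map_add, map_sum, charge, Finsupp.weight_single]

theorem swapIdx_idx (j ℓ : Fin n → Fin M) : swapIdx (idx j ℓ) = idx ℓ j := by
  rw [swapIdx, idx, idx, Finsupp.mapDomain_add, Finsupp.mapDomain_finsetSum,
    Finsupp.mapDomain_finsetSum, add_comm]
  simp only [Finsupp.mapDomain_single, Sum.swap_inl, Sum.swap_inr]

theorem idx_comp (φ ψ : Equiv.Perm (Fin n)) (j ℓ : Fin n → Fin M) :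
    idx (j ∘ φ) (ℓ ∘ ψ) = idx j ℓ := by
  simp only [idx, Function.comp_apply]
  rw [Equiv.sum_comp φ fun i => Finsupp.single (Sum.inl (j i) : Var M) 1,
    Equiv.sum_comp ψ fun i => Finsupp.single (Sum.inr (ℓ i) : Var M) 1]

/-- Neutrality and degree 2n give n factors of each kind. This guarantees that the multiplicities
used as denominators in `hamOfPoly` do not vanish where they are needed. -/
theorem exists_idx_eq {γ : Var M →₀ ℕ} (hc : Finsupp.weight charge γ = 0)
    (hd : γ.degree = 2 * n) : ∃ j ℓ : Fin n → Fin M, idx j ℓ = γ := by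
  classical
  rw [Finsupp.weight_eq_sum, Fintype.sum_sum_type] at hc
  rw [degree_eq_sum, Fintype.sum_sum_type] at hd
  simp only [charge, Sum.elim_inl, Sum.elim_inr, smul_neg, Finset.sum_neg_distrib, nsmul_eq_mul,
    mul_one] at hc
  have hlr : (∑ k, γ (Sum.inl k) : ℕ) = ∑ k, γ (Sum.inr k) := by zify; linarith
  have hex : ∀ c : Fin M → ℕ, ∑ k, c k = n → ∃ f : Fin n → Fin M, ∀ k,
      ∑ i, (if f i = k then 1 else 0) = c k := by
    intro c hcn
    obtain ⟨f, hf⟩ := exists_tuple (∑ k, Multiset.replicate (c k) k) (n := n) (by simp [hcn])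
    refine ⟨f, fun k => ?_⟩
    have h1 := congrArg (Multiset.count k) hf
    rw [Multiset.count_map, ← Finset.filter_val, Finset.card_val, Finset.card_filter,
      Multiset.count_sum'] at h1
    simp only [Multiset.count_replicate, Finset.sum_ite_eq', Finset.mem_univ, if_true] at h1
    rw [← h1]
    simp only [eq_comm]
  obtain ⟨j, hj⟩ := hex (fun k => γ (Sum.inl k)) (by omega)
  obtain ⟨ℓ, hℓ⟩ := hex (fun k => γ (Sum.inr k)) (by omega)
  refine ⟨j, ℓ, Finsupp.ext fun v => ?_⟩
  rcases v with k | k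
  · simp [idx, Finsupp.single_apply, ← hj]
  · simp [idx, Finsupp.single_apply, ← hℓ]

theorem eval_monomial_idx (c : ℂ) (j ℓ : Fin n → Fin M) (u : Phase M) :
    eval (pt u) (monomial (idx j ℓ) c) =
      c * (∏ i, u (j i)) * ∏ i, (starRingEnd ℂ) (u (ℓ i)) := by
  rw [eval_monomial, Finsupp.prod_fintype _ _ (by simp), prod_pow_idx, mul_assoc]
  rfl

/-- The polynomial of a Hamiltonian. -/
def Ham.poly (H : Ham M n) : MvPolynomial (Var M) ℂ := ∑ j, ∑ ℓ, monomial (idx j ℓ) (H.coeff j ℓ)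

theorem Ham.reEval_poly (H : Ham M n) (u : Phase M) : reEval H.poly u = H.eval u := by
  simp only [reEval, Ham.eval, Ham.poly, Ham.sum, map_sum, eval_monomial_idx]

theorem Ham.isHomogeneous_poly (H : Ham M n) : H.poly.IsHomogeneous (2 * n) :=
  IsHomogeneous.sum _ _ _ fun j _ => IsHomogeneous.sum _ _ _ fun ℓ _ =>
    isHomogeneous_monomial _ (degree_idx j ℓ)

theorem Ham.degree_poly (H : Ham M n) {γ : Var M →₀ ℕ} (hγ : γ ∈ H.poly.support) :
    γ.degree = 2 * n := by
  by_contra h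
  exact (mem_support_iff.mp hγ) (H.isHomogeneous_poly.coeff_eq_zero h)

theorem Ham.poly_mem_pow (H : Ham M n) : H.poly ∈ idealOfVars (Var M) ℂ ^ (2 * n) := by
  rw [mem_pow_idealOfVars_iff]
  exact fun γ hγ => (H.degree_poly hγ).ge

theorem Ham.isHamPoly_poly (H : Ham M n) : IsHamPoly H.poly := by
  classical
  refine ⟨?_, ?_⟩
  · ext γ
    rw [coeff_conjP]
    simp only [Ham.poly, coeff_sum, coeff_monomial, map_sum]
    rw [Finset.sum_comm]
    refine Finset.sum_congr rfl fun j _ => Finset.sum_congr rfl fun ℓ _ => ?_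
    have : idx ℓ j = swapIdx γ ↔ idx j ℓ = γ := by
      rw [← swapIdx_idx j ℓ]
      exact ⟨fun h => by rw [← swapIdx_swapIdx (idx j ℓ), h, swapIdx_swapIdx], fun h => by rw [h]⟩
    by_cases h : idx j ℓ = γ
    · rw [if_pos h, if_pos (this.mpr h), ← H.reality]
    · rw [if_neg h, if_neg (fun h' => h (this.mp h')), map_zero]
  · exact IsWeightedHomogeneous.sum _ _ _ fun j _ => IsWeightedHomogeneous.sum _ _ _ fun ℓ _ =>
      isWeightedHomogeneous_monomial _ _ _ (weight_charge_idx j ℓ)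

theorem Ham.norm_coeff_le (H : Ham M n) (j ℓ : Fin n → Fin M) : ‖H.coeff j ℓ‖ ≤ H.norm :=
  le_ciSup (f := fun jℓ : (Fin n → Fin M) × (Fin n → Fin M) => ‖H.coeff jℓ.1 jℓ.2‖)
    (Set.finite_range _).bddAbove (j, ℓ)

/-- The sums over j and ℓ of the products are n-th powers of the ℓ¹ sizes, so the supremum of the
coefficients bounds the majorant on the simplex without any combinatorial constant. -/
theorem Ham.majLE_poly (H : Ham M n) {A : ℝ} (hA : 0 ≤ A) (h : H.norm ≤ A) : MajLE H.poly A := by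
  intro x hx hx1
  have h1 : maj H.poly x ≤ ∑ j : Fin n → Fin M, ∑ ℓ : Fin n → Fin M,
      A * ((∏ i, x (Sum.inl (j i))) * ∏ i, x (Sum.inr (ℓ i))) := by
    refine (maj_sum_le _ _ hx).trans (Finset.sum_le_sum fun j _ => ?_)
    refine (maj_sum_le _ _ hx).trans (Finset.sum_le_sum fun ℓ _ => ?_)
    rw [maj_monomial, mon, prod_pow_idx]
    exact mul_le_mul_of_nonneg_right ((H.norm_coeff_le j ℓ).trans h)
      (mul_nonneg (Finset.prod_nonneg fun i _ => hx _) (Finset.prod_nonneg fun i _ => hx _))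
  rw [Fintype.sum_sum_type] at hx1
  have p1 : 0 ≤ ∑ k, x (Sum.inl k) := Finset.sum_nonneg fun k _ => hx _
  have p2 : 0 ≤ ∑ k, x (Sum.inr k) := Finset.sum_nonneg fun k _ => hx _
  have h2 : (∑ j : Fin n → Fin M, ∑ ℓ : Fin n → Fin M,
      A * ((∏ i, x (Sum.inl (j i))) * ∏ i, x (Sum.inr (ℓ i)))) =
      A * ((∑ k, x (Sum.inl k)) ^ n * (∑ k, x (Sum.inr k)) ^ n) := by
    rw [Fintype.sum_pow, Fintype.sum_pow, Finset.sum_mul_sum]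
    simp only [Finset.mul_sum]
  refine h1.trans (h2.le.trans ?_)
  exact mul_le_of_le_one_right hA (mul_le_one₀ (pow_le_one₀ p1 (by linarith)) (by positivity)
    (pow_le_one₀ p2 (by linarith)))

/-- The number of ways in which an exponent arises. -/
def idxCard (n : ℕ) (γ : Var M →₀ ℕ) : ℕ :=
  Nat.card {jℓ : (Fin n → Fin M) × (Fin n → Fin M) // idx jℓ.1 jℓ.2 = γ}

theorem idxCard_swapIdx (γ : Var M →₀ ℕ) : idxCard n (swapIdx γ) = idxCard n γ := by
  refine Nat.card_congr ((Equiv.prodComm _ _).subtypeEquiv fun jℓ => ?_)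
  rw [Equiv.prodComm_apply, Prod.fst_swap, Prod.snd_swap, ← swapIdx_idx jℓ.1]
  exact ⟨fun h => by rw [h, swapIdx_swapIdx], fun h => by rw [← h, swapIdx_swapIdx]⟩

/-- The part of degree `2 * n` of a real polynomial, as a Hamiltonian. -/
def hamOfPoly (f : MvPolynomial (Var M) ℂ) (hf : IsHamPoly f) (n : ℕ) : Ham M n where
  coeff j ℓ := f.coeff (idx j ℓ) / (idxCard n (idx j ℓ) : ℂ)
  reality j ℓ := by
    rw [← swapIdx_idx j ℓ, idxCard_swapIdx, hf.coeff_swapIdx, map_div₀, Complex.conj_conj,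
      map_natCast]
  symmetry φ ψ j ℓ := by rw [idx_comp]

/-- The pairs of tuples are grouped by exponent. Each coefficient of f was split equally among the
pairs producing it, so every fibre adds up to it. -/
theorem sum_hamOfPoly {f : MvPolynomial (Var M) ℂ} (hf : IsHamPoly f) (n : ℕ) (u : Phase M) :
    (hamOfPoly f hf n).sum u =
      ∑ γ ∈ f.support with γ.degree = 2 * n, f.coeff γ * ∏ v, pt u v ^ γ v := by
  classical
  let F : (Var M →₀ ℕ) → ℂ := fun γ => f.coeff γ / (idxCard n γ : ℂ) * ∏ v, pt u v ^ γ v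
  let T : Finset (Var M →₀ ℕ) := f.support.filter fun γ => γ.degree = 2 * n
  let I : (Fin n → Fin M) × (Fin n → Fin M) → (Var M →₀ ℕ) := fun jℓ => idx jℓ.1 jℓ.2
  have e1 : (hamOfPoly f hf n).sum u = ∑ jℓ, F (I jℓ) := by
    rw [Ham.sum, Fintype.sum_prod_type]
    refine Finset.sum_congr rfl fun j _ => Finset.sum_congr rfl fun ℓ _ => ?_
    simp only [F, I, prod_pow_idx, hamOfPoly, mul_assoc]
    rfl
  have e2 : ∑ jℓ, F (I jℓ) = ∑ jℓ with I jℓ ∈ T, F (I jℓ) := by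
    refine (Finset.sum_filter_of_ne fun jℓ _ hne => ?_).symm
    refine Finset.mem_filter.mpr ⟨mem_support_iff.mpr fun h0 => hne ?_, degree_idx _ _⟩
    simp [F, h0]
  rw [e1, e2, ← Finset.sum_fiberwise_of_maps_to (g := I) (t := T)
    (fun jℓ h => (Finset.mem_filter.mp h).2)]
  refine Finset.sum_congr rfl fun γ hγ => ?_
  obtain ⟨hs, hd⟩ := Finset.mem_filter.mp hγ
  have hset : (Finset.univ.filter fun jℓ => I jℓ ∈ T).filter (fun jℓ => I jℓ = γ) =
      Finset.univ.filter fun jℓ => I jℓ = γ := by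
    ext jℓ
    simp only [Finset.mem_filter, Finset.mem_univ, true_and, and_iff_right_iff_imp]
    rintro rfl
    exact hγ
  rw [hset, Finset.sum_congr rfl (g := fun _ => F γ)
    fun jℓ h => by rw [(Finset.mem_filter.mp h).2], Finset.sum_const, nsmul_eq_mul]
  have hcard : (Finset.univ.filter fun jℓ => I jℓ = γ).card = idxCard n γ := by
    rw [idxCard, Nat.card_eq_fintype_card, Fintype.card_subtype]
  have hne : (idxCard n γ : ℂ) ≠ 0 := by
    obtain ⟨j, ℓ, h⟩ := exists_idx_eq (n := n) (hf.gauge (mem_support_iff.mp hs)) hd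
    rw [← hcard]
    exact_mod_cast Finset.card_ne_zero_of_mem (a := (j, ℓ)) (by simp [I, h])
  rw [hcard]
  simp only [F]
  field_simp

/-- A real polynomial is the sum of its homogeneous parts. -/
theorem sum_eval_hamOfPoly {f : MvPolynomial (Var M) ℂ} (hf : IsHamPoly f) {a b : ℕ}
    (h1 : f ∈ idealOfVars (Var M) ℂ ^ (2 * a)) (h2 : ∀ γ ∈ f.support, γ.degree ≤ 2 * b)
    (u : Phase M) : ∑ n ∈ Finset.Icc a b, (hamOfPoly f hf n).eval u = reEval f u := by
  rw [mem_pow_idealOfVars_iff] at h1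
  simp only [Ham.eval, reEval, sum_hamOfPoly]
  rw [← Complex.re_sum, eval_eq']
  congr 1
  have hmap : ∀ γ ∈ f.support, γ.degree / 2 ∈ Finset.Icc a b := fun γ hγ => by
    have := h1 γ hγ
    have := h2 γ hγ
    rw [Finset.mem_Icc]
    omega
  rw [← Finset.sum_fiberwise_of_maps_to hmap]
  refine Finset.sum_congr rfl fun n _ => Finset.sum_congr (Finset.filter_congr fun γ hγ => ?_)
    fun γ _ => rfl
  obtain ⟨k, hk⟩ := even_degree (hf.gauge (mem_support_iff.mp hγ))
  omega

/-! ### Actions, Poisson brackets and the quadratic part. -/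

theorem l2_comm (u v : Phase M) : l2 u v = l2 v u := by
  refine Finset.sum_congr rfl fun k _ => ?_
  simp only [Complex.mul_re, Complex.conj_re, Complex.conj_im]
  ring

theorem grad_action (q : Fin M) (u : Phase M) : grad (action q) u = Pi.single q (2 * u q) := by
  have h : ∀ v : Phase M, fderiv ℝ (action q) u v = 2 * ((starRingEnd ℂ) (u q) * v q).re := by
    intro v
    have h1 : HasFDerivAt (fun u : Phase M => u q) (ContinuousLinearMap.proj q) u :=
      (ContinuousLinearMap.proj (R := ℝ) (φ := fun _ : Fin M => ℂ) q).hasFDerivAt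
    have h2 : HasFDerivAt (action q) _ u := h1.norm_sq
    rw [h2.fderiv]
    simp [Complex.inner]
    ring
  funext k
  simp only [grad, h]
  by_cases hk : k = q
  · subst hk
    apply Complex.ext <;> simp
  · have : ∀ z : ℂ, (Pi.single k z : Phase M) q = 0 := fun z =>
      Pi.single_eq_of_ne (M := fun _ => ℂ) (Ne.symm hk) z
    rw [Pi.single_eq_of_ne hk]
    simp [this]

/-- Resonant polynomials commute with the actions. -/
theorem poisson_action_reEval {f : MvPolynomial (Var M) ℂ} {q : Fin M}
    (h : ∀ γ ∈ f.support, γ (Sum.inl q) = γ (Sum.inr q)) (u : Phase M) :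
    poisson (action q) (reEval f) u = 0 := by
  classical
  rw [poisson, l2_comm, l2_grad, fderiv_reEval, grad_action]
  -- θ generates the rotation of the mode q. Its weight on a monomial is the exponent of u_q minus
  -- that of ū_q, which is zero here, so Euler's identity makes the bracket vanish.
  let θ : Var M → ℂ := Sum.elim (fun k => if k = q then 1 else 0) fun k => if k = q then -1 else 0
  have h0 : mult (Finsupp.weight θ) f = 0 := by
    ext γ
    rw [coeff_mult, coeff_zero]
    by_cases hγ : γ ∈ f.support
    · rw [Finsupp.weight_eq_sum, Fintype.sum_sum_type]
      simp [θ, h γ hγ]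
    · rw [notMem_support_iff.mp hγ, mul_zero]
  have h1 := congrArg (eval (pt u)) (sum_X_mul_pderiv θ f)
  rw [h0, map_zero, map_sum] at h1
  have h2 : ∀ i, eval (pt u) (pderiv i f) * pt (Complex.I • (Pi.single q (2 * u q) : Phase M)) i =
      2 * Complex.I * eval (pt u) (C (θ i) * (X i * pderiv i f)) := by
    intro i
    rw [map_mul, map_mul, eval_C, eval_X]
    rcases i with k | k
    · by_cases hk : k = q
      · subst hk; simp [pt, θ]; ring
      · simp [pt, θ, hk]
    · by_cases hk : k = q
      · subst hk
        have : (starRingEnd ℂ) 2 = 2 := map_ofNat _ 2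
        simp [pt, θ, this]
        ring
      · simp [pt, θ, hk]
  simp only [h2]
  rw [← Finset.mul_sum, h1]
  simp

/-- The increment of the quadratic part. -/
theorem Z2_add_sub (w : ℕ+ → ℝ) {χ : MvPolynomial (Var M) ℂ} (hχ : IsHamPoly χ) (m : Phase M) :
    Z2 w (m + vfield χ m) - Z2 w (m - vfield χ m) = reEval (homOp w χ) m := by
  -- Written with complex weights, `homOp` falls under Euler's identity. The rest is |a + b|² − |a −
  -- b|² = 4 Re(ā b) in each mode.
  have h1 : homOp w χ = C (-Complex.I) * mult (Finsupp.weight fun v => (sfreq w v : ℂ)) χ := by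
    ext γ
    rw [homOp, coeff_mult, coeff_C_mul, coeff_mult, Finsupp.weight_eq_sum, Finsupp.weight_eq_sum]
    push_cast [nsmul_eq_mul]
    ring
  rw [h1, ← sum_X_mul_pderiv, reEval, map_mul, map_sum, Fintype.sum_sum_type,
    ← Finset.sum_add_distrib, eval_C, Finset.mul_sum, Complex.re_sum, Z2, Z2, ← mul_sub,
    ← Finset.sum_sub_distrib, Finset.mul_sum]
  refine Finset.sum_congr rfl fun k _ => ?_
  have h2 : eval (pt m) (pderiv (Sum.inl k) χ) =
      (starRingEnd ℂ) (eval (pt m) (pderiv (Sum.inr k) χ)) := by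
    rw [← eval_conjP, conjP_pderiv, hχ.real]; rfl
  simp only [Pi.add_apply, Pi.sub_apply, vfield, vf, map_mul, eval_C, eval_X, h2]
  simp only [sfreq, Sum.elim_inl, Sum.elim_inr, charge, pt, Sum.swap_inl, ← Complex.normSq_eq_norm_sq, Complex.normSq_apply]
  simp
  ring

end HamPoly

end LowRegBNF
end


noncomputable section

namespace LowRegBNF

open MvPolynomial

/-! ### The transformation -/

section Transformation

variable {M p : ℕ}

/-- A vector field of order `2 * p + 1`, whose differential is bounded by `Γ` times a power of the norm. -/
structure IsFieldBound (p : ℕ) (g : Phase M → Phase M) (Γ : ℝ) : Prop where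
  contDiff : ContDiff ℝ ∞ g
  map_zero : g 0 = 0
  nonneg : 0 ≤ Γ
  half : ∀ x, 2 * hNorm (1 / 2) x ≤ 1 → ∀ v,
    hNorm (1 / 2) (fderiv ℝ g x v) ≤ (2 * hNorm (1 / 2) x) ^ (2 * p) * Γ * hNorm (1 / 2) v
  neg_half : ∀ x, 2 * hNorm (1 / 2) x ≤ 1 → ∀ v,
    hNorm (-(1 / 2)) (fderiv ℝ g x v) ≤ (2 * hNorm (1 / 2) x) ^ (2 * p) * Γ * hNorm (-(1 / 2)) v
  antisymm : ∀ x y z,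
    l2 (Complex.I • fderiv ℝ g x y) z + l2 (Complex.I • y) (fderiv ℝ g x z) = 0

variable {g : Phase M → Phase M} {Γ : ℝ}

theorem IsFieldBound.neg (h : IsFieldBound p g Γ) : IsFieldBound p (fun x => -g x) Γ := by
  have hd : ∀ x v, fderiv ℝ (fun x => -g x) x v = -fderiv ℝ g x v := fun x v => by
    rw [fderiv_fun_neg]; rfl
  refine ⟨h.contDiff.neg, by simp [h.map_zero], h.nonneg, fun x hx v => ?_, fun x hx v => ?_,
    fun x y z => ?_⟩
  · rw [hd, hNorm_neg]; exact h.half x hx v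
  · rw [hd, hNorm_neg]; exact h.neg_half x hx v
  · rw [hd, hd, smul_neg, l2_neg_left, l2_neg_right]
    linarith [h.antisymm x y z]

theorem pow_mul_le {t η Γ : ℝ} (hp : 1 ≤ p) (ht0 : 0 ≤ t) (ht : t ≤ 1) (htη : t * Γ ≤ η)
    (hΓ : 0 ≤ Γ) : t ^ (2 * p) * Γ ≤ η := by
  have : t ^ (2 * p) ≤ t := by
    simpa using pow_le_pow_of_le_one ht0 ht (show 1 ≤ 2 * p by omega)
  exact (mul_le_mul_of_nonneg_right this hΓ).trans htη

/-- The bound on the differential is integrated from 0 to m inside the ball of radius 4‖u‖. Writing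
8‖u‖ = (‖u‖/η)(8η) separates the required power from a factor made at most 1 by the smallness of ε.
The case u = 0 is apart because that ball is then empty. -/
theorem IsFieldBound.two_mul_le (h : IsFieldBound p g Γ) (hp : 1 ≤ p) {ε η : ℝ} (hε : 0 < η)
    (hηε : η ≤ 2 * ε) (h16 : 16 * ε ≤ 1) (h64 : 64 * ε * Γ ≤ 1) {m u : Phase M}
    (hm : hNorm (1 / 2) m ≤ 2 * hNorm (1 / 2) u) (hu : u ∈ hBall M η) :
    2 * hNorm (1 / 2) (g m) ≤ (hNorm (1 / 2) u / η) ^ (2 * p) * hNorm (1 / 2) u := by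
  have hu' : hNorm (1 / 2) u < η := hu
  have hΓ := h.nonneg
  set t := hNorm (1 / 2) u with ht
  have ht0 : 0 ≤ t := hNorm_nonneg _ _
  have hm0 := hNorm_nonneg (1 / 2) m
  rcases ht0.eq_or_lt with h0 | h0
  · have hmz : m = 0 := hNorm_eq_zero.mp (le_antisymm (by linarith) hm0)
    rw [hmz, h.map_zero, hNorm_zero, ← h0]
    simp
  have h1 := hNorm_sub_le_of_fderiv_le h.contDiff (ρ := 4 * t) (c := (8 * t) ^ (2 * p) * Γ)
    (by positivity)
    (fun x hx v => by
      have hx' : hNorm (1 / 2) x < 4 * t := hx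
      refine (h.half x (by linarith) v).trans ?_
      refine mul_le_mul_of_nonneg_right (mul_le_mul_of_nonneg_right ?_ hΓ) (hNorm_nonneg _ _)
      exact pow_le_pow_left₀ (by linarith [hNorm_nonneg (1 / 2) x]) (by linarith) _)
    (show m ∈ hBall M (4 * t) from lt_of_le_of_lt hm (by linarith))
    (show (0 : Phase M) ∈ hBall M (4 * t) by simp [hBall, h0])
  rw [h.map_zero, sub_zero, sub_zero] at h1
  have h2 : (8 * η) ^ (2 * p) * (4 * Γ) ≤ 1 :=
    pow_mul_le hp (by positivity) (by linarith) (by nlinarith) (by positivity)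
  have h3 : (8 * t) ^ (2 * p) * (4 * Γ) ≤ (t / η) ^ (2 * p) := by
    have : 8 * t = (t / η) * (8 * η) := by field_simp
    rw [this, mul_pow, mul_assoc]
    exact mul_le_of_le_one_right (by positivity) h2
  calc 2 * hNorm (1 / 2) (g m) ≤ 2 * ((8 * t) ^ (2 * p) * Γ * (2 * t)) := by
        have := mul_le_mul_of_nonneg_left hm (by positivity : 0 ≤ (8 * t) ^ (2 * p) * Γ)
        linarith
    _ = (8 * t) ^ (2 * p) * (4 * Γ) * t := by ring
    _ ≤ (t / η) ^ (2 * p) * t := mul_le_mul_of_nonneg_right h3 ht0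

theorem IsFieldBound.half_le (h : IsFieldBound p g Γ) (hp : 1 ≤ p) {ε : ℝ} (h16 : 16 * ε ≤ 1)
    (h64 : 64 * ε * Γ ≤ 1) {x : Phase M} (hx : x ∈ hBall M (4 * ε)) (v : Phase M) :
    hNorm (1 / 2) (fderiv ℝ g x v) ≤ 1 / 2 * hNorm (1 / 2) v ∧
      hNorm (-(1 / 2)) (fderiv ℝ g x v) ≤ 1 / 2 * hNorm (-(1 / 2)) v := by
  have hx' : hNorm (1 / 2) x < 4 * ε := hx
  have hx0 := hNorm_nonneg (1 / 2) x
  have hΓ := h.nonneg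
  have h1 : (2 * hNorm (1 / 2) x) ^ (2 * p) * Γ ≤ 1 / 2 :=
    pow_mul_le hp (by positivity) (by linarith) (by nlinarith) hΓ
  exact ⟨(h.half x (by linarith) v).trans (mul_le_mul_of_nonneg_right h1 (hNorm_nonneg _ _)),
    (h.neg_half x (by linarith) v).trans (mul_le_mul_of_nonneg_right h1 (hNorm_nonneg _ _))⟩

theorem hBall_mono {ε η : ℝ} (h : ε ≤ η) : hBall M ε ⊆ hBall M η := fun _ hu => lt_of_lt_of_le hu h

/-- The Cayley transform of `g` and its inverse, with the midpoint map `G`. -/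
theorem IsFieldBound.exists_transform (hM : 1 ≤ M) (hp : 1 ≤ p) (h : IsFieldBound p g Γ) {ε : ℝ}
    (hε : 0 < ε) (h16 : 16 * ε ≤ 1) (h64 : 64 * ε * Γ ≤ 1) :
    ∃ τ₀ τ₁ G : Phase M → Phase M,
      IsSmoothSymplecticOn τ₀ (hBall M ε) ∧ IsSmoothSymplecticOn τ₁ (hBall M (2 * ε)) ∧
      (∀ u ∈ hBall M ε,
        hNorm (1 / 2) (τ₀ u - u) ≤ (hNorm (1 / 2) u / ε) ^ (2 * p) * hNorm (1 / 2) u) ∧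
      (∀ u ∈ hBall M (2 * ε),
        hNorm (1 / 2) (τ₁ u - u) ≤ (hNorm (1 / 2) u / (2 * ε)) ^ (2 * p) * hNorm (1 / 2) u) ∧
      (∀ u ∈ hBall M ε, τ₀ u ∈ hBall M (2 * ε) ∧ τ₁ (τ₀ u) = u) ∧
      ContDiffOn ℝ ∞ G (hBall M (2 * ε)) ∧
      (∀ u ∈ hBall M (2 * ε), G u - g (G u) = u ∧ τ₁ u = G u + g (G u) ∧
        hNorm (1 / 2) (G u) ≤ 2 * hNorm (1 / 2) u ∧
        ∀ v, hNorm (1 / 2) (fderiv ℝ G u v) ≤ 2 * hNorm (1 / 2) v) ∧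
      (∀ u ∈ hBall M ε, ∀ v,
        hNorm (1 / 2) (fderiv ℝ τ₀ u v) ≤ 4 * hNorm (1 / 2) v ∧
        hNorm (-(1 / 2)) (fderiv ℝ τ₀ u v) ≤ 4 * hNorm (-(1 / 2)) v) ∧
      (∀ u ∈ hBall M (2 * ε), ∀ v,
        hNorm (1 / 2) (fderiv ℝ τ₁ u v) ≤ 4 * hNorm (1 / 2) v ∧
        hNorm (-(1 / 2)) (fderiv ℝ τ₁ u v) ≤ 4 * hNorm (-(1 / 2)) v) := by
  have hsub : hBall M (2 * ε) ⊆ hBall M (4 * ε) := hBall_mono (by linarith)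
  obtain ⟨G, τ₁, hG, hτ₁, H₁⟩ := exists_cayley hM h.contDiff h.map_zero (ρ := 4 * ε)
    (fun x hx v => (h.half_le hp h16 h64 hx v).1) (fun x hx v => (h.half_le hp h16 h64 hx v).2)
    h.antisymm
  -- The transform of −g exchanges the endpoints m − g(m) and m + g(m), so it inverts τ₁. Each
  -- midpoint map needs a ball twice as large as its domain, hence the radii 4ε and 2ε.
  obtain ⟨G₀, τ₀, -, hτ₀, H₀⟩ := exists_cayley hM h.neg.contDiff h.neg.map_zero (ρ := 2 * ε)
    (fun x hx v => (h.neg.half_le hp h16 h64 (hsub hx) v).1)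
    (fun x hx v => (h.neg.half_le hp h16 h64 (hsub hx) v).2) h.neg.antisymm
  rw [show 4 * ε / 2 = 2 * ε by ring] at hG hτ₁ H₁
  rw [show 2 * ε / 2 = ε by ring] at hτ₀ H₀
  have hclose₁ : ∀ u ∈ hBall M (2 * ε), hNorm (1 / 2) (τ₁ u - u) ≤
      (hNorm (1 / 2) u / (2 * ε)) ^ (2 * p) * hNorm (1 / 2) u := fun u hu => by
    obtain ⟨-, h1, h2, h3, -⟩ := H₁ u hu
    have e : τ₁ u - u = (2 : ℝ) • g (G u) := by
      rw [h2, two_smul]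
      nth_rewrite 3 [← h1]
      abel
    rw [e, hNorm_smul, abs_two]
    exact h.two_mul_le hp (by positivity) le_rfl h16 h64 h3 hu
  have hclose₀ : ∀ u ∈ hBall M ε, hNorm (1 / 2) (τ₀ u - u) ≤
      (hNorm (1 / 2) u / ε) ^ (2 * p) * hNorm (1 / 2) u := fun u hu => by
    obtain ⟨-, h1, h2, h3, -⟩ := H₀ u hu
    have e : τ₀ u - u = (2 : ℝ) • (-g (G₀ u)) := by
      rw [h2, two_smul]
      nth_rewrite 3 [← h1]
      abel
    rw [e, hNorm_smul, abs_two]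
    exact h.neg.two_mul_le hp hε (by linarith) h16 h64 h3 hu
  refine ⟨τ₀, τ₁, G, hτ₀, hτ₁, hclose₀, hclose₁, fun u hu => ?_, hG, fun u hu => ?_,
    fun u hu v => ((H₀ u hu).2.2.2.2 v).2, fun u hu v => ((H₁ u hu).2.2.2.2 v).2⟩
  · obtain ⟨hm, h1, h2, -, -⟩ := H₀ u hu
    have hu' : hNorm (1 / 2) u < ε := hu
    have hu0 := hNorm_nonneg (1 / 2) u
    have hmem : τ₀ u ∈ hBall M (2 * ε) := by
      have h3 : (hNorm (1 / 2) u / ε) ^ (2 * p) * hNorm (1 / 2) u ≤ hNorm (1 / 2) u :=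
        mul_le_of_le_one_left hu0 (pow_le_one₀ (by positivity) ((div_le_one hε).mpr hu'.le))
      have h4 := hNorm_add_le (1 / 2) (τ₀ u - u) u
      rw [sub_add_cancel] at h4
      have h5 := hclose₀ u hu
      change hNorm (1 / 2) (τ₀ u) < 2 * ε
      linarith
    refine ⟨hmem, ?_⟩
    obtain ⟨k1, k2, k3, -, -⟩ := H₁ _ hmem
    -- Both points solve x − g(x) = τ₀ u in the ball of radius 4ε, where this equation has at most
    -- one solution: the two maps share their midpoint.
    have heq : G (τ₀ u) = G₀ u := by
      refine eq_of_sub_eq h.contDiff (fun x hx v => (h.half_le hp h16 h64 hx v).1) k1 (hsub hm) ?_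
      rw [k2, h2, sub_eq_add_neg]
    rw [k3, heq]
    rwa [sub_neg_eq_add] at h1
  · obtain ⟨-, h1, h2, h3, h4⟩ := H₁ u hu
    exact ⟨h1, h2, h3, fun v => (h4 v).1⟩

/-! ### The normal form read in the midpoint variable. -/

variable {w : ℕ+ → ℝ} {N D n e : ℕ} {K : ℝ} {P χ Q : MvPolynomial (Var M) ℂ}

theorem IsNormalForm.isFieldBound (h : IsNormalForm w N p n P (K ^ e) χ Q)
    (hK : IsControl M N D w K) (hn : 2 * (p + n) ≤ D) (hJ : ∑ v : Var M, 1 / japV v ≤ K) :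
    IsFieldBound p (vfield χ) (K ^ (e + 2 * D + 8)) := by
  have hD : ∀ γ ∈ χ.support, γ.degree ≤ D := fun γ hγ => (h.degree_gen γ hγ).trans hn
  have hK0 : 0 ≤ K := by linarith [hK.two_le]
  exact ⟨contDiff_vfield χ, vfield_zero (Ideal.pow_le_pow_right (by omega) h.order_gen),
    by positivity,
    fun x hx v => hNorm_half_fderiv_vfield_le h.coeff_gen hD h.order_gen hK.degree_le hK.kernel hJ
      hK.two_le hx v,
    fun x hx v => hNorm_neg_half_fderiv_vfield_le h.coeff_gen hD h.order_gen hK.degree_le hK.kernel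
      hJ hK.two_le hx v, fun x y z => vfield_antisymm h.ham_gen x y z⟩

/-- The remainder in the midpoint variable. -/
theorem IsNormalForm.majLE_remainder (h : IsNormalForm w N p n P (K ^ e) χ Q)
    (hK : IsControl M N D w K) (he : 1 ≤ e) (hPD : ∀ γ ∈ P.support, γ.degree ≤ D)
    (hPK : MajLE P K) (hn : 2 * (p + n) ≤ D) :
    MajLE (homOp w χ + substDiff P χ Q) (K ^ ((e + D + 3) * D + e + 1)) := by
  intro x hx hx1
  refine (maj_le_of_coeff_le (fun γ => ?_) hx).trans (majLE_substDiff hK he hPD hPK hn h x hx hx1)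
  rcases lt_or_ge (2 * (p + n)) γ.degree with hγ | hγ
  · rw [coeff_remainder h hγ]
  · rw [(mem_pow_idealOfVars_iff' _ _).mp h.remainder γ (by omega), norm_zero]
    exact norm_nonneg _

/-- The energy identity in the midpoint variable. -/
theorem IsNormalForm.energy_eq (h : IsNormalForm w N p n P (K ^ e) χ Q) (m : Phase M) :
    Z2 w (m + vfield χ m) + reEval P (m + vfield χ m) =
      Z2 w (m - vfield χ m) + reEval Q (m - vfield χ m) +
        reEval (homOp w χ + substDiff P χ Q) m := by
  have h1 := Z2_add_sub w h.ham_gen m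
  have h2 := congrArg Complex.re (eval_add_smul_vfield h.ham_gen 1 m P)
  have h3 := congrArg Complex.re (eval_add_smul_vfield h.ham_gen (-1) m Q)
  rw [one_smul] at h2
  rw [neg_one_smul, ← sub_eq_add_neg] at h3
  simp only [reEval, substDiff, map_add, map_sub, Complex.add_re, Complex.sub_re] at h1 h2 h3 ⊢
  linarith

/-- By parity E has order 2(p + n) + 2, so its differential has order 2(p + n) + 1, one more than
required; the spare factor ‖u‖ ≤ 1 is dropped. The midpoint map and its differential each cost a
factor 2 by the chain rule. -/
theorem IsNormalForm.hNorm_grad_remainder_le (h : IsNormalForm w N p n P (K ^ e) χ Q)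
    (hP : IsHamPoly P)
    (hK : IsControl M N D w K) (he : 1 ≤ e) (hPD : ∀ γ ∈ P.support, γ.degree ≤ D)
    (hPK : MajLE P K) (hn : 2 * (p + n) ≤ D) (hJ : ∑ v : Var M, 1 / japV v ≤ K)
    {G : Phase M → Phase M} {u : Phase M} (hG : DifferentiableAt ℝ G u)
    (hGu : hNorm (1 / 2) (G u) ≤ 2 * hNorm (1 / 2) u)
    (hdG : ∀ v, hNorm (1 / 2) (fderiv ℝ G u v) ≤ 2 * hNorm (1 / 2) v)
    (hu : 8 * K * hNorm (1 / 2) u ≤ 1) :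
    hNorm (-(1 / 2)) (grad (fun u => reEval (homOp w χ + substDiff P χ Q) (G u)) u) ≤
      K ^ ((e + D + 3) * D + e + 9 + 8 * (p + n) + 4) *
        hNorm (1 / 2) u ^ (2 * (p + n)) := by
  set E := homOp w χ + substDiff P χ Q with hE
  have hK2 := hK.two_le
  have hK0 : 0 ≤ K := by linarith
  have hu0 := hNorm_nonneg (1 / 2) u
  have hG0 := hNorm_nonneg (1 / 2) (G u)
  have hEham : IsHamPoly E :=
    (isHamPoly_homOp h.ham_gen w).add (isHamPoly_substDiff hP h.ham_gen h.ham_nf)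
  have hEord := hEham.mem_pow_even h.remainder
  have hEmaj := h.majLE_remainder hK he hPD hPK hn
  set B := K ^ ((e + D + 3) * D + e + 1) with hB
  have hB0 : 0 ≤ B := by positivity
  have hmid : 4 * K * hNorm (1 / 2) (G u) ≤ 8 * K * hNorm (1 / 2) u := by nlinarith
  have h8 : 8 * K ≤ K ^ 4 := by
    have : 2 ^ 3 ≤ K ^ 3 := pow_le_pow_left₀ (by norm_num) hK2 3
    nlinarith
  have hu1 : hNorm (1 / 2) u ≤ 1 := by nlinarith
  have key : 8 * B * K * (8 * K * hNorm (1 / 2) u) ^ (2 * (p + n) + 1) ≤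
      K ^ ((e + D + 3) * D + e + 9 + 8 * (p + n) + 4) * hNorm (1 / 2) u ^ (2 * (p + n)) := by
    have h1 : hNorm (1 / 2) u ^ (2 * (p + n) + 1) ≤ hNorm (1 / 2) u ^ (2 * (p + n)) :=
      pow_le_pow_of_le_one hu0 hu1 (Nat.le_succ _)
    have h2 : (8 * K) ^ (2 * (p + n) + 1) ≤ (K ^ 4) ^ (2 * (p + n) + 1) :=
      pow_le_pow_left₀ (by positivity) h8 _
    have hK1 : 1 ≤ K := by linarith
    calc 8 * B * K * (8 * K * hNorm (1 / 2) u) ^ (2 * (p + n) + 1)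
        = B * (8 * K) * (8 * K) ^ (2 * (p + n) + 1) * hNorm (1 / 2) u ^ (2 * (p + n) + 1) := by
          rw [mul_pow]; ring
      _ ≤ B * K ^ 4 * (K ^ 4) ^ (2 * (p + n) + 1) * hNorm (1 / 2) u ^ (2 * (p + n)) := by
          gcongr
      _ = K ^ ((e + D + 3) * D + e + 1 + 4 + 4 * (2 * (p + n) + 1)) *
            hNorm (1 / 2) u ^ (2 * (p + n)) := by
          rw [hB, ← pow_mul, ← pow_add, ← pow_add]
      _ ≤ _ := by
          refine mul_le_mul_of_nonneg_right (pow_le_pow_right₀ hK1 (by omega)) (by positivity)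
  refine hNorm_grad_le (by positivity) fun v => ?_
  have hd : fderiv ℝ (fun u => reEval E (G u)) u v = fderiv ℝ (reEval E) (G u) (fderiv ℝ G u v) := by
    have hR : DifferentiableAt ℝ (reEval E) (G u) :=
      ((contDiff_reEval E).differentiable (by simp)).differentiableAt
    have := fderiv_comp u hR hG
    exact congrArg (fun L => L v) this
  rw [hd]
  refine (abs_fderiv_reEval_le (d := 2 * (p + n) + 1) hEord hEmaj (by linarith) hJ (by linarith)
    _).trans ?_
  have hv0 := hNorm_nonneg (1 / 2) v
  refine le_trans ?_ (mul_le_mul_of_nonneg_right key hv0)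
  calc 4 * B * K * (4 * K * hNorm (1 / 2) (G u)) ^ (2 * (p + n) + 1) *
        hNorm (1 / 2) (fderiv ℝ G u v)
      ≤ 4 * B * K * (8 * K * hNorm (1 / 2) u) ^ (2 * (p + n) + 1) * (2 * hNorm (1 / 2) v) := by
        have := hdG v
        have := hNorm_nonneg (1 / 2) (fderiv ℝ G u v)
        gcongr
    _ = _ := by ring

end Transformation

end LowRegBNF
end

/-! ### The normal form theorem. -/

open LowRegBNF in
theorem theorem4p1 (p r : ℕ) (hp : 1 ≤ p) (hr : 1 ≤ r) :
    ∃ b : ℝ, 0 < b ∧ ∀ C₀ β ρ : ℝ, 0 < C₀ → 0 < β → 0 < ρ →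
    ∃ C : ℝ, 0 < C ∧
      ∀ N : ℕ, 1 ≤ N →
      ∀ V : ℝ → ℝ, IsPotential V → hatH1Norm V ≤ ρ →
      ∀ w : ℕ+ → ℝ, IsSpectrum V w → NonResonant w (r + p) N β →
      ∀ M : ℕ, 2 ≤ M →
      ∀ P : Ham M (p + 1), P.norm ≤ C₀ →
      ∃ (ε₀ : ℝ) (τ₀ τ₁ : Phase M → Phase M) (Q : (n : ℕ) → Ham M n) (R : Phase M → ℝ),
        1 / (C * Real.log M ^ b) ≤ ε₀ ∧
        -- smooth symplectic maps
        IsSmoothSymplecticOn τ₀ (hBall M ε₀) ∧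
        IsSmoothSymplecticOn τ₁ (hBall M (2 * ε₀)) ∧
        -- close to the identity
        (∀ u ∈ hBall M ε₀,
          hNorm (1 / 2) (τ₀ u - u) ≤ (hNorm (1 / 2) u / ε₀) ^ (2 * p) * hNorm (1 / 2) u) ∧
        (∀ u ∈ hBall M (2 * ε₀),
          hNorm (1 / 2) (τ₁ u - u) ≤ (hNorm (1 / 2) u / (2 * ε₀)) ^ (2 * p) * hNorm (1 / 2) u) ∧
        -- the diagram commutes
        (∀ u ∈ hBall M ε₀, τ₀ u ∈ hBall M (2 * ε₀) ∧ τ₁ (τ₀ u) = u) ∧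
        -- the decomposition
        (∀ u ∈ hBall M (2 * ε₀),
          Z2 w (τ₁ u) + P.eval (τ₁ u) =
            Z2 w u + (∑ n ∈ Finset.Icc (p + 1) (r + p), (Q n).eval u) + R u) ∧
        -- commutation with the low actions
        (∀ q : Fin M, (mode q : ℕ) ≤ N → ∀ u : Phase M,
          poisson (action q) (fun v => ∑ n ∈ Finset.Icc (p + 1) (r + p), (Q n).eval v) u = 0) ∧
        -- the remainder
        ContDiffOn ℝ ∞ R (hBall M (2 * ε₀)) ∧
        (∀ u ∈ hBall M (2 * ε₀),
          hNorm (-(1 / 2)) (grad R u) ≤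
            C * Real.log M ^ b * hNorm (1 / 2) u ^ (2 * r + 2 * p)) ∧
        -- the differentials
        (∀ u ∈ hBall M ε₀, ∀ v : Phase M,
          hNorm (1 / 2) (fderiv ℝ τ₀ u v) ≤ 4 ^ r * hNorm (1 / 2) v ∧
          hNorm (-(1 / 2)) (fderiv ℝ τ₀ u v) ≤ 4 ^ r * hNorm (-(1 / 2)) v) ∧
        (∀ u ∈ hBall M (2 * ε₀), ∀ v : Phase M,
          hNorm (1 / 2) (fderiv ℝ τ₁ u v) ≤ 4 ^ r * hNorm (1 / 2) v ∧
          hNorm (-(1 / 2)) (fderiv ℝ τ₁ u v) ≤ 4 ^ r * hNorm (-(1 / 2)) v) := by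
  obtain ⟨e, he, hNF⟩ := exists_isNormalForm p (2 * (r + p)) r hp (by omega)
  set D := 2 * (r + p) with hD
  set a := e + 2 * D + 8 with ha
  set c := (e + D + 3) * D + e + 9 + 8 * (p + r) + 4 with hc
  -- The exponent a bounds the vector field, c the gradient of the remainder, and the extra 8 leaves
  -- at least the K⁶ ≥ 64 needed for the smallness conditions. None of them depends on C₀, β or ρ,
  -- which enter only through K = C log M.
  refine ⟨((a + c + 8 : ℕ) : ℝ), by positivity, fun C₀ β ρ hC₀ hβ hρ => ?_⟩
  obtain ⟨C, hC1, hctl⟩ := exists_isControl (r + p) hC₀ hβ hρ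
  refine ⟨C ^ (a + c + 8), by positivity, ?_⟩
  intro N _ V hV hVρ w hw hres M hM P hP
  obtain ⟨hK, hJ, hCK⟩ := hctl M N w hM (fun k => hw.abs_sub_le hV hVρ k) hres
  rw [Real.rpow_natCast, ← mul_pow]
  set K := C * Real.log M with hKdef
  have hK2 := hK.two_le
  have hK0 : 0 < K := by linarith
  have hK1 : 1 ≤ K := by linarith
  have hPdeg : ∀ γ ∈ P.poly.support, γ.degree ≤ D := fun γ hγ => by
    rw [P.degree_poly hγ]; omega
  have hPmaj : MajLE P.poly K := P.majLE_poly hK0.le (hP.trans hCK)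
  have hPham := P.isHamPoly_poly
  obtain ⟨χ, q, h⟩ := hNF M N w K P.poly hK hPham P.poly_mem_pow hPdeg hPmaj
  have hn : 2 * (p + r) ≤ D := by omega
  set ε : ℝ := 1 / K ^ (a + c + 8) with hεdef
  have hε : 0 < ε := by positivity
  have hεle : ∀ k ≤ a + c + 8, ε * K ^ k ≤ 1 / K ^ (a + c + 8 - k) := fun k hk => by
    rw [hεdef, div_mul_eq_mul_div, one_mul, div_le_div_iff₀ (by positivity) (by positivity),
      one_mul, ← pow_add, Nat.add_sub_cancel' hk]
  have hpow : ∀ k, 6 ≤ k → 64 ≤ K ^ k := fun k hk => by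
    calc (64 : ℝ) = 2 ^ 6 := by norm_num
      _ ≤ K ^ 6 := pow_le_pow_left₀ (by norm_num) hK2 6
      _ ≤ K ^ k := pow_le_pow_right₀ hK1 hk
  have hsmall : ∀ k ≤ a + c + 2, 64 * ε * K ^ k ≤ 1 := fun k hk => by
    have h1 := hεle k (by omega)
    have h2 := hpow (a + c + 8 - k) (by omega)
    have h3 : 1 / K ^ (a + c + 8 - k) ≤ 1 / 64 := one_div_le_one_div_of_le (by norm_num) h2
    linarith
  have h64 := hsmall 0 (by omega)
  have h64K := hsmall 1 (by omega)
  rw [pow_zero, mul_one] at h64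
  rw [pow_one] at h64K
  obtain ⟨τ₀, τ₁, G, s₀, s₁, c₀, c₁, hdiag, hG, hGu, d₀, d₁⟩ :=
    (h.isFieldBound hK hn hJ).exists_transform (by omega) hp hε (by linarith)
      (hsmall a (by omega))
  -- A single Cayley transform already has differentials bounded by 4, whatever r is.
  have h4r : (4 : ℝ) ≤ 4 ^ r := le_self_pow₀ (by norm_num) (by omega)
  have hQ : ∀ u, ∑ n ∈ Finset.Icc (p + 1) (r + p), (hamOfPoly q h.ham_nf n).eval u = reEval q u :=
    fun u => sum_eval_hamOfPoly h.ham_nf h.order_nf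
      (fun γ hγ => (h.degree_nf γ hγ).trans (by omega)) u
  refine ⟨ε, τ₀, τ₁, fun n => hamOfPoly q h.ham_nf n,
    fun u => reEval (homOp w χ + substDiff P.poly χ q) (G u), le_rfl, s₀, s₁, c₀, c₁, hdiag,
    fun u hu => ?_, fun k hk u => ?_, (contDiff_reEval _).comp_contDiffOn hG, fun u hu => ?_,
    fun u hu v => ⟨(d₀ u hu v).1.trans ?_, (d₀ u hu v).2.trans ?_⟩,
    fun u hu v => ⟨(d₁ u hu v).1.trans ?_, (d₁ u hu v).2.trans ?_⟩⟩
  · obtain ⟨h1, h2, -, -⟩ := hGu u hu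
    have h3 := h.energy_eq (G u)
    rw [h1, ← h2, Ham.reEval_poly] at h3
    rw [hQ, h3]
  · simp only [hQ]
    exact poisson_action_reEval (fun γ hγ => h.resonant γ hγ k hk) u
  · obtain ⟨-, -, h3, h4⟩ := hGu u hu
    have hu' : hNorm (1 / 2) u < 2 * ε := hu
    have hdiff : DifferentiableAt ℝ G u :=
      (hG.contDiffAt ((isOpen_hBall _).mem_nhds hu)).differentiableAt (by simp)
    have h5 := h.hNorm_grad_remainder_le hPham hK he hPdeg hPmaj hn hJ hdiff h3 h4
      (by nlinarith [hNorm_nonneg (1 / 2) u])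
    refine h5.trans ?_
    rw [show 2 * r + 2 * p = 2 * (p + r) by ring]
    exact mul_le_mul_of_nonneg_right (pow_le_pow_right₀ hK1
      ((Nat.le_add_left c a).trans (Nat.le_add_right _ 8))) (pow_nonneg (hNorm_nonneg _ _) _)
  all_goals exact mul_le_mul_of_nonneg_right h4r (hNorm_nonneg _ _)
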